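/- Let $n\ge 2$, let $\Omega\subset\mathbb{R}^n$ be a bounded domain with Lipschitz boundary, and let $A$ be an open set with $\overline A\subset\Omega$, with Lipschitz boundary and finitely many connected components, such that $B:=\Omega\setminus\overline A$ is connected. Let $1<p<q<\infty$ and let $Q_B:B\times[0,\infty)\to\mathbb{R}$ and $Q_A:A\times[0,\infty)\to\mathbb{R}$ satisfy: (A1) $Q_B$ and $Q_A$ are Carathéodory functions: measurable in $x$ for every $E\ge 0$, and continuous in $E$ for a.e. $x$; (A2) for a.e. $x\in B$ (resp. a.e. $x\in A$) the function $E\mapsto Q_B(x,E)$ (resp. $E\mapsto Q_A(x,E)$) is $C^1$ and strictly convex on $[0,\infty)$, vanishes at $E=0$ and is positive for $E>0$; (A3) there are constants $0<\underline Q\le\overline Q$ and $E_0>0$ such that, for all $E\ge 0$, $$\underline Q\left[\left(\tfrac{E}{E_0}\right)^p-1\right]\le Q_B(x,E)\le\overline Q\left[\left(\tfrac{E}{E_0}\right)^p+1\right]\ \text{ for a.e. }x\in B,$$ $$\underline Q\left[\left(\tfrac{E}{E_0}\right)^q-1\right]\le Q_A(x,E)\le\overline Q\left[\left(\tfrac{E}{E_0}\right)^q+1\right]\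 \text{ for a.e. }x\in A;$$ (A4) there is a function $\beta$ on $B$ such that $\lim_{E\to+\infty}Q_B(x,E)/E^p=\beta(x)$ for a.e. $x\in B$. Let $f\in W^{1,p}(\Omega)$, where "$v=f$ on $\partial\Omega$" means $v-f\in W^{1,p}_0(\Omega)$. For every $\lambda>0$ let $v^\lambda$ be the minimizer of $$\mathbb{G}^\lambda(v)=\frac{1}{\lambda^p}\left(\int_B Q_B(x,\lambda|\nabla v(x)|)\,dx+\int_A Q_A(x,\lambda|\nabla v(x)|)\,dx\right)\in[0,+\infty]$$ over all $v\in W^{1,p}(\Omega)$ with $v=f$ on $\partial\Omega$. Then the problem of minimizing $\int_B\beta(x)|\nabla v(x)|^p\,dx$ over all $v\in W^{1,p}(\Omega)$ with $v=f$ on $\partial\Omega$ and $\nabla v=0$ a.e. in $A$ has a unique solution $w$; this $w$ is (a.e. equal to) a constant on each connected component of $A$; and, as $\lambda\to+\infty$, $v^\lambda\rightharpoonup w$ weakly in $W^{1,p}(\Omega)$. Moreover, the restrictions to $A$ of $w$ and of $v^\lambda$, for every $\lambda>0$, belong to $W^{1,q}(A)$, and $v^\lambda\to w$ strongly in $W^{1,q}(A)$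 as $\lambda\to+\infty$. -/

import Mathlib

open MeasureTheory Set Filter Topology
open scoped ENNReal NNReal ContDiff

noncomputable section

/-- Euclidean space `ℝⁿ`. -/
abbrev Eucl (n : ℕ) : Type := EuclideanSpace ℝ (Fin n)

/-- `1 < p` supplies the condition `1 ≤ p` under which the Lebesgue spaces are normed. -/
instance factOneLeOfReal (p : ℝ) [h : Fact (1 < p)] : Fact ((1 : ℝ≥0∞) ≤ ENNReal.ofReal p) :=
  ⟨by simpa using ENNReal.ofReal_le_ofReal h.out.le⟩

section Sobolev

variable {n : ℕ}

/-- Test functions `C_c^∞(U)`. -/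
def IsTestFunction (U : Set (Eucl n)) (φ : Eucl n → ℝ) : Prop :=
  ContDiff ℝ ∞ φ ∧ HasCompactSupport φ ∧ tsupport φ ⊆ U

/-- `g` is the weak gradient of `u` in `U`: for all `φ ∈ C_c^∞(U)` and all directions `e`,
`∫_U u ∂ₑφ = - ∫_U (g · e) φ`. -/
def HasWeakGradient (U : Set (Eucl n)) (u : Eucl n → ℝ) (g : Eucl n → Eucl n) : Prop :=
  ∀ φ : Eucl n → ℝ, IsTestFunction U φ → ∀ e : Eucl n,
    ∫ x in U, u x * fderiv ℝ φ x e = - ∫ x in U, inner ℝ (g x) e * φ x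

theorem IsTestFunction.integrable_mul_fderiv {p : ℝ} [Fact (1 < p)] {U : Set (Eucl n)}
    {φ : Eucl n → ℝ} (hφ : IsTestFunction U φ) (e : Eucl n)
    (u : Lp ℝ (ENNReal.ofReal p) (volume.restrict U)) :
    Integrable (fun x => u x * fderiv ℝ φ x e) (volume.restrict U) := by
  have hu : LocallyIntegrable (u : Eucl n → ℝ) (volume.restrict U) :=
    (Lp.memLp u).locallyIntegrable Fact.out
  refine hu.integrable_smul_right_of_hasCompactSupport (g := fun x => fderiv ℝ φ x e) ?_ ?_
  · exact (hφ.1.continuous_fderiv (by simp)).clm_apply continuous_const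
  · exact hφ.2.1.fderiv_apply (𝕜 := ℝ) e

theorem IsTestFunction.integrable_inner_mul {p : ℝ} [Fact (1 < p)] {U : Set (Eucl n)}
    {φ : Eucl n → ℝ} (hφ : IsTestFunction U φ) (e : Eucl n)
    (g : Lp (Eucl n) (ENNReal.ofReal p) (volume.restrict U)) :
    Integrable (fun x => inner ℝ (g x) e * φ x) (volume.restrict U) := by
  have hg : LocallyIntegrable (fun x => inner ℝ (g x) e) (volume.restrict U) :=
    ((Lp.memLp g).inner_const e).locallyIntegrable Fact.out
  exact hg.integrable_smul_right_of_hasCompactSupport hφ.1.continuous hφ.2.1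

/-- The Sobolev space `W^{1,p}(U)`, as the space of pairs `(u, ∇u)` in `L^p(U) × L^p(U; ℝⁿ)` with
`∇u` the weak gradient of `u`. It carries the norm `max (‖u‖_{L^p}, ‖∇u‖_{L^p})`, which is
equivalent to the other usual norms of `W^{1,p}(U)`. -/
def SobolevSpace (p : ℝ) [Fact (1 < p)] (U : Set (Eucl n)) :
    Submodule ℝ (Lp ℝ (ENNReal.ofReal p) (volume.restrict U) ×
      Lp (Eucl n) (ENNReal.ofReal p) (volume.restrict U)) where
  carrier := {z | HasWeakGradient U z.1 z.2}
  zero_mem' := by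
    intro φ _ e
    have h1 : ∀ᵐ x ∂(volume.restrict U),
        ((0 : Lp ℝ (ENNReal.ofReal p) (volume.restrict U)) : Eucl n → ℝ) x * fderiv ℝ φ x e
          = 0 := by
      filter_upwards [Lp.coeFn_zero ℝ (ENNReal.ofReal p) (volume.restrict U)] with x hx
      rw [hx, Pi.zero_apply, zero_mul]
    have h2 : ∀ᵐ x ∂(volume.restrict U),
        inner ℝ (((0 : Lp (Eucl n) (ENNReal.ofReal p) (volume.restrict U)) : Eucl n → Eucl n) x) e
          * φ x = 0 := by
      filter_upwards [Lp.coeFn_zero (Eucl n) (ENNReal.ofReal p) (volume.restrict U)] with x hx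
      rw [hx, Pi.zero_apply, inner_zero_left, zero_mul]
    change ∫ x in U, _ = - ∫ x in U, _
    rw [Prod.fst_zero, Prod.snd_zero, integral_congr_ae h1, integral_congr_ae h2]
    simp
  add_mem' := by
    rintro ⟨u, g⟩ ⟨v, h⟩ hu hv φ hφ e
    have hu' := hu φ hφ e
    have hv' := hv φ hφ e
    have h1 : ∀ᵐ x ∂(volume.restrict U), (u + v : Lp ℝ _ _) x * fderiv ℝ φ x e
        = u x * fderiv ℝ φ x e + v x * fderiv ℝ φ x e := by
      filter_upwards [Lp.coeFn_add u v] with x hx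
      rw [hx, Pi.add_apply, add_mul]
    have h2 : ∀ᵐ x ∂(volume.restrict U), inner ℝ ((g + h : Lp (Eucl n) _ _) x) e * φ x
        = inner ℝ (g x) e * φ x + inner ℝ (h x) e * φ x := by
      filter_upwards [Lp.coeFn_add g h] with x hx
      rw [hx, Pi.add_apply, inner_add_left, add_mul]
    change ∫ x in U, (u + v : Lp ℝ _ _) x * fderiv ℝ φ x e
      = - ∫ x in U, inner ℝ ((g + h : Lp (Eucl n) _ _) x) e * φ x
    rw [integral_congr_ae h1, integral_congr_ae h2,
      integral_add (hφ.integrable_mul_fderiv e u) (hφ.integrable_mul_fderiv e v),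
      integral_add (hφ.integrable_inner_mul e g) (hφ.integrable_inner_mul e h)]
    simp only at hu' hv'
    rw [hu', hv']
    ring
  smul_mem' := by
    rintro c ⟨u, g⟩ hu φ hφ e
    have hu' := hu φ hφ e
    have h1 : ∀ᵐ x ∂(volume.restrict U), (c • u : Lp ℝ _ _) x * fderiv ℝ φ x e
        = c * (u x * fderiv ℝ φ x e) := by
      filter_upwards [Lp.coeFn_smul c u] with x hx
      rw [hx, Pi.smul_apply, smul_eq_mul, mul_assoc]
    have h2 : ∀ᵐ x ∂(volume.restrict U), inner ℝ ((c • g : Lp (Eucl n) _ _) x) e * φ x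
        = c * (inner ℝ (g x) e * φ x) := by
      filter_upwards [Lp.coeFn_smul c g] with x hx
      rw [hx, Pi.smul_apply, real_inner_smul_left, mul_assoc]
    change ∫ x in U, (c • u : Lp ℝ _ _) x * fderiv ℝ φ x e
      = - ∫ x in U, inner ℝ ((c • g : Lp (Eucl n) _ _) x) e * φ x
    rw [integral_congr_ae h1, integral_congr_ae h2, integral_const_mul, integral_const_mul]
    simp only at hu'
    rw [hu']
    ring

variable {p : ℝ} [Fact (1 < p)] {U : Set (Eucl n)}

/-- The function underlying an element of `W^{1,p}(U)` (defined almost everywhere in `U`). -/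
def sobFun (u : SobolevSpace p U) : Eucl n → ℝ := u.1.1

/-- The weak gradient of an element of `W^{1,p}(U)` (defined almost everywhere in `U`). -/
def sobGrad (u : SobolevSpace p U) : Eucl n → Eucl n := u.1.2

/-- `W^{1,p}_0(U)`: the closure in `W^{1,p}(U)` of the `C¹` functions compactly supported in `U`. -/
def SobolevZero (p : ℝ) [Fact (1 < p)] (U : Set (Eucl n)) : Set (SobolevSpace p U) :=
  closure {u | ∃ φ : Eucl n → ℝ, ContDiff ℝ 1 φ ∧ HasCompactSupport φ ∧ tsupport φ ⊆ U ∧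
    sobFun u =ᵐ[volume.restrict U] φ}

/-- `u = f` on `∂U`, i.e. `u` and `f` have the same trace: `u - f ∈ W^{1,p}_0(U)`. -/
def SameTrace (u f : SobolevSpace p U) : Prop := u - f ∈ SobolevZero p U

end Sobolev

section Geometry

variable {n : ℕ}

/-- `U` has Lipschitz boundary: near each boundary point `x₀`, and with respect to some unit
vector `ν`, the set `U` is the strict epigraph (in direction `ν`) of a Lipschitz function of the
component of `x - x₀` orthogonal to `ν`. -/
def HasLipschitzBoundary (U : Set (Eucl n)) : Prop :=
  ∀ x₀ ∈ frontier U, ∃ r : ℝ, 0 < r ∧ ∃ ν : Eucl n, ‖ν‖ = 1 ∧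
    ∃ (K : ℝ≥0) (γ : Eucl n → ℝ), LipschitzWith K γ ∧
      ∀ x ∈ Metric.ball x₀ r,
        (x ∈ U ↔ γ ((x - x₀) - inner ℝ ν (x - x₀) • ν) < inner ℝ ν (x - x₀))

/-- The region `B = Ω \ closure A`. -/
def outerRegion (Ω A : Set (Eucl n)) : Set (Eucl n) := Ω \ closure A

/-- Standing assumptions on the regions: `Ω` is a bounded domain with Lipschitz boundary, `A ⊂⊂ Ω`
is open with Lipschitz boundary and finitely many connected components, and `B = Ω \ closure A` is
a domain. -/
structure IsConductorGeometry (Ω A : Set (Eucl n)) : Prop where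
  isOpen_domain : IsOpen Ω
  isConnected_domain : IsConnected Ω
  isBounded_domain : Bornology.IsBounded Ω
  lipschitz_domain : HasLipschitzBoundary Ω
  isOpen_inner : IsOpen A
  closure_inner_subset : closure A ⊆ Ω
  lipschitz_inner : HasLipschitzBoundary A
  finite_components_inner : Finite (ConnectedComponents A)
  isConnected_outer : IsConnected (outerRegion Ω A)

end Geometry

section Energy

variable {n : ℕ}

/-- Carathéodory function on `U × [0, ∞)`: (Lebesgue) measurable in `x ∈ U` for every `E ≥ 0`,
continuous in `E ∈ [0, ∞)` for almost every `x ∈ U`. -/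
def IsCaratheodory (U : Set (Eucl n)) (Q : Eucl n → ℝ → ℝ) : Prop :=
  (∀ E : ℝ, 0 ≤ E → AEMeasurable (fun x => Q x E) (volume.restrict U)) ∧
    ∀ᵐ x ∂(volume.restrict U), ContinuousOn (Q x) (Ici 0)

/-- For almost every `x ∈ U`, `E ↦ Q(x, E)` is positive, `C¹` and strictly convex, and vanishes at
`E = 0`. -/
def IsConvexDensity (U : Set (Eucl n)) (Q : Eucl n → ℝ → ℝ) : Prop :=
  ∀ᵐ x ∂(volume.restrict U), (∀ E : ℝ, 0 < E → 0 < Q x E) ∧ ContDiffOn ℝ 1 (Q x) (Ici 0) ∧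
    StrictConvexOn ℝ (Ici 0) (Q x) ∧ Q x 0 = 0

/-- Growth of order `s` with constants `c ≤ C` and reference field `E₀`: for almost every `x ∈ U`
and all `E ≥ 0`, `c [(E/E₀)^s - 1] ≤ Q(x, E) ≤ C [(E/E₀)^s + 1]`. -/
def HasGrowth (U : Set (Eucl n)) (Q : Eucl n → ℝ → ℝ) (s c C E₀ : ℝ) : Prop :=
  ∀ᵐ x ∂(volume.restrict U), ∀ E : ℝ, 0 ≤ E →
    c * ((E / E₀) ^ s - 1) ≤ Q x E ∧ Q x E ≤ C * ((E / E₀) ^ s + 1)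

/-- `β` is the asymptotic coefficient of order `s` of `Q`: `Q(x, E) / E^s → β(x)` as `E → +∞`, for
almost every `x ∈ U`. -/
def HasAsymptoticGrowth (U : Set (Eucl n)) (Q : Eucl n → ℝ → ℝ) (s : ℝ) (β : Eucl n → ℝ) : Prop :=
  ∀ᵐ x ∂(volume.restrict U), Tendsto (fun E : ℝ => Q x E / E ^ s) atTop (𝓝 (β x))

variable {p : ℝ} [Fact (1 < p)]

/-- The normalized Dirichlet energy, with values in `[0, ∞]`:
`G^λ(v) = λ^{-p} (∫_B Q_B(x, λ|∇v(x)|) dx + ∫_A Q_A(x, λ|∇v(x)|) dx)`. -/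
def normalizedEnergy (Ω A : Set (Eucl n)) (QB QA : Eucl n → ℝ → ℝ) (lam : ℝ)
    (v : SobolevSpace p Ω) : ℝ≥0∞ :=
  ENNReal.ofReal (1 / lam ^ p) *
    ((∫⁻ x in outerRegion Ω A, ENNReal.ofReal (QB x (lam * ‖sobGrad v x‖))) +
      ∫⁻ x in A, ENNReal.ofReal (QA x (lam * ‖sobGrad v x‖)))

/-- `v` minimizes the normalized energy `G^λ` over `{v ∈ W^{1,p}(Ω) : v = f on ∂Ω}`. -/
def IsNormalizedSolution (Ω A : Set (Eucl n)) (QB QA : Eucl n → ℝ → ℝ) (f : SobolevSpace p Ω)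
    (lam : ℝ) (v : SobolevSpace p Ω) : Prop :=
  SameTrace v f ∧ IsMinOn (normalizedEnergy Ω A QB QA lam) {u | SameTrace u f} v

/-- The limiting energy `∫_B β |∇v|^p dx`, with values in `[0, ∞]`. -/
def limitEnergy (Ω A : Set (Eucl n)) (β : Eucl n → ℝ) (v : SobolevSpace p Ω) : ℝ≥0∞ :=
  ∫⁻ x in outerRegion Ω A, ENNReal.ofReal (β x * ‖sobGrad v x‖ ^ p)

/-- The functions `v ∈ W^{1,p}(Ω)` with `v = f` on `∂Ω` and `∇v = 0` a.e. in `A`. -/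
def perfectConductorClass (Ω A : Set (Eucl n)) (f : SobolevSpace p Ω) : Set (SobolevSpace p Ω) :=
  {v | SameTrace v f ∧ ∀ᵐ x ∂(volume.restrict A), sobGrad v x = 0}

/-- `w` minimizes `∫_B β |∇v|^p dx` among the `v ∈ W^{1,p}(Ω)` with `v = f` on `∂Ω` and `∇v = 0`
a.e. in `A`. -/
def IsLimitSolution (Ω A : Set (Eucl n)) (β : Eucl n → ℝ) (f w : SobolevSpace p Ω) : Prop :=
  w ∈ perfectConductorClass Ω A f ∧
    IsMinOn (limitEnergy Ω A β) (perfectConductorClass Ω A f) w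

end Energy

end

/-! The normalized energies are squeezed between p-homogeneous weighted Dirichlet energies.

From below: on B let `a k` be the infimum of Q_B(x,r)/r^p over r beyond a threshold that grows with
k; these weights increase to β. On A, because q > p, Q_A(x,E) dominates (k+1)E^p up to a constant.
So the energy J_k with weight `a k` on B and k+1 on A (`conductorWeight`) satisfies J_k ≤ G^λ +
C_k/λ^p. The supremum of the J_k is the limiting energy when the gradient vanishes in A, and is
infinite otherwise (`IsConductorGeometry.iSup_gradEnergy`,
`IsConductorGeometry.sobGrad_eq_zero_of_iSup_ne_top`).

From above: the limit minimizer w has zero gradient in A, hence is a competitor whose inner energy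
is zero, and G^λ(v^λ) ≤ G^λ(w) ≤ ∫_B b_j|∇w|^p + C_j/λ^p with b_j → β. Letting λ → ∞ and then j → ∞,
the upper limit of J_k(v^λ) is at most the limiting energy of w, for each fixed k.

The J_k are uniformly convex with a modulus independent of k (`uniformlyConvexSeq_gradEnergy`): an
integrable form of the strict convexity of |·|^p bounds the gradient of a difference, and Poincaré's
inequality bounds the function. The abstract `UniformlyConvexSeq.exists_minimizer` then gives the
existence of w and the strong convergence v^λ → w in W^{1,p}(Ω), from which weak convergence
follows; applied to constant families it gives uniqueness. Completeness replaces weak compactness.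

In A the growth of order q gives ∫_A |∇v^λ|^q = O(λ^{p-q}), so the gradients tend to 0 in L^q(A). In
the Lipschitz set A the L^q norm of a function is controlled by the L^q norm of its gradient and by
its L^1 norm (`HasLipschitzBoundary.exists_lintegral_rpow_le`); this yields both the W^{1,q}(A)
regularity and the strong convergence there. -/

noncomputable section

/-! ### Minimizing suprema of uniformly convex functionals -/

section Minimization

variable {V : Type*} [NormedAddCommGroup V] [NormedSpace ℝ V]

/-- A sequence of functionals is uniformly convex on bounded sublevels, uniformly in the index:
two points of `X` at which `J k` is close to a lower bound of `J k` at their midpoint are close to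
each other. -/
def UniformlyConvexSeq (X : Set V) (J : ℕ → V → ℝ≥0∞) : Prop :=
  ∀ M : ℝ≥0, ∀ ε : ℝ, 0 < ε → ∃ δ : ℝ≥0, 0 < δ ∧ ∀ k : ℕ, ∀ u ∈ X, ∀ v ∈ X, ∀ m : ℝ≥0∞, m ≤ M →
    J k u ≤ m + δ → J k v ≤ m + δ → m ≤ J k ((1 / 2 : ℝ) • (u + v)) → ‖u - v‖ < ε

/-- Minimizers of the supremum of an increasing, uniformly convex sequence of lower semicontinuous
functionals: existence, and strong convergence of asymptotically minimizing families. -/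
theorem UniformlyConvexSeq.exists_minimizer [CompleteSpace V] {X : Set V} (hX : IsClosed X)
    (hXm : ∀ u ∈ X, ∀ v ∈ X, (1 / 2 : ℝ) • (u + v) ∈ X) {J : ℕ → V → ℝ≥0∞}
    (hJ : UniformlyConvexSeq X J) (hmono : ∀ u, Monotone fun k => J k u)
    (hlsc : ∀ k, LowerSemicontinuous (J k)) {u₀ : V} (hu₀ : u₀ ∈ X) (hfin : ⨆ k, J k u₀ ≠ ⊤) :
    ∃ w ∈ X, (∀ u ∈ X, ⨆ k, J k w ≤ ⨆ k, J k u) ∧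
      ∀ {ι : Type} (l : Filter ι) (v : ι → V), (∀ᶠ i in l, v i ∈ X) →
        (∀ k, ∀ t, ⨆ k, J k w < t → ∀ᶠ i in l, J k (v i) < t) → Tendsto v l (𝓝 w) := by
  -- The limit `L` of the infima `m k` will turn out to be the minimum of the supremum functional.
  set m : ℕ → ℝ≥0∞ := fun k => ⨅ u ∈ X, J k u with hm
  have hmm : Monotone m := fun i j hij => iInf₂_mono fun u _ => hmono u hij
  set L : ℝ≥0∞ := ⨆ k, m k with hL
  have hmL : ∀ k, m k ≤ L := fun k => le_iSup m k
  have hLe : ∀ u ∈ X, L ≤ ⨆ k, J k u := fun u hu =>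
    iSup_mono fun k => iInf₂_le u hu
  have hLt : L ≠ ⊤ := ne_top_of_le_ne_top hfin (hLe u₀ hu₀)
  have hmid : ∀ k, ∀ u ∈ X, ∀ v ∈ X, m k ≤ J k ((1 / 2 : ℝ) • (u + v)) := fun k u hu v hv =>
    iInf₂_le _ (hXm u hu v hv)
  have hclose : ∀ δ : ℝ≥0, 0 < δ → ∃ N, ∀ k ≥ N, L ≤ m k + δ := by
    intro δ hδ
    rcases eq_or_ne L 0 with h0 | h0
    · exact ⟨0, fun k _ => by simp [h0]⟩
    have : L - δ < L := ENNReal.sub_lt_self hLt h0 (by simpa using hδ.ne')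
    obtain ⟨N, hN⟩ := lt_iSup_iff.1 this
    exact ⟨N, fun k hk => tsub_le_iff_right.1 (hN.le.trans (hmm hk))⟩
  have hM : L = ((L.toNNReal : ℝ≥0) : ℝ≥0∞) := (ENNReal.coe_toNNReal hLt).symm
  have hex : ∀ k : ℕ, ∃ u ∈ X, J k u ≤ m k + ((1 / (k + 1 : ℝ≥0) : ℝ≥0) : ℝ≥0∞) := by
    intro k
    have hlt : m k < m k + ((1 / (k + 1 : ℝ≥0) : ℝ≥0) : ℝ≥0∞) := by
      refine ENNReal.lt_add_right (ne_top_of_le_ne_top hLt (hmL k)) ?_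
      have : (0 : ℝ≥0) < 1 / (k + 1 : ℝ≥0) := by positivity
      exact ENNReal.coe_ne_zero.2 this.ne'
    obtain ⟨u, hu⟩ := iInf_lt_iff.1 hlt
    obtain ⟨huX, hu⟩ := iInf_lt_iff.1 hu
    exact ⟨u, huX, hu.le⟩
  choose u huX hu using hex
  have htend : Tendsto (fun k : ℕ => (1 / (k + 1 : ℝ≥0) : ℝ≥0)) atTop (𝓝 0) :=
    tendsto_one_div_add_atTop_nhds_zero_nat
  -- Freeze one index N. By monotonicity J_N(u_j) ≤ J_j(u_j) ≤ L + δ/2 ≤ m_N + δ for j ≥ N, so all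
  -- later terms almost minimize the same functional J_N and uniform convexity makes them close.
  have hcauchy : CauchySeq u := by
    refine Metric.cauchySeq_iff'.2 fun ε hε => ?_
    obtain ⟨δ, hδ, H⟩ := hJ L.toNNReal ε hε
    obtain ⟨N₁, hN₁⟩ := hclose (δ / 2) (by positivity)
    have hδ2 : 0 < δ / 2 := by positivity
    obtain ⟨N₂, hN₂⟩ := eventually_atTop.1 (htend.eventually (gt_mem_nhds hδ2))
    refine ⟨max N₁ N₂, fun j hj => ?_⟩
    have key : ∀ j ≥ max N₁ N₂, J (max N₁ N₂) (u j) ≤ m (max N₁ N₂) + δ := by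
      intro j hj
      calc J (max N₁ N₂) (u j) ≤ J j (u j) := hmono _ hj
        _ ≤ m j + ((1 / (j + 1 : ℝ≥0) : ℝ≥0) : ℝ≥0∞) := hu j
        _ ≤ (m (max N₁ N₂) + (δ / 2 : ℝ≥0)) + (δ / 2 : ℝ≥0) := by
            refine add_le_add ((hmL j).trans (hN₁ _ (le_max_left _ _))) ?_
            exact_mod_cast (hN₂ j ((le_max_right _ _).trans hj)).le
        _ = m (max N₁ N₂) + δ := by
            rw [add_assoc, ← ENNReal.coe_add, add_halves]
    rw [dist_eq_norm]
    exact H _ _ (huX j) _ (huX _) _ ((hmL _).trans hM.le) (key j hj) (key _ le_rfl)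
      (hmid _ _ (huX j) _ (huX _))
  obtain ⟨w, hw⟩ := cauchySeq_tendsto_of_complete hcauchy
  have hwX : w ∈ X := hX.mem_of_tendsto hw (Eventually.of_forall huX)
  -- Lower semicontinuity is applied to the fixed J_k, while J_k(u_j) ≤ J_j(u_j) ≤ L + 1/(j+1).
  have hwL : ∀ k, J k w ≤ L := by
    intro k
    refine le_of_forall_lt fun t ht => ?_
    obtain ⟨s, hts, hs⟩ := exists_between ht
    refine hts.trans_le ?_
    have h1 : ∀ᶠ j : ℕ in atTop, s ≤ L + ((1 / (j + 1 : ℝ≥0) : ℝ≥0) : ℝ≥0∞) := by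
      filter_upwards [hw.eventually (hlsc k w s hs), eventually_ge_atTop k] with j hj hkj
      calc s ≤ J k (u j) := hj.le
        _ ≤ J j (u j) := hmono _ hkj
        _ ≤ _ := (hu j).trans (add_le_add (hmL j) le_rfl)
    have h2 : Tendsto (fun j : ℕ => L + ((1 / (j + 1 : ℝ≥0) : ℝ≥0) : ℝ≥0∞)) atTop (𝓝 (L + 0)) :=
      tendsto_const_nhds.add (ENNReal.tendsto_coe.2 htend)
    rw [add_zero] at h2
    exact ge_of_tendsto h2 h1
  have hwle : ⨆ k, J k w ≤ L := iSup_le hwL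
  have hweq : ⨆ k, J k w = L := le_antisymm hwle (hLe w hwX)
  refine ⟨w, hwX, fun v hv => hwle.trans (hLe v hv), fun l v hvX hv => ?_⟩
  rw [Metric.tendsto_nhds]
  intro ε hε
  obtain ⟨δ, hδ, H⟩ := hJ L.toNNReal ε hε
  obtain ⟨N, hN⟩ := hclose (δ / 2) (by positivity)
  -- As before, one index N suffices: both `w` and `v i` lie within δ of the infimum of J_N.
  have hlt : ⨆ k, J k w < L + (δ / 2 : ℝ≥0) := by
    rw [hweq]
    exact ENNReal.lt_add_right hLt (by simpa using hδ.ne')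
  have hδδ : L + (δ / 2 : ℝ≥0) ≤ m N + δ := by
    calc L + (δ / 2 : ℝ≥0) ≤ m N + (δ / 2 : ℝ≥0) + (δ / 2 : ℝ≥0) := by gcongr; exact hN N le_rfl
      _ = m N + δ := by rw [add_assoc, ← ENNReal.coe_add, add_halves]
  filter_upwards [hvX, hv N _ hlt] with i hiX hi
  rw [dist_eq_norm]
  exact H N _ hiX _ hwX _ ((hmL _).trans hM.le) (hi.le.trans hδδ)
    ((hwL N).trans (le_self_add.trans hδδ)) (hmid _ _ hiX _ hwX)

end Minimization

/-! ### Quantitative convexity of powers of the norm, and Jensen's inequality -/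

section Convexity

/-- Uniform strict convexity of `‖·‖ ^ p`, in a form that can be integrated. -/
theorem exists_norm_sub_rpow_add_le {E : Type*} [NormedAddCommGroup E] [InnerProductSpace ℝ E]
    [FiniteDimensional ℝ E] {p : ℝ} (hp : 1 < p) {ε : ℝ} (hε : 0 < ε) :
    ∃ C : ℝ, 0 ≤ C ∧ ∀ x y : E, ‖x - y‖ ^ p + C * ‖(1 / 2 : ℝ) • (x + y)‖ ^ p ≤
      (ε + C / 2) * (‖x‖ ^ p + ‖y‖ ^ p) := by
  have hp0 : 0 < p := by linarith
  have hconv : ∀ a b : ℝ, 0 ≤ a → 0 ≤ b → a ≠ b →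
      ((a + b) / 2) ^ p < (a ^ p + b ^ p) / 2 := by
    intro a b ha hb hab
    have h2 : (0 : ℝ) < 1 / 2 := by norm_num
    have := (strictConvexOn_rpow hp).2 ha hb hab h2 h2 (by norm_num)
    simp only [smul_eq_mul] at this
    calc ((a + b) / 2) ^ p = (1 / 2 * a + 1 / 2 * b) ^ p := by ring_nf
      _ < _ := this
      _ = _ := by ring
  have hmidle : ∀ x y : E, ‖(1 / 2 : ℝ) • (x + y)‖ ≤ (‖x‖ + ‖y‖) / 2 := by
    intro x y
    rw [norm_smul]
    have := norm_add_le x y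
    norm_num
    linarith
  have hlt : ∀ x y : E, x ≠ y → ‖(1 / 2 : ℝ) • (x + y)‖ ^ p < (‖x‖ ^ p + ‖y‖ ^ p) / 2 := by
    intro x y hxy
    -- Equal norms use the strict convexity of the Euclidean norm, different norms that of t ↦ t^p.
    by_cases h : ‖x‖ = ‖y‖
    · have h1 : ‖(1 / 2 : ℝ) • (x + y)‖ < ‖x‖ := by
        have h2 : ‖x + y‖ < ‖x‖ + ‖y‖ := by
          refine lt_of_le_of_ne (norm_add_le x y) fun h3 => hxy ?_
          exact (sameRay_iff_norm_add.2 h3).eq_of_norm_eq h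
        rw [norm_smul]
        norm_num
        linarith
      calc _ < ‖x‖ ^ p := Real.rpow_lt_rpow (norm_nonneg _) h1 hp0
        _ = _ := by rw [← h]; ring
    · exact (Real.rpow_le_rpow (norm_nonneg _) (hmidle x y) hp0.le).trans_lt
        (hconv _ _ (norm_nonneg _) (norm_nonneg _) h)
  -- The convexity defect `F` is continuous, homogeneous of degree p, and positive off the diagonal.
  -- Compactness bounds it below on the normalized pairs that are separated by at least ε.
  set F : E × E → ℝ := fun z => (‖z.1‖ ^ p + ‖z.2‖ ^ p) / 2 - ‖(1 / 2 : ℝ) • (z.1 + z.2)‖ ^ p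
    with hF
  have hcF : Continuous F := by
    refine Continuous.sub (Continuous.div_const (Continuous.add ?_ ?_) _) ?_
    all_goals exact Continuous.rpow_const (by fun_prop) fun _ => Or.inr hp0.le
  have hF0 : ∀ z, 0 ≤ F z := by
    intro z
    by_cases h : z.1 = z.2
    · have : (1 / 2 : ℝ) • (z.2 + z.2) = z.2 := by rw [← two_smul ℝ z.2, smul_smul]; norm_num
      simp only [hF, h, this]
      linarith
    · exact (sub_pos.2 (hlt _ _ h)).le
  set S : Set (E × E) := {z | ‖z.1‖ ^ p + ‖z.2‖ ^ p = 1 ∧ ε ≤ ‖z.1 - z.2‖ ^ p} with hS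
  have hSc : IsCompact S := by
    refine Metric.isCompact_of_isClosed_isBounded ?_ ?_
    · refine IsClosed.inter (s₁ := {z : E × E | ‖z.1‖ ^ p + ‖z.2‖ ^ p = 1})
        (s₂ := {z : E × E | ε ≤ ‖z.1 - z.2‖ ^ p}) (isClosed_eq ?_ continuous_const)
        (isClosed_le continuous_const ?_)
      · refine Continuous.add ?_ ?_
        all_goals exact Continuous.rpow_const (by fun_prop) fun _ => Or.inr hp0.le
      · exact Continuous.rpow_const (by fun_prop) fun _ => Or.inr hp0.le
    · refine (Metric.isBounded_closedBall (x := (0 : E × E)) (r := 1)).subset fun z hz => ?_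
      have h1 : ∀ a b : ℝ, 0 ≤ a → 0 ≤ b → a ^ p + b ^ p = 1 → a ≤ 1 := by
        intro a b ha hb hab
        by_contra! h
        have := Real.one_lt_rpow h hp0
        have := Real.rpow_nonneg hb p
        linarith
      rw [mem_closedBall_zero_iff, Prod.norm_def]
      exact max_le (h1 _ _ (norm_nonneg _) (norm_nonneg _) hz.1)
        (h1 _ _ (norm_nonneg _) (norm_nonneg _) (by rw [add_comm]; exact hz.1))
  obtain ⟨d, hd, hdS⟩ : ∃ d : ℝ, 0 < d ∧ ∀ z ∈ S, d ≤ F z := by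
    rcases S.eq_empty_or_nonempty with h | h
    · exact ⟨1, one_pos, by simp [h]⟩
    · obtain ⟨z, hz, hmin⟩ := hSc.exists_isMinOn h hcF.continuousOn
      refine ⟨F z, sub_pos.2 (hlt _ _ fun h => ?_), fun y hy => hmin hy⟩
      have := hz.2
      rw [h, sub_self, norm_zero, Real.zero_rpow hp0.ne'] at this
      linarith
  -- The crude bound ‖x - y‖^p ≤ 2^p(‖x‖^p + ‖y‖^p) and a defect at least `d` on normalized pairs
  -- dictate this constant.
  refine ⟨2 ^ p / d, by positivity, fun x y => ?_⟩
  set C := 2 ^ p / d with hC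
  have hCpos : 0 ≤ C := by positivity
  suffices h : ‖x - y‖ ^ p ≤ ε * (‖x‖ ^ p + ‖y‖ ^ p) + C * F (x, y) by
    simp only [hF] at h
    linarith
  have hsub : ‖x - y‖ ^ p ≤ 2 ^ p * (‖x‖ ^ p + ‖y‖ ^ p) := by
    have h1 : ‖x - y‖ ≤ 2 * max ‖x‖ ‖y‖ :=
      (norm_sub_le x y).trans (by linarith [le_max_left ‖x‖ ‖y‖, le_max_right ‖x‖ ‖y‖])
    calc ‖x - y‖ ^ p ≤ (2 * max ‖x‖ ‖y‖) ^ p := Real.rpow_le_rpow (norm_nonneg _) h1 hp0.le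
      _ = 2 ^ p * (max ‖x‖ ‖y‖) ^ p := Real.mul_rpow (by norm_num) (by positivity)
      _ ≤ _ := by
        gcongr
        have := Real.rpow_nonneg (norm_nonneg x) p
        have := Real.rpow_nonneg (norm_nonneg y) p
        rcases max_choice ‖x‖ ‖y‖ with h | h <;> rw [h] <;> linarith
  by_cases hsmall : ‖x - y‖ ^ p ≤ ε * (‖x‖ ^ p + ‖y‖ ^ p)
  · have := mul_nonneg hCpos (hF0 (x, y))
    linarith
  push Not at hsmall
  set T := ‖x‖ ^ p + ‖y‖ ^ p with hT
  have hT0 : 0 ≤ T := by positivity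
  have hTpos : 0 < T := by
    rcases hT0.eq_or_lt with h | h
    · rw [← h] at hsub hsmall
      linarith
    · exact h
  -- For a pair whose separation exceeds the ε term, this scaling lands in `S`.
  set r := T ^ (-(1 / p)) with hr
  have hrpos : 0 < r := Real.rpow_pos_of_pos hTpos _
  have hrp : r ^ p = T⁻¹ := by
    rw [hr, ← Real.rpow_mul hT0, neg_mul, one_div, inv_mul_cancel₀ hp0.ne', Real.rpow_neg_one]
  have hsc : ∀ z : E, ‖r • z‖ ^ p = T⁻¹ * ‖z‖ ^ p := by
    intro z
    rw [norm_smul, Real.mul_rpow (norm_nonneg _) (norm_nonneg _), Real.norm_of_nonneg hrpos.le, hrp]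
  have hmem : (r • x, r • y) ∈ S := by
    refine ⟨?_, ?_⟩
    · simp only [hsc]
      rw [← mul_add]
      exact inv_mul_cancel₀ hTpos.ne'
    · simp only
      rw [← smul_sub, hsc, inv_mul_eq_div, le_div_iff₀ hTpos]
      exact hsmall.le
  have hFs : F (r • x, r • y) = T⁻¹ * F (x, y) := by
    simp only [hF]
    rw [← smul_add, smul_comm, hsc, hsc, hsc]
    ring
  have h3 := hdS _ hmem
  rw [hFs, inv_mul_eq_div, le_div_iff₀ hTpos] at h3
  calc ‖x - y‖ ^ p ≤ 2 ^ p * T := hsub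
    _ = C * (d * T) := by rw [hC]; field_simp
    _ ≤ C * F (x, y) := by gcongr
    _ ≤ _ := by
      have : 0 ≤ ε * T := by positivity
      linarith

/-- Jensen's inequality for `t ↦ t ^ q` and Lebesgue integrals. -/
theorem lintegral_rpow_le_measure_univ_mul {α : Type*} [MeasurableSpace α] (ν : Measure α)
    {f : α → ℝ≥0∞} (hf : AEMeasurable f ν) {q : ℝ} (hq : 1 < q) :
    (∫⁻ x, f x ∂ν) ^ q ≤ ν univ ^ (q - 1) * ∫⁻ x, f x ^ q ∂ν := by
  have hc := Real.HolderConjugate.conjExponent hq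
  have h := ENNReal.lintegral_mul_le_Lp_mul_Lq ν hc hf (aemeasurable_const (b := (1 : ℝ≥0∞)))
  simp only [Pi.mul_apply, mul_one, ENNReal.one_rpow, lintegral_const, one_mul] at h
  refine (ENNReal.rpow_le_rpow h hc.nonneg).trans_eq ?_
  rw [ENNReal.mul_rpow_of_nonneg _ _ hc.nonneg, ← ENNReal.rpow_mul, ← ENNReal.rpow_mul,
    one_div_mul_cancel hc.ne_zero, ENNReal.rpow_one, mul_comm]
  congr 2
  rw [Real.conjExponent]
  field_simp

end Convexity

end

noncomputable section

/-! ### Increments of weakly differentiable functions along a vector -/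

section Translation

variable {n : ℕ}

/-- For each fixed s the map is a translation. This supplies joint measurability and integrability
of G(x + sh), which functions defined only almost everywhere require before Fubini can be used. -/
theorem measurePreserving_shear (h : Eucl n) (ν : Measure ℝ) [SFinite ν] :
    MeasurePreserving (fun z : ℝ × Eucl n => (z.1, z.2 + z.1 • h)) (ν.prod volume)
      (ν.prod volume) :=
  (MeasurePreserving.id ν).skew_product (g := fun s x => x + s • h) (by fun_prop)
    (Eventually.of_forall fun s => map_add_right_eq_self volume (s • h))

theorem quasiMeasurePreserving_shear (h : Eucl n) (ν : Measure ℝ) [SFinite ν] :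
    Measure.QuasiMeasurePreserving (fun z : ℝ × Eucl n => z.2 + z.1 • h) (ν.prod volume) volume :=
  Measure.quasiMeasurePreserving_snd.comp (measurePreserving_shear h ν).quasiMeasurePreserving

theorem integrable_shear {h : Eucl n} {G : Eucl n → ℝ} (hG : Integrable G) (ν : Measure ℝ)
    [IsFiniteMeasure ν] : Integrable (fun z : ℝ × Eucl n => G (z.2 + z.1 • h)) (ν.prod volume) :=
  (measurePreserving_shear h ν).integrable_comp_of_integrable (hG.comp_snd ν)

theorem IsTestFunction.comp_sub {S U : Set (Eucl n)} {φ : Eucl n → ℝ} (hφ : IsTestFunction S φ)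
    {a : Eucl n} (hSU : ∀ x ∈ S, x + a ∈ U) : IsTestFunction U fun x => φ (x - a) := by
  refine ⟨hφ.1.comp (contDiff_id.sub contDiff_const),
    hφ.2.1.comp_homeomorph (Homeomorph.subRight a), fun x hx => ?_⟩
  have h1 : tsupport (fun x => φ (x - a)) = (Homeomorph.subRight a) ⁻¹' tsupport φ :=
    tsupport_comp_eq_preimage φ (Homeomorph.subRight a)
  rw [h1] at hx
  have := hSU _ (hφ.2.2 hx)
  simpa using this

theorem IsTestFunction.exists_bound_fderiv {U : Set (Eucl n)} {φ : Eucl n → ℝ}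
    (hφ : IsTestFunction U φ) (e : Eucl n) : ∃ K, ∀ x, ‖fderiv ℝ φ x e‖ ≤ K := by
  refine (hφ.2.1.fderiv_apply (𝕜 := ℝ) e).exists_bound_of_continuous ?_
  exact (hφ.1.continuous_fderiv (by simp)).clm_apply continuous_const

/-- A weakly differentiable function is the integral of its weak gradient along almost all
segments in a given direction. -/
theorem HasWeakGradient.sub_eq_integral {U S : Set (Eucl n)} (hU : MeasurableSet U) (hS : IsOpen S)
    {u : Eucl n → ℝ} {g : Eucl n → Eucl n} (hu : IntegrableOn u U) (hg : IntegrableOn g U)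
    (hug : HasWeakGradient U u g) {h : Eucl n}
    (hseg : ∀ x ∈ S, ∀ s ∈ Icc (0 : ℝ) 1, x + s • h ∈ U) :
    ∀ᵐ x ∂(volume.restrict S), u (x + h) - u x =
      ∫ s in Icc (0 : ℝ) 1, inner ℝ (U.indicator g (x + s • h)) h := by
  set V : Eucl n → ℝ := U.indicator u with hV
  set G : Eucl n → ℝ := fun x => inner ℝ (U.indicator g x) h with hG
  have hVi : Integrable V := hu.integrable_indicator hU
  have hGi : Integrable G := (hg.integrable_indicator hU).inner_const h
  set ν : Measure ℝ := volume.restrict (Icc (0 : ℝ) 1) with hν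
  have hGν := integrable_shear (h := h) hGi ν
  have hint : Integrable (fun x => V (x + h) - V x - ∫ s, G (x + s • h) ∂ν) :=
    ((hVi.comp_add_right h).sub hVi).sub hGν.integral_prod_right
  suffices H : ∀ᵐ x, x ∈ S → V (x + h) - V x - ∫ s, G (x + s • h) ∂ν = 0 by
    rw [ae_restrict_iff' hS.measurableSet]
    filter_upwards [H] with x hx hxS
    have h0 : x ∈ U := by simpa using hseg x hxS 0 (by simp)
    have h1 : x + h ∈ U := by simpa using hseg x hxS 1 (by simp)
    have := hx hxS
    simp only [hV, indicator_of_mem h0, indicator_of_mem h1] at this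
    exact sub_eq_zero.1 this
  -- By the fundamental lemma of the calculus of variations, it is enough to test the identity
  -- against smooth φ supported in `S`.
  refine hS.ae_eq_zero_of_integral_contDiff_smul_eq_zero
    (hint.locallyIntegrable.locallyIntegrableOn S) fun φ hφ1 hφ2 hφ3 => ?_
  have hφ : IsTestFunction S φ := ⟨hφ1, hφ2, hφ3⟩
  obtain ⟨K, hK⟩ := hφ.exists_bound_fderiv h
  obtain ⟨K₀, hK₀⟩ := hφ2.exists_bound_of_continuous hφ1.continuous
  have hφd : Differentiable ℝ φ := hφ1.differentiable (by simp)
  have hcfd : Continuous fun x => fderiv ℝ φ x h :=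
    (hφ1.continuous_fderiv (by simp)).clm_apply continuous_const
  have hmul : ∀ {W : Eucl n → ℝ} {ψ : Eucl n → ℝ}, Integrable W → Continuous ψ → ∀ {K : ℝ},
      (∀ x, ‖ψ x‖ ≤ K) → Integrable fun x => W x * ψ x := fun {W ψ} hW hψ {K} hb =>
    hW.mul_bdd (c := K) hψ.aestronglyMeasurable (Eventually.of_forall hb)
  have hGφ : Integrable (fun z : ℝ × Eucl n => G (z.2 + z.1 • h) * φ z.2) (ν.prod volume) :=
    hGν.mul_bdd (c := K₀) (hφ1.continuous.comp continuous_snd).aestronglyMeasurable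
      (Eventually.of_forall fun z => hK₀ z.2)
  -- Moving the translation onto φ makes the integral differentiable in s although `u` is only
  -- weakly differentiable. Its derivative is then rewritten through the weak gradient, and
  -- integrated over [0,1].
  set I : ℝ → ℝ := fun s => ∫ x, V x * φ (x - s • h) with hI
  have hder : ∀ s, HasDerivAt I (∫ x, V x * -(fderiv ℝ φ (x - s • h) h)) s := by
    intro s
    refine (hasDerivAt_integral_of_dominated_loc_of_deriv_le (s := univ)
      (F := fun s x => V x * φ (x - s • h)) (F' := fun s x => V x * -(fderiv ℝ φ (x - s • h) h))
      (bound := fun x => ‖V x‖ * K) univ_mem ?_ ?_ ?_ ?_ ?_ ?_).2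
    · refine Eventually.of_forall fun t => hVi.1.mul ?_
      exact (hφ1.continuous.comp (by fun_prop)).aestronglyMeasurable
    · exact hmul hVi (hφ1.continuous.comp (by fun_prop)) fun x => hK₀ _
    · exact hVi.1.mul (hcfd.comp (by fun_prop)).neg.aestronglyMeasurable
    · refine Eventually.of_forall fun x t _ => ?_
      rw [norm_mul, norm_neg]
      exact mul_le_mul_of_nonneg_left (hK _) (norm_nonneg _)
    · exact hVi.norm.mul_const K
    · refine Eventually.of_forall fun x t _ => ?_
      have h1 : HasDerivAt (fun t : ℝ => x - t • h) (-h) t := by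
        simpa using ((hasDerivAt_id t).smul_const h).const_sub x
      have h2 := ((hφd (x - t • h)).hasFDerivAt.comp_hasDerivAt t h1).const_mul (V x)
      simpa using h2
  -- The translate φ(· - sh) is an admissible test function in `U` precisely because the segments
  -- starting in `S` stay in `U`.
  have hweak : ∀ s ∈ Icc (0 : ℝ) 1,
      ∫ x, V x * -(fderiv ℝ φ (x - s • h) h) = ∫ x, G (x + s • h) * φ x := by
    intro s hs
    have hw := hug _ (hφ.comp_sub (a := s • h) fun x hx => hseg x hx s hs) h
    simp only [fderiv_comp_sub] at hw
    have e1 : ∫ x in U, u x * fderiv ℝ φ (x - s • h) h = ∫ x, V x * fderiv ℝ φ (x - s • h) h := by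
      rw [← integral_indicator hU]
      congr 1 with x
      by_cases hx : x ∈ U <;> simp [hV, hx]
    have e2 : ∫ x in U, inner ℝ (g x) h * φ (x - s • h) = ∫ x, G x * φ (x - s • h) := by
      rw [← integral_indicator hU]
      congr 1 with x
      by_cases hx : x ∈ U <;> simp [hG, hx]
    rw [e1, e2] at hw
    simp only [mul_neg, integral_neg]
    rw [hw, neg_neg, ← integral_add_right_eq_self _ (s • h)]
    simp
  have hFTC : ∫ s in (0 : ℝ)..1, ∫ x, G (x + s • h) * φ x = I 1 - I 0 := by
    refine intervalIntegral.integral_eq_sub_of_hasDerivAt (fun s hs => ?_) ?_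
    · rw [uIcc_of_le zero_le_one] at hs
      rw [← hweak s hs]
      exact hder s
    · rw [intervalIntegrable_iff_integrableOn_Icc_of_le zero_le_one]
      exact hGφ.integral_prod_left
  rw [intervalIntegral.integral_of_le zero_le_one, ← integral_Icc_eq_integral_Ioc,
    integral_integral_swap (f := fun s x => G (x + s • h) * φ x) hGφ] at hFTC
  have hI1 : I 1 = ∫ x, V (x + h) * φ x := by
    simp only [hI, one_smul]
    rw [← integral_add_right_eq_self _ h]
    simp
  have hI0 : I 0 = ∫ x, V x * φ x := by simp [hI]
  have i1 := hmul (hVi.comp_add_right h) hφ1.continuous hK₀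
  have i2 := hmul hVi hφ1.continuous hK₀
  have i3 := hmul hGν.integral_prod_right hφ1.continuous hK₀
  calc ∫ x, φ x • (V (x + h) - V x - ∫ s, G (x + s • h) ∂ν)
      = ∫ x, (V (x + h) * φ x - V x * φ x - (∫ s, G (x + s • h) ∂ν) * φ x) := by
        congr 1 with x
        rw [smul_eq_mul]
        ring
    _ = 0 := by
        have e := integral_sub (i1.sub i2) i3
        simp only [Pi.sub_apply] at e
        rw [e, integral_sub i1 i2, ← hI1, ← hI0, ← hFTC]
        simp only [integral_mul_const]
        exact sub_self _

/-- The `L^q` norm of an increment along `h` is at most `‖h‖` times that of the gradient. -/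
theorem lintegral_rpow_le_of_eq_integral_segment {w : Eucl n → ℝ} {G : Eucl n → Eucl n}
    (hG : AEStronglyMeasurable G) {S : Set (Eucl n)} {h : Eucl n}
    (hw : ∀ᵐ x ∂(volume.restrict S), w x = ∫ s in Icc (0 : ℝ) 1, inner ℝ (G (x + s • h)) h)
    {q : ℝ} (hq : 1 < q) :
    ∫⁻ x in S, ‖w x‖ₑ ^ q ≤ ‖h‖ₑ ^ q * ∫⁻ x, ‖G x‖ₑ ^ q := by
  have hq0 : 0 ≤ q := by linarith
  set ν : Measure ℝ := volume.restrict (Icc (0 : ℝ) 1) with hν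
  have hν1 : ν univ = 1 := by simp [hν]
  have hmeas : AEMeasurable (fun z : ℝ × Eucl n => ‖G (z.2 + z.1 • h)‖ₑ) (ν.prod volume) :=
    (hG.comp_quasiMeasurePreserving (quasiMeasurePreserving_shear h ν)).enorm
  have hmeas' : AEMeasurable (fun z : ℝ × Eucl n => (‖h‖ₑ * ‖G (z.2 + z.1 • h)‖ₑ) ^ q)
      (ν.prod volume) := (hmeas.const_mul _).pow_const q
  have hslice : ∀ᵐ x : Eucl n, AEMeasurable (fun s : ℝ => ‖G (x + s • h)‖ₑ) ν := by
    filter_upwards [hmeas.aestronglyMeasurable.prod_swap.prodMk_left] with x hx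
    exact hx.aemeasurable
  -- Jensen on the unit segment; afterwards Fubini and translation invariance remove the dependence
  -- on s.
  have h1 : ∀ᵐ x ∂(volume.restrict S), ‖w x‖ₑ ^ q ≤ ∫⁻ s, (‖h‖ₑ * ‖G (x + s • h)‖ₑ) ^ q ∂ν := by
    filter_upwards [hw, ae_restrict_of_ae hslice] with x hx hxs
    rw [hx]
    calc ‖∫ s, inner ℝ (G (x + s • h)) h ∂ν‖ₑ ^ q
        ≤ (∫⁻ s, ‖h‖ₑ * ‖G (x + s • h)‖ₑ ∂ν) ^ q := by
          refine ENNReal.rpow_le_rpow ((enorm_integral_le_lintegral_enorm _).trans ?_) hq0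
          refine lintegral_mono fun s => ?_
          rw [mul_comm, ← ofReal_norm, ← ofReal_norm, ← ofReal_norm,
            ← ENNReal.ofReal_mul (norm_nonneg _)]
          exact ENNReal.ofReal_le_ofReal (norm_inner_le_norm _ _)
      _ ≤ _ := by
          have := lintegral_rpow_le_measure_univ_mul ν (hxs.const_mul ‖h‖ₑ) hq
          rwa [hν1, ENNReal.one_rpow, one_mul] at this
  calc ∫⁻ x in S, ‖w x‖ₑ ^ q
      ≤ ∫⁻ x in S, ∫⁻ s, (‖h‖ₑ * ‖G (x + s • h)‖ₑ) ^ q ∂ν := lintegral_mono_ae h1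
    _ ≤ ∫⁻ x, ∫⁻ s, (‖h‖ₑ * ‖G (x + s • h)‖ₑ) ^ q ∂ν := setLIntegral_le_lintegral _ _
    _ = ∫⁻ s, ∫⁻ x, (‖h‖ₑ * ‖G (x + s • h)‖ₑ) ^ q ∂volume ∂ν :=
        (lintegral_lintegral_swap hmeas').symm
    _ = ∫⁻ _, (‖h‖ₑ ^ q * ∫⁻ x, ‖G x‖ₑ ^ q) ∂ν := by
        congr 1 with s
        rw [lintegral_add_right_eq_self (fun x => (‖h‖ₑ * ‖G x‖ₑ) ^ q) (s • h)]
        simp only [ENNReal.mul_rpow_of_nonneg _ _ hq0]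
        rw [lintegral_const_mul'' _ (hG.enorm.pow_const q)]
    _ = _ := by rw [lintegral_const, hν1, mul_one]

theorem lintegral_indicator_enorm_rpow {U : Set (Eucl n)} (hU : MeasurableSet U)
    (g : Eucl n → Eucl n) {q : ℝ} (hq : 0 < q) :
    ∫⁻ x, ‖U.indicator g x‖ₑ ^ q = ∫⁻ x in U, ‖g x‖ₑ ^ q := by
  rw [← lintegral_indicator hU]
  congr 1 with x
  by_cases hx : x ∈ U <;> simp [hx, hq]

/-- `L^q` estimate of the increments of a weakly differentiable function. -/
theorem HasWeakGradient.lintegral_sub_rpow_le {U S : Set (Eucl n)} (hU : MeasurableSet U)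
    (hS : IsOpen S) {u : Eucl n → ℝ} {g : Eucl n → Eucl n} (hu : IntegrableOn u U)
    (hg : IntegrableOn g U) (hug : HasWeakGradient U u g) {h : Eucl n}
    (hseg : ∀ x ∈ S, ∀ s ∈ Icc (0 : ℝ) 1, x + s • h ∈ U) {q : ℝ} (hq : 1 < q) :
    ∫⁻ x in S, ‖u (x + h) - u x‖ₑ ^ q ≤ ‖h‖ₑ ^ q * ∫⁻ x in U, ‖g x‖ₑ ^ q := by
  have h1 := lintegral_rpow_le_of_eq_integral_segment (hg.integrable_indicator hU).1
    (hug.sub_eq_integral hU hS hu hg hseg) hq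
  rwa [lintegral_indicator_enorm_rpow hU g (by linarith)] at h1

end Translation

end

noncomputable section

/-! ### Geometry of Lipschitz boundaries -/

section LipschitzBoundary

variable {n : ℕ}

theorem inner_add_smul_unit {ν : Eucl n} (hν : ‖ν‖ = 1) (y : Eucl n) (t : ℝ) :
    inner ℝ ν (y + t • ν) = inner ℝ ν y + t := by
  rw [inner_add_right, real_inner_smul_right, real_inner_self_eq_norm_sq, hν]
  ring

theorem sub_inner_smul_add_smul_unit {ν : Eucl n} (hν : ‖ν‖ = 1) (y : Eucl n) (t : ℝ) :
    (y + t • ν) - inner ℝ ν (y + t • ν) • ν = y - inner ℝ ν y • ν := by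
  rw [inner_add_smul_unit hν, add_smul]
  abel

/-- A point strictly above the graph lies in the open set `A`, and one strictly below it has a
neighbourhood missing `A`; neither can be a frontier point. -/
theorem frontier_eq_graph {A : Set (Eucl n)} (hA : IsOpen A) {x₀ ν : Eucl n} {r : ℝ}
    {K : ℝ≥0} {γ : Eucl n → ℝ} (hγ : LipschitzWith K γ)
    (H : ∀ x ∈ Metric.ball x₀ r,
      (x ∈ A ↔ γ ((x - x₀) - inner ℝ ν (x - x₀) • ν) < inner ℝ ν (x - x₀)))
    {x : Eucl n} (hx : x ∈ frontier A) (hxr : x ∈ Metric.ball x₀ r) :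
    γ ((x - x₀) - inner ℝ ν (x - x₀) • ν) = inner ℝ ν (x - x₀) := by
  have hxA : x ∉ A := by
    rw [hA.frontier_eq] at hx
    exact hx.2
  have h1 : inner ℝ ν (x - x₀) ≤ γ ((x - x₀) - inner ℝ ν (x - x₀) • ν) := by
    by_contra! h
    exact hxA ((H x hxr).2 h)
  refine le_antisymm ?_ h1
  by_contra! h
  have hc1 : Continuous fun x : Eucl n => inner ℝ ν (x - x₀) := by fun_prop
  have hc2 : Continuous fun x : Eucl n => γ ((x - x₀) - inner ℝ ν (x - x₀) • ν) :=
    hγ.continuous.comp (by fun_prop)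
  have hev : ∀ᶠ y in 𝓝 x, y ∉ A := by
    filter_upwards [(hc1.continuousAt.eventually_lt hc2.continuousAt h),
      Metric.isOpen_ball.mem_nhds hxr] with y hy hyr hyA
    exact lt_asymm hy ((H y hyr).1 hyA)
  have hcl : x ∈ closure A := frontier_subset_closure hx
  obtain ⟨y, hy, hyA⟩ := mem_closure_iff_nhds.1 hcl _ hev
  exact hy hyA

/-- Locally the frontier lies on a graph, so its translates by distinct multiples of ν are pairwise
disjoint. Infinitely many disjoint translates by a bounded set of vectors force measure zero. -/
theorem HasLipschitzBoundary.volume_frontier_eq_zero {A : Set (Eucl n)}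
    (h : HasLipschitzBoundary A) (hA : IsOpen A) : volume (frontier A) = 0 := by
  refine measure_null_of_locally_null _ fun x₀ hx₀ => ?_
  obtain ⟨r, hr, ν, hν, K, γ, hγ, H⟩ := h x₀ hx₀
  refine ⟨frontier A ∩ Metric.ball x₀ r, inter_mem_nhdsWithin _ (Metric.ball_mem_nhds _ hr), ?_⟩
  set t : ℕ → ℝ := fun k => 1 / ((k : ℝ) + 1) with ht
  have htinj : ∀ i j, t i = t j → i = j := by
    intro i j hij
    simp only [ht, one_div, inv_inj] at hij
    exact_mod_cast add_right_cancel hij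
  refine Measure.addHaar_eq_zero_of_disjoint_translates volume (fun k => t k • ν) ?_ ?_
    (isClosed_frontier.measurableSet.inter Metric.isOpen_ball.measurableSet)
  · refine (Metric.isBounded_closedBall (x := (0 : Eucl n)) (r := 1)).subset ?_
    rintro _ ⟨k, rfl⟩
    rw [mem_closedBall_zero_iff, norm_smul, hν, mul_one, Real.norm_eq_abs,
      abs_of_nonneg (by positivity)]
    exact (div_le_one (by positivity)).2 (by linarith [(Nat.cast_nonneg k : (0 : ℝ) ≤ k)])
  · intro i j hij
    refine Set.disjoint_left.2 ?_
    rintro z hz1 hz2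
    simp only [singleton_add] at hz1 hz2
    obtain ⟨x, hx, rfl⟩ := hz1
    obtain ⟨y, hy, hxy⟩ := hz2
    have hxy' : (x - x₀) + t i • ν = (y - x₀) + t j • ν := by
      simp only at hxy
      rw [sub_add_eq_add_sub, sub_add_eq_add_sub, add_comm x, add_comm y, hxy]
    have e1 := sub_inner_smul_add_smul_unit hν (x - x₀) (t i)
    rw [hxy', sub_inner_smul_add_smul_unit hν] at e1
    have e2 := inner_add_smul_unit hν (x - x₀) (t i)
    rw [hxy', inner_add_smul_unit hν, ← frontier_eq_graph hA hγ H hx.1 hx.2,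
      ← frontier_eq_graph hA hγ H hy.1 hy.2, e1] at e2
    exact hij (htinj _ _ (add_left_cancel e2).symm)

/-- Near a Lipschitz boundary point, an open set can be translated into a ball contained in it,
along segments that stay in the set. -/
theorem HasLipschitzBoundary.exists_segment {A : Set (Eucl n)} (h : HasLipschitzBoundary A)
    (hA : IsOpen A) {x₀ : Eucl n} (hx₀ : x₀ ∈ frontier A) :
    ∃ (v : Eucl n) (ρ : ℝ), 0 < ρ ∧ Metric.ball (x₀ + v) ρ ⊆ A ∧
      ∀ x ∈ A ∩ Metric.ball x₀ ρ, ∀ s ∈ Icc (0 : ℝ) 1, x + s • v ∈ A := by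
  obtain ⟨r, hr, ν, hν, K, γ, hγ, H⟩ := h x₀ hx₀
  -- Moving up along ν keeps the orthogonal component and raises the height, so a strict epigraph is
  -- preserved; the step r/2 from the ball of radius r/2 stays within the chart.
  have key : ∀ x ∈ Metric.ball x₀ (r / 2), ∀ s ∈ Icc (0 : ℝ) 1,
      (γ ((x - x₀) - inner ℝ ν (x - x₀) • ν) < inner ℝ ν (x - x₀) + s * (r / 2)) →
        x + s • (r / 2) • ν ∈ A := by
    intro x hx s hs hlt
    have hball : x + s • (r / 2) • ν ∈ Metric.ball x₀ r := by
      rw [mem_ball_iff_norm] at hx ⊢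
      calc ‖x + s • (r / 2) • ν - x₀‖ = ‖(x - x₀) + s • (r / 2) • ν‖ := by congr 1; abel
        _ ≤ ‖x - x₀‖ + ‖s • (r / 2) • ν‖ := norm_add_le _ _
        _ < r / 2 + r / 2 := by
          refine add_lt_add_of_lt_of_le hx ?_
          rw [norm_smul, norm_smul, hν, mul_one, Real.norm_of_nonneg hs.1,
            Real.norm_of_nonneg (by positivity)]
          exact mul_le_of_le_one_left (by positivity) hs.2
        _ = r := by ring
    rw [H _ hball, smul_smul, add_sub_right_comm, sub_inner_smul_add_smul_unit hν,
      inner_add_smul_unit hν]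
    exact hlt
  have hx₀r : x₀ ∈ Metric.ball x₀ r := Metric.mem_ball_self hr
  have h0 := frontier_eq_graph hA hγ H hx₀ hx₀r
  have hmem : x₀ + (r / 2) • ν ∈ A := by
    have := key x₀ (Metric.mem_ball_self (by positivity)) 1 (by simp) (by rw [h0]; simp [hr])
    simpa using this
  obtain ⟨ρ, hρ, hball⟩ := Metric.isOpen_iff.1 hA _ hmem
  refine ⟨(r / 2) • ν, min ρ (r / 2), by positivity,
    (Metric.ball_subset_ball (min_le_left _ _)).trans hball, fun x hx s hs => ?_⟩
  have hx1 : x ∈ Metric.ball x₀ (r / 2) := Metric.ball_subset_ball (min_le_right _ _) hx.2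
  refine key x hx1 s hs ?_
  have := (H x (Metric.ball_subset_ball (by linarith) hx1)).1 hx.1
  have h2 : 0 ≤ s * (r / 2) := mul_nonneg hs.1 (by positivity)
  linarith

end LipschitzBoundary

/-! ### Poincaré-type estimates and functions with zero gradient -/

section Poincare

variable {n : ℕ}

/-- Substitute y = x + h and integrate in x first. Convexity of the ball keeps the segment from x to
x + h inside it, so the increment estimate applies for each h, and only |h| < 2r contributes. -/
theorem lintegral_lintegral_ball_sub_rpow_le {U : Set (Eucl n)} (hU : MeasurableSet U)
    {u : Eucl n → ℝ} {g : Eucl n → Eucl n} (hu : IntegrableOn u U) (hg : IntegrableOn g U)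
    (hug : HasWeakGradient U u g) {c : Eucl n} {r : ℝ} (hQ : Metric.ball c r ⊆ U) {q : ℝ}
    (hq : 1 < q) :
    ∫⁻ x in Metric.ball c r, ∫⁻ y in Metric.ball c r, ‖u y - u x‖ₑ ^ q ≤
      volume (Metric.ball (0 : Eucl n) (2 * r)) *
        (ENNReal.ofReal (2 * r) ^ q * ∫⁻ x in U, ‖g x‖ₑ ^ q) := by
  set Q := Metric.ball c r with hQdef
  have hQo : IsOpen Q := Metric.isOpen_ball
  have hQm : MeasurableSet Q := hQo.measurableSet
  set V : Eucl n → ℝ := Q.indicator u with hV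
  have hVm : AEStronglyMeasurable V := ((hu.mono_set hQ).integrable_indicator hQm).1
  set T : Eucl n × Eucl n → ℝ≥0∞ := (Q ×ˢ Q).indicator fun z => ‖V z.2 - V z.1‖ₑ ^ q with hT
  have hTm : AEMeasurable T (volume.prod volume) :=
    ((hVm.comp_snd.sub hVm.comp_fst).enorm.pow_const q).indicator (hQm.prod hQm)
  have hTm' : AEMeasurable (fun z : Eucl n × Eucl n => T (z.1, z.1 + z.2))
      (volume.prod volume) :=
    hTm.comp_quasiMeasurePreserving
      (measurePreserving_prod_add (volume : Measure (Eucl n)) volume).quasiMeasurePreserving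
  have e1 : ∫⁻ x in Q, ∫⁻ y in Q, ‖u y - u x‖ₑ ^ q = ∫⁻ x, ∫⁻ y, T (x, y) := by
    rw [← lintegral_indicator hQm]
    congr 1 with x
    by_cases hx : x ∈ Q
    · rw [indicator_of_mem hx, ← lintegral_indicator hQm]
      congr 1 with y
      by_cases hy : y ∈ Q <;> simp [hT, hV, hx, hy]
    · simp [hT, hx]
  have e2 : ∀ x, ∫⁻ y, T (x, y) = ∫⁻ h, T (x, x + h) := fun x =>
    (lintegral_add_left_eq_self (fun y => T (x, y)) x).symm
  rw [e1]
  simp only [e2]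
  rw [lintegral_lintegral_swap (f := fun x h => T (x, x + h)) hTm']
  have key : ∀ h : Eucl n, ∫⁻ x, T (x, x + h) ≤
      (Metric.ball (0 : Eucl n) (2 * r)).indicator
        (fun _ => ENNReal.ofReal (2 * r) ^ q * ∫⁻ x in U, ‖g x‖ₑ ^ q) h := by
    intro h
    by_cases hh : h ∈ Metric.ball (0 : Eucl n) (2 * r)
    · rw [indicator_of_mem hh]
      set S : Set (Eucl n) := Q ∩ (fun x => x + h) ⁻¹' Q with hS
      have hSo : IsOpen S := hQo.inter (hQo.preimage (by fun_prop))
      have e3 : ∫⁻ x, T (x, x + h) = ∫⁻ x in S, ‖u (x + h) - u x‖ₑ ^ q := by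
        rw [← lintegral_indicator hSo.measurableSet]
        congr 1 with x
        by_cases hx : x ∈ Q <;> by_cases hy : x + h ∈ Q <;> simp [hT, hV, hS, hx, hy]
      rw [e3]
      refine (hug.lintegral_sub_rpow_le hU hSo hu hg (fun x hx s hs => hQ ?_) hq).trans ?_
      · have := (convex_ball c r).add_smul_sub_mem hx.1 hx.2 hs
        simp only [add_sub_cancel_left] at this
        exact this
      · gcongr
        rw [← ofReal_norm]
        exact ENNReal.ofReal_le_ofReal (mem_ball_zero_iff.1 hh).le
    · rw [indicator_of_notMem hh]
      refine le_of_eq (lintegral_eq_zero_of_ae_eq_zero (Eventually.of_forall fun x => ?_))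
      refine indicator_of_notMem (fun hx => hh ?_) _
      have h1 := mem_ball_iff_norm.1 hx.1
      have h2 := mem_ball_iff_norm.1 hx.2
      rw [mem_ball_zero_iff]
      calc ‖h‖ = ‖(x + h - c) - (x - c)‖ := by congr 1; abel
        _ ≤ ‖x + h - c‖ + ‖x - c‖ := norm_sub_le _ _
        _ < 2 * r := by simp only at h1 h2; linarith
  refine (lintegral_mono key).trans_eq ?_
  rw [lintegral_indicator Metric.isOpen_ball.measurableSet, setLIntegral_const, mul_comm]

/-- `L^q` estimate in a ball in terms of the gradient and of the `L^1` norm. -/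
theorem exists_lintegral_ball_rpow_le (c : Eucl n) {r : ℝ} (hr : 0 < r) {q : ℝ} (hq : 1 < q) :
    ∃ C : ℝ≥0, ∀ (U : Set (Eucl n)), MeasurableSet U → Metric.ball c r ⊆ U →
      ∀ (u : Eucl n → ℝ) (g : Eucl n → Eucl n), IntegrableOn u U → IntegrableOn g U →
      HasWeakGradient U u g →
      ∫⁻ x in Metric.ball c r, ‖u x‖ₑ ^ q ≤
        C * ((∫⁻ x in U, ‖g x‖ₑ ^ q) + (∫⁻ x in U, ‖u x‖ₑ) ^ q) := by
  have hq0 : 0 ≤ q := by linarith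
  set m : ℝ≥0∞ := volume (Metric.ball c r) with hm
  have hm0 : m ≠ 0 := (Metric.measure_ball_pos volume c hr).ne'
  have hmt : m ≠ ⊤ := measure_ball_lt_top.ne
  set D : ℝ≥0∞ := volume (Metric.ball (0 : Eucl n) (2 * r)) * ENNReal.ofReal (2 * r) ^ q with hD
  have hDt : D ≠ ⊤ := ENNReal.mul_ne_top measure_ball_lt_top.ne
    (ENNReal.rpow_ne_top_of_nonneg hq0 ENNReal.ofReal_ne_top)
  set E : ℝ≥0∞ := (m ^ q)⁻¹ * ((2 : ℝ≥0∞) ^ (q - 1) * (m ^ (q - 1) * D + m)) with hE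
  have hmq0 : m ^ q ≠ 0 := (ENNReal.rpow_pos (pos_iff_ne_zero.2 hm0) hmt).ne'
  have hmqt : m ^ q ≠ ⊤ := ENNReal.rpow_ne_top_of_nonneg hq0 hmt
  have hEt : E ≠ ⊤ := by
    refine ENNReal.mul_ne_top (ENNReal.inv_ne_top.2 hmq0) (ENNReal.mul_ne_top ?_ ?_)
    · exact ENNReal.rpow_ne_top_of_nonneg (by linarith) (by simp)
    · refine ENNReal.add_ne_top.2 ⟨ENNReal.mul_ne_top ?_ hDt, hmt⟩
      exact ENNReal.rpow_ne_top_of_nonneg (by linarith) hmt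
  refine ⟨E.toNNReal, fun U hU hQU u g hu hg hug => ?_⟩
  rw [ENNReal.coe_toNNReal hEt]
  set Q := Metric.ball c r with hQdef
  have hum : AEStronglyMeasurable u (volume.restrict Q) := (hu.mono_set hQU).1
  set Gq := ∫⁻ x in U, ‖g x‖ₑ ^ q with hGq
  set I := ∫⁻ x in U, ‖u x‖ₑ with hI
  -- Average u(x) = u(y) - (u(y) - u(x)) over y in the ball. The first part gives the L^1 norm, the
  -- second is handled by Jensen and later integrated in x.
  have hpt : ∀ x, m ^ q * ‖u x‖ₑ ^ q ≤
      (2 : ℝ≥0∞) ^ (q - 1) * (m ^ (q - 1) * ∫⁻ y in Q, ‖u y - u x‖ₑ ^ q) +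
        (2 : ℝ≥0∞) ^ (q - 1) * I ^ q := by
    intro x
    have hmx : AEMeasurable (fun y => ‖u y - u x‖ₑ) (volume.restrict Q) :=
      (hum.sub aestronglyMeasurable_const).enorm
    have h1 : m * ‖u x‖ₑ ≤ (∫⁻ y in Q, ‖u y - u x‖ₑ) + I := by
      calc m * ‖u x‖ₑ = ∫⁻ y in Q, ‖u x‖ₑ := by rw [setLIntegral_const, mul_comm]
        _ ≤ ∫⁻ y in Q, (‖u y - u x‖ₑ + ‖u y‖ₑ) := by
            refine lintegral_mono fun y => ?_
            calc ‖u x‖ₑ = ‖u y - (u y - u x)‖ₑ := by rw [sub_sub_cancel]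
              _ ≤ ‖u y‖ₑ + ‖u y - u x‖ₑ := enorm_sub_le
              _ = _ := add_comm _ _
        _ = (∫⁻ y in Q, ‖u y - u x‖ₑ) + ∫⁻ y in Q, ‖u y‖ₑ := lintegral_add_left' hmx _
        _ ≤ _ := add_le_add le_rfl (lintegral_mono_set hQU)
    calc m ^ q * ‖u x‖ₑ ^ q = (m * ‖u x‖ₑ) ^ q := (ENNReal.mul_rpow_of_nonneg _ _ hq0).symm
      _ ≤ ((∫⁻ y in Q, ‖u y - u x‖ₑ) + I) ^ q := ENNReal.rpow_le_rpow h1 hq0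
      _ ≤ (2 : ℝ≥0∞) ^ (q - 1) * ((∫⁻ y in Q, ‖u y - u x‖ₑ) ^ q + I ^ q) :=
          ENNReal.rpow_add_le_mul_rpow_add_rpow _ _ hq.le
      _ ≤ (2 : ℝ≥0∞) ^ (q - 1) * (m ^ (q - 1) * (∫⁻ y in Q, ‖u y - u x‖ₑ ^ q) + I ^ q) := by
          gcongr
          have := lintegral_rpow_le_measure_univ_mul (volume.restrict Q) hmx hq
          rwa [Measure.restrict_apply_univ] at this
      _ = _ := mul_add _ _ _
  have hsum : m ^ q * ∫⁻ x in Q, ‖u x‖ₑ ^ q ≤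
      (2 : ℝ≥0∞) ^ (q - 1) * (m ^ (q - 1) * D + m) * (Gq + I ^ q) := by
    calc m ^ q * ∫⁻ x in Q, ‖u x‖ₑ ^ q = ∫⁻ x in Q, m ^ q * ‖u x‖ₑ ^ q :=
          (lintegral_const_mul' _ _ hmqt).symm
      _ ≤ ∫⁻ x in Q, ((2 : ℝ≥0∞) ^ (q - 1) * (m ^ (q - 1) * ∫⁻ y in Q, ‖u y - u x‖ₑ ^ q) +
            (2 : ℝ≥0∞) ^ (q - 1) * I ^ q) := lintegral_mono hpt
      _ = (2 : ℝ≥0∞) ^ (q - 1) * (m ^ (q - 1) * ∫⁻ x in Q, ∫⁻ y in Q, ‖u y - u x‖ₑ ^ q) +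
            (2 : ℝ≥0∞) ^ (q - 1) * (I ^ q * m) := by
          rw [lintegral_add_right _ measurable_const, setLIntegral_const,
            lintegral_const_mul' _ _ (ENNReal.rpow_ne_top_of_nonneg (by linarith) (by simp)),
            lintegral_const_mul' _ _ (ENNReal.rpow_ne_top_of_nonneg (by linarith) hmt), mul_assoc]
      _ ≤ (2 : ℝ≥0∞) ^ (q - 1) * (m ^ (q - 1) * (D * Gq)) +
            (2 : ℝ≥0∞) ^ (q - 1) * (I ^ q * m) := by
          gcongr
          rw [hD, mul_assoc]
          exact lintegral_lintegral_ball_sub_rpow_le hU hu hg hug hQU hq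
      _ = (2 : ℝ≥0∞) ^ (q - 1) * ((m ^ (q - 1) * D) * Gq + m * I ^ q) := by ring
      _ ≤ (2 : ℝ≥0∞) ^ (q - 1) * ((m ^ (q - 1) * D + m) * Gq +
            (m ^ (q - 1) * D + m) * I ^ q) := by
          gcongr
          · exact le_self_add
          · exact le_add_self
      _ = _ := by ring
  calc ∫⁻ x in Q, ‖u x‖ₑ ^ q = (m ^ q)⁻¹ * (m ^ q * ∫⁻ x in Q, ‖u x‖ₑ ^ q) := by
        rw [← mul_assoc, ENNReal.inv_mul_cancel hmq0 hmqt, one_mul]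
    _ ≤ (m ^ q)⁻¹ * ((2 : ℝ≥0∞) ^ (q - 1) * (m ^ (q - 1) * D + m) * (Gq + I ^ q)) := by gcongr
    _ = _ := by rw [hE]; ring

/-- In a bounded Lipschitz open set, the `L^q` norm is controlled by the `L^q` norm of the gradient
and by the `L^1` norm. -/
theorem HasLipschitzBoundary.exists_lintegral_rpow_le {A : Set (Eucl n)}
    (h : HasLipschitzBoundary A) (hA : IsOpen A) (hAb : Bornology.IsBounded A) {q : ℝ}
    (hq : 1 < q) :
    ∃ C : ℝ≥0, ∀ (u : Eucl n → ℝ) (g : Eucl n → Eucl n), IntegrableOn u A → IntegrableOn g A →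
      HasWeakGradient A u g →
      ∫⁻ x in A, ‖u x‖ₑ ^ q ≤ C * ((∫⁻ x in A, ‖g x‖ₑ ^ q) + (∫⁻ x in A, ‖u x‖ₑ) ^ q) := by
  have hq0 : 0 ≤ q := by linarith
  suffices H : ∃ C : ℝ≥0, ∀ (u : Eucl n → ℝ) (g : Eucl n → Eucl n), IntegrableOn u A →
      IntegrableOn g A → HasWeakGradient A u g →
      ∫⁻ x in A ∩ closure A, ‖u x‖ₑ ^ q ≤
        C * ((∫⁻ x in A, ‖g x‖ₑ ^ q) + (∫⁻ x in A, ‖u x‖ₑ) ^ q) by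
    rwa [inter_eq_left.2 subset_closure] at H
  have hcpt : IsCompact (closure A) := hAb.isCompact_closure
  -- Compactness of the closure reduces the estimate to a neighbourhood of one point: a ball inside
  -- `A` at interior points, a translated piece at boundary points.
  refine hcpt.induction_on (p := fun s => ∃ C : ℝ≥0, ∀ (u : Eucl n → ℝ) (g : Eucl n → Eucl n),
    IntegrableOn u A → IntegrableOn g A → HasWeakGradient A u g →
      ∫⁻ x in A ∩ s, ‖u x‖ₑ ^ q ≤ C * ((∫⁻ x in A, ‖g x‖ₑ ^ q) + (∫⁻ x in A, ‖u x‖ₑ) ^ q))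
    ⟨0, by simp⟩ ?_ ?_ ?_
  · rintro s t hst ⟨C, hC⟩
    exact ⟨C, fun u g hu hg hug =>
      (lintegral_mono_set (inter_subset_inter_right _ hst)).trans (hC u g hu hg hug)⟩
  · rintro s t ⟨C, hC⟩ ⟨C', hC'⟩
    refine ⟨C + C', fun u g hu hg hug => ?_⟩
    rw [inter_union_distrib_left, ENNReal.coe_add, add_mul]
    exact (lintegral_union_le _ _ _).trans (add_le_add (hC u g hu hg hug) (hC' u g hu hg hug))
  · intro x₀ hx₀
    by_cases hxA : x₀ ∈ A
    · obtain ⟨r, hr, hball⟩ := Metric.isOpen_iff.1 hA _ hxA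
      obtain ⟨C, hC⟩ := exists_lintegral_ball_rpow_le x₀ hr hq
      exact ⟨Metric.ball x₀ r, mem_nhdsWithin_of_mem_nhds (Metric.ball_mem_nhds _ hr), C,
        fun u g hu hg hug => (lintegral_mono_set inter_subset_right).trans
          (hC A hA.measurableSet hball u g hu hg hug)⟩
    · have hfr : x₀ ∈ frontier A := by
        rw [hA.frontier_eq]
        exact ⟨hx₀, hxA⟩
      obtain ⟨v, ρ, hρ, hball, hseg⟩ := h.exists_segment hA hfr
      obtain ⟨C, hC⟩ := exists_lintegral_ball_rpow_le (x₀ + v) hρ hq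
      -- Split u(x) = u(x+v) - (u(x+v) - u(x)). The translate is controlled in a ball contained in
      -- `A`, and the increment by the gradient along segments in `A`; the factor 2^(q-1) comes from
      -- convexity of t^q.
      refine ⟨Metric.ball x₀ ρ, mem_nhdsWithin_of_mem_nhds (Metric.ball_mem_nhds _ hρ),
        (2 : ℝ≥0) ^ (q - 1) * (‖v‖₊ ^ q + C), fun u g hu hg hug => ?_⟩
      set S := A ∩ Metric.ball x₀ ρ with hS
      have hSo : IsOpen S := hA.inter Metric.isOpen_ball
      have hAm := hA.measurableSet
      set Gq := ∫⁻ x in A, ‖g x‖ₑ ^ q with hGq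
      set I := ∫⁻ x in A, ‖u x‖ₑ with hI
      have h1 : ∫⁻ x in S, ‖u (x + v) - u x‖ₑ ^ q ≤ ‖v‖ₑ ^ q * Gq :=
        hug.lintegral_sub_rpow_le hAm hSo hu hg hseg hq
      have h2 : ∫⁻ x in S, ‖u (x + v)‖ₑ ^ q ≤ C * (Gq + I ^ q) := by
        refine le_trans ?_ (hC A hAm hball u g hu hg hug)
        calc ∫⁻ x in S, ‖u (x + v)‖ₑ ^ q
            ≤ ∫⁻ x in Metric.ball x₀ ρ, ‖u (x + v)‖ₑ ^ q := lintegral_mono_set inter_subset_right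
          _ = ∫⁻ x in Metric.ball (x₀ + v) ρ, ‖u x‖ₑ ^ q := by
              rw [← lintegral_indicator Metric.isOpen_ball.measurableSet,
                ← lintegral_indicator Metric.isOpen_ball.measurableSet,
                ← lintegral_add_right_eq_self
                  ((Metric.ball (x₀ + v) ρ).indicator fun x => ‖u x‖ₑ ^ q) v]
              congr 1 with x
              have : x + v ∈ Metric.ball (x₀ + v) ρ ↔ x ∈ Metric.ball x₀ ρ := by
                simp [Metric.mem_ball]
              by_cases hx : x ∈ Metric.ball x₀ ρ
              · rw [indicator_of_mem hx, indicator_of_mem (this.2 hx)]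
              · rw [indicator_of_notMem hx, indicator_of_notMem (mt this.1 hx)]
      have hm : AEMeasurable (fun x => ‖u (x + v)‖ₑ ^ q) (volume.restrict S) := by
        have hV : AEStronglyMeasurable (A.indicator u) := (hu.integrable_indicator hAm).1
        have hV' := (hV.comp_quasiMeasurePreserving
          (measurePreserving_add_right volume v).quasiMeasurePreserving).enorm.pow_const q
        refine (hV'.mono_measure Measure.restrict_le_self).congr ?_
        rw [Filter.EventuallyEq, ae_restrict_iff' hSo.measurableSet]
        refine Eventually.of_forall fun x hx => ?_
        have : x + v ∈ A := by simpa using hseg x hx 1 (by simp)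
        simp [this]
      have hcoe : (((2 : ℝ≥0) ^ (q - 1) * (‖v‖₊ ^ q + C) : ℝ≥0) : ℝ≥0∞) =
          (2 : ℝ≥0∞) ^ (q - 1) * (‖v‖ₑ ^ q + C) := by
        rw [ENNReal.coe_mul, ENNReal.coe_add, ENNReal.coe_rpow_of_nonneg _ hq0,
          ENNReal.coe_rpow_of_nonneg _ (by linarith)]
        rfl
      rw [hcoe]
      have h2t : (2 : ℝ≥0∞) ^ (q - 1) ≠ ⊤ := ENNReal.rpow_ne_top_of_nonneg (by linarith) (by simp)
      calc ∫⁻ x in S, ‖u x‖ₑ ^ q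
          ≤ ∫⁻ x in S, (2 : ℝ≥0∞) ^ (q - 1) * (‖u (x + v)‖ₑ ^ q + ‖u (x + v) - u x‖ₑ ^ q) := by
            refine lintegral_mono fun x => ?_
            refine le_trans (ENNReal.rpow_le_rpow ?_ hq0)
              (ENNReal.rpow_add_le_mul_rpow_add_rpow _ _ hq.le)
            calc ‖u x‖ₑ = ‖u (x + v) - (u (x + v) - u x)‖ₑ := by rw [sub_sub_cancel]
              _ ≤ _ := enorm_sub_le
        _ = (2 : ℝ≥0∞) ^ (q - 1) * ((∫⁻ x in S, ‖u (x + v)‖ₑ ^ q) +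
              ∫⁻ x in S, ‖u (x + v) - u x‖ₑ ^ q) := by
            rw [lintegral_const_mul' _ _ h2t, lintegral_add_left' hm]
        _ ≤ (2 : ℝ≥0∞) ^ (q - 1) * (C * (Gq + I ^ q) + ‖v‖ₑ ^ q * (Gq + I ^ q)) := by
            gcongr
            exact h1.trans (by gcongr; exact le_self_add)
        _ = _ := by ring

/-- The double integral of the increments over the ball vanishes, so u equals u(x) almost everywhere
for almost every choice of x. The exponent 2 is arbitrary. -/
theorem HasWeakGradient.exists_ae_eq_const_ball {U : Set (Eucl n)} (hU : MeasurableSet U)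
    {u : Eucl n → ℝ} {g : Eucl n → Eucl n} (hu : IntegrableOn u U) (hg : IntegrableOn g U)
    (hug : HasWeakGradient U u g) (hg0 : ∀ᵐ x ∂(volume.restrict U), g x = 0) {c : Eucl n} {r : ℝ}
    (hr : 0 < r) (hQ : Metric.ball c r ⊆ U) :
    ∃ k : ℝ, ∀ᵐ x ∂(volume.restrict (Metric.ball c r)), u x = k := by
  have h0 : ∫⁻ x in U, ‖g x‖ₑ ^ (2 : ℝ) = 0 := by
    refine lintegral_eq_zero_of_ae_eq_zero ?_
    filter_upwards [hg0] with x hx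
    simp [hx]
  have h1 := lintegral_lintegral_ball_sub_rpow_le hU hu hg hug hQ one_lt_two
  rw [h0, mul_zero, mul_zero, nonpos_iff_eq_zero] at h1
  set Q := Metric.ball c r with hQdef
  have hum : AEStronglyMeasurable u (volume.restrict Q) := (hu.mono_set hQ).1
  have hm : AEMeasurable (fun z : Eucl n × Eucl n => ‖u z.2 - u z.1‖ₑ ^ (2 : ℝ))
      ((volume.restrict Q).prod (volume.restrict Q)) :=
    (hum.comp_snd.sub hum.comp_fst).enorm.pow_const _
  rw [lintegral_eq_zero_iff' hm.lintegral_prod_right'] at h1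
  have : (ae (volume.restrict Q)).NeBot := by
    rw [ae_neBot, Ne, Measure.restrict_eq_zero]
    exact (Metric.measure_ball_pos volume c hr).ne'
  obtain ⟨x, hx⟩ := h1.exists
  refine ⟨u x, ?_⟩
  have hmx : AEMeasurable (fun y => ‖u y - u x‖ₑ ^ (2 : ℝ)) (volume.restrict Q) :=
    (hum.sub aestronglyMeasurable_const).enorm.pow_const _
  simp only [Pi.zero_apply] at hx
  rw [lintegral_eq_zero_iff' hmx] at hx
  filter_upwards [hx] with y hy
  have : u y - u x = 0 := by simpa using hy
  linarith

/-- A function with vanishing weak gradient is constant on connected components. -/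
theorem HasWeakGradient.exists_ae_eq_const {A : Set (Eucl n)} (hA : IsOpen A)
    {u : Eucl n → ℝ} {g : Eucl n → Eucl n} (hu : IntegrableOn u A) (hg : IntegrableOn g A)
    (hug : HasWeakGradient A u g) (hg0 : ∀ᵐ x ∂(volume.restrict A), g x = 0) {x₀ : Eucl n}
    (hx₀ : x₀ ∈ A) :
    ∃ k : ℝ, ∀ᵐ x ∂(volume.restrict (connectedComponentIn A x₀)), u x = k := by
  have hex : ∀ x ∈ A, ∃ r > 0, Metric.ball x r ⊆ A ∧
      ∃ k : ℝ, ∀ᵐ y ∂(volume.restrict (Metric.ball x r)), u y = k := by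
    intro x hx
    obtain ⟨r, hr, hball⟩ := Metric.isOpen_iff.1 hA _ hx
    exact ⟨r, hr, hball, hug.exists_ae_eq_const_ball hA.measurableSet hu hg hg0 hr hball⟩
  choose! r hr hball k hk using hex
  have hsub : connectedComponentIn A x₀ ⊆ A := connectedComponentIn_subset A x₀
  -- Two open balls that meet share a set of positive measure, on which both constants are attained;
  -- so `k` is locally constant, hence constant on a connected component.
  have hloc : ∀ x ∈ A, ∀ y ∈ A, y ∈ Metric.ball x (r x) → k x = k y := by
    intro x hx y hy hyx
    have hne : (ae (volume.restrict (Metric.ball x (r x) ∩ Metric.ball y (r y)))).NeBot := by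
      rw [ae_neBot, Ne, Measure.restrict_eq_zero]
      exact ((Metric.isOpen_ball.inter Metric.isOpen_ball).measure_pos volume
        ⟨y, hyx, Metric.mem_ball_self (hr y hy)⟩).ne'
    obtain ⟨z, hz1, hz2⟩ := ((ae_restrict_of_ae_restrict_of_subset inter_subset_left
      (hk x hx)).and (ae_restrict_of_ae_restrict_of_subset inter_subset_right (hk y hy))).exists
    exact hz1.symm.trans hz2
  have hconst : ∀ y ∈ connectedComponentIn A x₀, k x₀ = k y := by
    intro y hy
    refine isPreconnected_connectedComponentIn.induction₂' (fun x y => k x = k y) ?_ ?_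
      (mem_connectedComponentIn hx₀) hy
    · intro x hx
      filter_upwards [mem_nhdsWithin_of_mem_nhds (Metric.ball_mem_nhds x (hr x (hsub hx))),
        self_mem_nhdsWithin] with y hyx hyC
      have := hloc x (hsub hx) y (hsub hyC) hyx
      exact ⟨this, this.symm⟩
    · exact fun x y z _ _ _ h1 h2 => h1.trans h2
  refine ⟨k x₀, ?_⟩
  have hCm : MeasurableSet (connectedComponentIn A x₀) := hA.connectedComponentIn.measurableSet
  rw [ae_restrict_iff' hCm, ae_iff]
  -- Localizing the null set avoids choosing a countable subcover by the balls.
  refine measure_null_of_locally_null _ fun x hx => ?_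
  simp only [mem_ofPred_eq, Classical.not_imp] at hx
  refine ⟨_, inter_mem_nhdsWithin _ (Metric.ball_mem_nhds x (hr x (hsub hx.1))), ?_⟩
  have h1 := hk x (hsub hx.1)
  rw [ae_restrict_iff' Metric.isOpen_ball.measurableSet, ae_iff] at h1
  refine measure_mono_null (fun y hy => ?_) h1
  simp only [mem_inter_iff, mem_ofPred_eq, Classical.not_imp] at hy ⊢
  refine ⟨hy.2, fun h => hy.1.2 ?_⟩
  rw [h, hconst x hx.1]

end Poincare

end

noncomputable section

/-! ### Restriction, uniqueness and classical gradients -/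

section WeakGradient

variable {n : ℕ} {U V : Set (Eucl n)}

theorem IsTestFunction.eq_zero_of_notMem {φ : Eucl n → ℝ} (hφ : IsTestFunction U φ) {x : Eucl n}
    (hx : x ∉ U) : φ x = 0 :=
  image_eq_zero_of_notMem_tsupport fun h => hx (hφ.2.2 h)

theorem IsTestFunction.fderiv_eq_zero_of_notMem {φ : Eucl n → ℝ} (hφ : IsTestFunction U φ)
    {x : Eucl n} (hx : x ∉ U) : fderiv ℝ φ x = 0 :=
  fderiv_of_notMem_tsupport (𝕜 := ℝ) fun h => hx (hφ.2.2 h)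

theorem IsTestFunction.mono {φ : Eucl n → ℝ} (hφ : IsTestFunction U φ) (hUV : U ⊆ V) :
    IsTestFunction V φ :=
  ⟨hφ.1, hφ.2.1, hφ.2.2.trans hUV⟩

theorem IsTestFunction.setIntegral_mul_fderiv {φ : Eucl n → ℝ} (hφ : IsTestFunction U φ)
    (u : Eucl n → ℝ) (e : Eucl n) :
    ∫ x in U, u x * fderiv ℝ φ x e = ∫ x, u x * fderiv ℝ φ x e :=
  setIntegral_eq_integral_of_forall_compl_eq_zero fun x hx => by
    simp [hφ.fderiv_eq_zero_of_notMem hx]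

theorem IsTestFunction.setIntegral_inner_mul {φ : Eucl n → ℝ} (hφ : IsTestFunction U φ)
    (g : Eucl n → Eucl n) (e : Eucl n) :
    ∫ x in U, inner ℝ (g x) e * φ x = ∫ x, inner ℝ (g x) e * φ x :=
  setIntegral_eq_integral_of_forall_compl_eq_zero fun x hx => by
    simp [hφ.eq_zero_of_notMem hx]

theorem HasWeakGradient.mono {u : Eucl n → ℝ} {g : Eucl n → Eucl n} (h : HasWeakGradient V u g)
    (hUV : U ⊆ V) : HasWeakGradient U u g := by
  intro φ hφ e
  have := h φ (hφ.mono hUV) e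
  rwa [(hφ.mono hUV).setIntegral_mul_fderiv, (hφ.mono hUV).setIntegral_inner_mul,
    ← hφ.setIntegral_mul_fderiv, ← hφ.setIntegral_inner_mul] at this

theorem HasWeakGradient.congr {u u' : Eucl n → ℝ} {g g' : Eucl n → Eucl n}
    (h : HasWeakGradient U u g) (hu : u =ᵐ[volume.restrict U] u')
    (hg : g =ᵐ[volume.restrict U] g') : HasWeakGradient U u' g' := by
  intro φ hφ e
  have e1 : ∫ x in U, u' x * fderiv ℝ φ x e = ∫ x in U, u x * fderiv ℝ φ x e :=
    integral_congr_ae (by filter_upwards [hu] with x hx; rw [hx])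
  have e2 : ∫ x in U, inner ℝ (g' x) e * φ x = ∫ x in U, inner ℝ (g x) e * φ x :=
    integral_congr_ae (by filter_upwards [hg] with x hx; rw [hx])
  rw [e1, e2, h φ hφ e]

/-- Fundamental lemma of the calculus of variations, read componentwise. It identifies the abstract
gradient of a Sobolev element represented by a C¹ function with the classical one. -/
theorem HasWeakGradient.ae_eq (hU : IsOpen U) {u : Eucl n → ℝ} {g g' : Eucl n → Eucl n}
    (h : HasWeakGradient U u g) (h' : HasWeakGradient U u g') (hg : IntegrableOn g U)
    (hg' : IntegrableOn g' U) : g =ᵐ[volume.restrict U] g' := by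
  have key : ∀ᵐ x, x ∈ U → (g - g') x = 0 := by
    refine hU.ae_eq_zero_of_integral_contDiff_smul_eq_zero
      (IntegrableOn.locallyIntegrableOn (hg.sub hg')) fun φ h1 h2 h3 => ?_
    have hφ : IsTestFunction U φ := ⟨h1, h2, h3⟩
    obtain ⟨K, hK⟩ := h2.exists_bound_of_continuous h1.continuous
    have hb : ∀ f : Eucl n → Eucl n, IntegrableOn f U →
        Integrable (fun x => φ x • f x) (volume.restrict U) := fun f hf =>
      hf.bdd_smul K h1.continuous.aestronglyMeasurable (Eventually.of_forall hK)
    rw [← setIntegral_eq_integral_of_forall_compl_eq_zero (s := U) fun x hx => by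
      rw [hφ.eq_zero_of_notMem hx, zero_smul]]
    refine ext_inner_left ℝ fun e => ?_
    rw [inner_zero_right, ← integral_inner (hb _ (hg.sub hg'))]
    have e1 : ∀ f : Eucl n → Eucl n, IntegrableOn f U →
        Integrable (fun x => inner ℝ (f x) e * φ x) (volume.restrict U) := fun f hf =>
      (hf.inner_const e).mul_bdd (c := K) h1.continuous.aestronglyMeasurable
        (Eventually.of_forall hK)
    have e2 : ∀ x, inner ℝ e (φ x • (g - g') x) =
        inner ℝ (g x) e * φ x - inner ℝ (g' x) e * φ x := by
      intro x
      rw [real_inner_smul_right, Pi.sub_apply, inner_sub_right, real_inner_comm (g x),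
        real_inner_comm (g' x)]
      ring
    simp only [e2]
    rw [integral_sub (e1 g hg) (e1 g' hg')]
    have := (h φ hφ e).symm.trans (h' φ hφ e)
    linarith
  rw [Filter.EventuallyEq, ae_restrict_iff' hU.measurableSet]
  filter_upwards [key] with x hx hxU
  exact sub_eq_zero.1 (hx hxU)

theorem continuous_gradient {φ : Eucl n → ℝ} (hφ : ContDiff ℝ 1 φ) : Continuous (gradient φ) :=
  (InnerProductSpace.toDual ℝ (Eucl n)).symm.continuous.comp (hφ.continuous_fderiv (by simp))

theorem hasWeakGradient_gradient {φ : Eucl n → ℝ} (hφ : ContDiff ℝ 1 φ)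
    (U : Set (Eucl n)) : HasWeakGradient U φ (gradient φ) := by
  intro ψ hψ e
  rw [hψ.setIntegral_mul_fderiv, hψ.setIntegral_inner_mul]
  simp only [inner_gradient_left]
  have c1 : Continuous fun x => fderiv ℝ φ x e :=
    (hφ.continuous_fderiv (by simp)).clm_apply continuous_const
  have c2 : Continuous fun x => fderiv ℝ ψ x e :=
    (hψ.1.continuous_fderiv (by simp)).clm_apply continuous_const
  exact integral_mul_fderiv_eq_neg_fderiv_mul_of_integrable
    ((c1.mul hψ.1.continuous).integrable_of_hasCompactSupport hψ.2.1.mul_left)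
    ((hφ.continuous.mul c2).integrable_of_hasCompactSupport
      (hψ.2.1.fderiv_apply (𝕜 := ℝ) e).mul_left)
    ((hφ.continuous.mul hψ.1.continuous).integrable_of_hasCompactSupport hψ.2.1.mul_left)
    (fun x _ => (hφ.differentiable (by simp)) x) (fun x _ => (hψ.1.differentiable (by simp)) x)

end WeakGradient

/-! ### Completeness of Sobolev spaces and Poincaré's inequality -/

section SobolevSpace

variable {n : ℕ} {p : ℝ} [hp : Fact (1 < p)] {U V : Set (Eucl n)}

theorem eLpNorm_ofReal_rpow {α F : Type*} [MeasurableSpace α] [NormedAddCommGroup F]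
    (μ : Measure α) (f : α → F) {p : ℝ} (hp : 0 < p) :
    eLpNorm f (ENNReal.ofReal p) μ ^ p = ∫⁻ x, ‖f x‖ₑ ^ p ∂μ := by
  rw [eLpNorm_eq_lintegral_rpow_enorm_toReal (by simpa using hp) ENNReal.ofReal_ne_top,
    ENNReal.toReal_ofReal hp.le, ← ENNReal.rpow_mul, one_div_mul_cancel hp.ne', ENNReal.rpow_one]

theorem enorm_Lp_rpow {α F : Type*} [MeasurableSpace α] [NormedAddCommGroup F] {μ : Measure α}
    (f : Lp F (ENNReal.ofReal p) μ) : ‖f‖ₑ ^ p = ∫⁻ x, ‖f x‖ₑ ^ p ∂μ := by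
  rw [Lp.enorm_def, eLpNorm_ofReal_rpow μ _ (by linarith [hp.out])]

theorem lintegral_rpow_ne_top {α F : Type*} [MeasurableSpace α] [NormedAddCommGroup F]
    {μ : Measure α} (f : Lp F (ENNReal.ofReal p) μ) : ∫⁻ x, ‖f x‖ₑ ^ p ∂μ ≠ ⊤ := by
  rw [← enorm_Lp_rpow]
  exact ENNReal.rpow_ne_top_of_nonneg (by linarith [hp.out]) enorm_ne_top

theorem norm_Lp_le_of_lintegral_rpow_le {α F F' : Type*} [MeasurableSpace α]
    [NormedAddCommGroup F] [NormedAddCommGroup F'] {μ : Measure α}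
    (f : Lp F (ENNReal.ofReal p) μ) (g : Lp F' (ENNReal.ofReal p) μ) (R : ℝ≥0)
    (h : ∫⁻ x, ‖f x‖ₑ ^ p ∂μ ≤ (R : ℝ≥0∞) ^ p * ∫⁻ x, ‖g x‖ₑ ^ p ∂μ) : ‖f‖ ≤ R * ‖g‖ := by
  have hp0 : 0 < p := by linarith [hp.out]
  rw [← enorm_Lp_rpow, ← enorm_Lp_rpow, ← ENNReal.mul_rpow_of_nonneg _ _ hp0.le,
    ENNReal.rpow_le_rpow_iff hp0] at h
  have h2 : (‖f‖₊ : ℝ≥0∞) ≤ ((R * ‖g‖₊ : ℝ≥0) : ℝ≥0∞) := by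
    rw [ENNReal.coe_mul]
    exact h
  exact_mod_cast ENNReal.coe_le_coe.1 h2

theorem integrableOn_Lp {F : Type*} [NormedAddCommGroup F] (hU : volume U ≠ ⊤)
    (f : Lp F (ENNReal.ofReal p) (volume.restrict U)) : IntegrableOn f U := by
  have : IsFiniteMeasure (volume.restrict U) := isFiniteMeasure_restrict.2 hU
  exact (Lp.memLp f).integrable Fact.out

/-- Hölder duality: a continuous compactly supported function belongs to the conjugate Lebesgue
space. -/
theorem continuous_integral_inner_Lp {F : Type*} [NormedAddCommGroup F] [InnerProductSpace ℝ F]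
    {ψ : Eucl n → F} (hψ : Continuous ψ) (hψc : HasCompactSupport ψ) :
    Continuous fun u : Lp F (ENNReal.ofReal p) (volume.restrict U) =>
      ∫ x in U, inner ℝ (u x) (ψ x) := by
  have hc := (Real.HolderConjugate.conjExponent hp.out).ennrealOfReal
  have : Fact ((1 : ℝ≥0∞) ≤ ENNReal.ofReal p.conjExponent) :=
    ⟨by simpa using ENNReal.ofReal_le_ofReal (Real.HolderConjugate.conjExponent hp.out).symm.lt.le⟩
  have hm : MemLp ψ (ENNReal.ofReal p.conjExponent) (volume.restrict U) :=
    hψ.memLp_of_hasCompactSupport hψc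
  have h2 : (fun u : Lp F (ENNReal.ofReal p) (volume.restrict U) => ∫ x in U, inner ℝ (u x) (ψ x)) =
      ((innerSL ℝ (E := F)).lpPairing (volume.restrict U) (ENNReal.ofReal p)
        (ENNReal.ofReal p.conjExponent)).flip (hm.toLp ψ) := by
    ext u
    rw [ContinuousLinearMap.flip_apply, ContinuousLinearMap.lpPairing_eq_integral]
    refine integral_congr_ae ?_
    filter_upwards [hm.coeFn_toLp] with x hx
    rw [hx]
    rfl
  rw [h2]
  exact ContinuousLinearMap.continuous _

/-- Each test function and direction imposes one equation between continuous functionals of the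
pair. The resulting completeness is what turns Cauchy minimizing sequences into minimizers. -/
theorem isClosed_sobolevSpace (p : ℝ) [hp : Fact (1 < p)] (U : Set (Eucl n)) :
    IsClosed (SobolevSpace p U : Set (Lp ℝ (ENNReal.ofReal p) (volume.restrict U) ×
      Lp (Eucl n) (ENNReal.ofReal p) (volume.restrict U))) := by
  have h : (SobolevSpace p U : Set (Lp ℝ (ENNReal.ofReal p) (volume.restrict U) ×
      Lp (Eucl n) (ENNReal.ofReal p) (volume.restrict U))) =
      ⋂ (φ : Eucl n → ℝ) (_ : IsTestFunction U φ) (e : Eucl n),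
        {z | ∫ x in U, inner ℝ (z.1 x) (fderiv ℝ φ x e) =
          - ∫ x in U, inner ℝ (z.2 x) (φ x • e)} := by
    ext z
    simp only [mem_iInter, mem_ofPred_eq, SetLike.mem_coe]
    refine forall_congr' fun φ => forall_congr' fun _ => forall_congr' fun e => ?_
    have e1 : ∀ x, inner ℝ (z.1 x) (fderiv ℝ φ x e) = z.1 x * fderiv ℝ φ x e := fun x => by
      simp [mul_comm]
    have e2 : ∀ x, inner ℝ (z.2 x) (φ x • e) = inner ℝ (z.2 x) e * φ x := fun x => by
      rw [real_inner_smul_right, mul_comm]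
    simp only [e1, e2]
  rw [h]
  refine isClosed_iInter fun φ => isClosed_iInter fun hφ => isClosed_iInter fun e =>
    isClosed_eq ?_ (Continuous.neg ?_)
  · have c := hφ.1.continuous_fderiv (by simp)
    exact (continuous_integral_inner_Lp (c.clm_apply continuous_const)
      (hφ.2.1.fderiv_apply (𝕜 := ℝ) e)).comp continuous_fst
  · exact (continuous_integral_inner_Lp (hφ.1.continuous.smul continuous_const)
      hφ.2.1.smul_right).comp continuous_snd

instance completeSpace_sobolevSpace : CompleteSpace (SobolevSpace p U) :=
  (isClosed_sobolevSpace p U).completeSpace_coe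

theorem sobGrad_add (u v : SobolevSpace p U) :
    sobGrad (u + v) =ᵐ[volume.restrict U] fun x => sobGrad u x + sobGrad v x :=
  Lp.coeFn_add _ _

theorem sobGrad_sub (u v : SobolevSpace p U) :
    sobGrad (u - v) =ᵐ[volume.restrict U] fun x => sobGrad u x - sobGrad v x :=
  Lp.coeFn_sub _ _

theorem sobGrad_smul (c : ℝ) (u : SobolevSpace p U) :
    sobGrad (c • u) =ᵐ[volume.restrict U] fun x => c • sobGrad u x :=
  Lp.coeFn_smul _ _

theorem sobFun_sub (u v : SobolevSpace p U) :
    sobFun (u - v) =ᵐ[volume.restrict U] fun x => sobFun u x - sobFun v x :=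
  Lp.coeFn_sub _ _

theorem hasWeakGradient_sob (u : SobolevSpace p U) : HasWeakGradient U (sobFun u) (sobGrad u) :=
  u.2

/-- The element of `W^{1,p}(U)` given by a function and its weak gradient. -/
def sobMk {u : Eucl n → ℝ} {g : Eucl n → Eucl n}
    (hu : MemLp u (ENNReal.ofReal p) (volume.restrict U))
    (hg : MemLp g (ENNReal.ofReal p) (volume.restrict U)) (h : HasWeakGradient U u g) :
    SobolevSpace p U :=
  ⟨(hu.toLp u, hg.toLp g), h.congr hu.coeFn_toLp.symm hg.coeFn_toLp.symm⟩

theorem sobFun_sobMk {u : Eucl n → ℝ} {g : Eucl n → Eucl n}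
    (hu : MemLp u (ENNReal.ofReal p) (volume.restrict U))
    (hg : MemLp g (ENNReal.ofReal p) (volume.restrict U)) (h : HasWeakGradient U u g) :
    sobFun (sobMk hu hg h) =ᵐ[volume.restrict U] u := hu.coeFn_toLp

theorem sobGrad_sobMk {u : Eucl n → ℝ} {g : Eucl n → Eucl n}
    (hu : MemLp u (ENNReal.ofReal p) (volume.restrict U))
    (hg : MemLp g (ENNReal.ofReal p) (volume.restrict U)) (h : HasWeakGradient U u g) :
    sobGrad (sobMk hu hg h) =ᵐ[volume.restrict U] g := hg.coeFn_toLp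

theorem sub_eq_integral_gradient {φ : Eucl n → ℝ} (hφ : ContDiff ℝ 1 φ) (x h : Eucl n) :
    φ (x + h) - φ x = ∫ s in Icc (0 : ℝ) 1, inner ℝ (gradient φ (x + s • h)) h := by
  simp only [inner_gradient_left]
  have hd : ∀ s : ℝ, HasDerivAt (fun s : ℝ => φ (x + s • h)) (fderiv ℝ φ (x + s • h) h) s := by
    intro s
    have h1 : HasDerivAt (fun s : ℝ => x + s • h) h s := by
      simpa using ((hasDerivAt_id s).smul_const h).const_add x
    exact ((hφ.differentiable (by simp)) (x + s • h)).hasFDerivAt.comp_hasDerivAt s h1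
  have hc : Continuous fun s : ℝ => fderiv ℝ φ (x + s • h) h :=
    ((hφ.continuous_fderiv (by simp)).comp (by fun_prop)).clm_apply continuous_const
  have := intervalIntegral.integral_eq_sub_of_hasDerivAt (fun s _ => hd s)
    (hc.intervalIntegrable 0 1)
  rw [intervalIntegral.integral_of_le zero_le_one, ← integral_Icc_eq_integral_Ioc] at this
  rw [this]
  simp

/-- Poincaré's inequality for `C¹` functions compactly supported in a bounded set. -/
theorem exists_lintegral_rpow_le_gradient (hn : 0 < n) (hUb : Bornology.IsBounded U)
    (hU : MeasurableSet U) {p : ℝ} (hp : 1 < p) :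
    ∃ R : ℝ≥0, ∀ φ : Eucl n → ℝ, ContDiff ℝ 1 φ → tsupport φ ⊆ U →
      ∫⁻ x in U, ‖φ x‖ₑ ^ p ≤ (R : ℝ≥0∞) ^ p * ∫⁻ x in U, ‖gradient φ x‖ₑ ^ p := by
  obtain ⟨R, hR, hUR⟩ := hUb.subset_ball_lt 0 (0 : Eucl n)
  have hne : Nontrivial (Eucl n) := by
    have : Nonempty (Fin n) := ⟨⟨0, hn⟩⟩
    exact inferInstance
  -- A vector of length 2R moves `U`, contained in the ball of radius R, off itself. Hence φ(x + h)
  -- = 0 for x in `U`, and the increment along h is -φ(x).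
  obtain ⟨h, hh⟩ := exists_norm_eq (Eucl n) (c := 2 * R) (by positivity)
  refine ⟨‖h‖₊, fun φ hφ hs => ?_⟩
  have hzero : ∀ x ∈ U, φ (x + h) = 0 := by
    intro x hx
    refine image_eq_zero_of_notMem_tsupport fun hmem => ?_
    have h1 := mem_ball_zero_iff.1 (hUR (hs hmem))
    have h2 := mem_ball_zero_iff.1 (hUR hx)
    have h3 : ‖h‖ ≤ ‖x + h‖ + ‖x‖ := by
      calc ‖h‖ = ‖(x + h) - x‖ := by rw [add_sub_cancel_left]
        _ ≤ _ := norm_sub_le _ _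
    linarith
  have hg0 : ∀ x ∉ U, gradient φ x = 0 := by
    intro x hx
    rw [gradient, fderiv_of_notMem_tsupport (𝕜 := ℝ) fun hm => hx (hs hm), map_zero]
  have key := lintegral_rpow_le_of_eq_integral_segment (S := U) (h := h)
    (w := fun x => φ (x + h) - φ x)
    (continuous_gradient hφ).aestronglyMeasurable
    (Eventually.of_forall fun x => sub_eq_integral_gradient hφ x h) hp
  have e1 : ∫⁻ x in U, ‖φ (x + h) - φ x‖ₑ ^ p = ∫⁻ x in U, ‖φ x‖ₑ ^ p := by
    refine setLIntegral_congr_fun hU fun x hx => ?_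
    rw [hzero x hx, zero_sub, enorm_neg]
  have e2 : ∫⁻ x, ‖gradient φ x‖ₑ ^ p = ∫⁻ x in U, ‖gradient φ x‖ₑ ^ p := by
    rw [← lintegral_indicator_enorm_rpow hU _ (by linarith)]
    congr 1 with x
    by_cases hx : x ∈ U <;> simp [hx, hg0]
  rw [e1, e2] at key
  exact key

/-- Poincaré's inequality in `W^{1,p}_0(U)`. -/
theorem exists_norm_le_norm_gradient (p : ℝ) [hp : Fact (1 < p)] (hn : 0 < n) (hU : IsOpen U)
    (hUb : Bornology.IsBounded U) :
    ∃ R : ℝ≥0, ∀ z ∈ SobolevZero p U, ‖z‖ ≤ R * ‖z.1.2‖ := by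
  obtain ⟨R, hR⟩ := exists_lintegral_rpow_le_gradient hn hUb hU.measurableSet hp.out
  have hvol : volume U ≠ ⊤ := hUb.measure_lt_top.ne
  -- The norm is the maximum of the function and gradient norms; the 1 accounts for the latter.
  refine ⟨max R 1, fun z hz => ?_⟩
  have hcl : IsClosed {z : SobolevSpace p U | ‖z‖ ≤ ((max R 1 : ℝ≥0) : ℝ) * ‖z.1.2‖} :=
    isClosed_le continuous_norm (by fun_prop)
  refine closure_minimal ?_ hcl hz
  rintro z ⟨φ, hφ, hφc, hφU, hzφ⟩
  have hgint : IntegrableOn (gradient φ) U := by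
    have hgc : HasCompactSupport (gradient φ) :=
      (hφc.fderiv (𝕜 := ℝ)).comp_left (map_zero _)
    exact ((continuous_gradient hφ).integrable_of_hasCompactSupport hgc).integrableOn
  have hg : sobGrad z =ᵐ[volume.restrict U] gradient φ :=
    HasWeakGradient.ae_eq hU ((hasWeakGradient_sob z).congr hzφ EventuallyEq.rfl)
      (hasWeakGradient_gradient hφ U) (integrableOn_Lp hvol z.1.2) hgint
  have h1 : ‖z.1.1‖ ≤ R * ‖z.1.2‖ := by
    refine norm_Lp_le_of_lintegral_rpow_le _ _ R ?_
    have e1 : ∫⁻ x in U, ‖z.1.1 x‖ₑ ^ p = ∫⁻ x in U, ‖φ x‖ₑ ^ p :=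
      lintegral_congr_ae (by filter_upwards [hzφ] with x hx; rw [← hx]; rfl)
    have e2 : ∫⁻ x in U, ‖z.1.2 x‖ₑ ^ p = ∫⁻ x in U, ‖gradient φ x‖ₑ ^ p :=
      lintegral_congr_ae (by filter_upwards [hg] with x hx; rw [← hx]; rfl)
    rw [e1, e2]
    exact hR φ hφ hφU
  change max ‖z.1.1‖ ‖z.1.2‖ ≤ _
  refine max_le (h1.trans ?_) ?_
  · gcongr
    exact le_max_left _ _
  · exact le_mul_of_one_le_left (norm_nonneg _) (by exact_mod_cast le_max_right R 1)

end SobolevSpace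

end

noncomputable section

/-! ### Translations and mollifications in Lebesgue spaces -/

section Mollification

open scoped Convolution

variable {n : ℕ} {p : ℝ} [hp : Fact (1 < p)] {F : Type*} [NormedAddCommGroup F]

/-- Continuity of translations in `L^p`. -/
theorem MeasureTheory.MemLp.exists_lintegral_translate_sub_le {z : Eucl n → F}
    (hz : MemLp z (ENNReal.ofReal p) volume) {η : ℝ≥0∞} (hη : 0 < η) :
    ∃ δ > 0, ∀ y : Eucl n, ‖y‖ < δ → ∫⁻ x, ‖z (x - y) - z x‖ₑ ^ p ≤ η := by
  have hp0 : 0 < p := by linarith [hp.out]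
  set Z := hz.toLp z with hZ
  -- Currying makes the translations a continuous family of continuous maps, the form in which
  -- continuity of composition in L^p is available.
  set T : Eucl n → C(Eucl n, Eucl n) :=
    fun y => (ContinuousMap.mk (fun a : Eucl n × Eucl n => a.2 - a.1) (by fun_prop)).curry y
    with hT
  have hTc : Continuous T := ContinuousMap.continuous _
  have hTm : ∀ y, MeasurePreserving (T y) (volume : Measure (Eucl n)) volume := fun y =>
    measurePreserving_sub_right volume y
  have hcont : Continuous fun y => Lp.compMeasurePreserving (T y) (hTm y) Z :=
    continuous_const.compMeasurePreservingLp hTc hTm ENNReal.ofReal_ne_top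
  have hint : ∀ y, ‖Lp.compMeasurePreserving (T y) (hTm y) Z - Z‖ₑ ^ p =
      ∫⁻ x, ‖z (x - y) - z x‖ₑ ^ p := by
    intro y
    rw [enorm_Lp_rpow]
    refine lintegral_congr_ae ?_
    filter_upwards [Lp.coeFn_sub (Lp.compMeasurePreserving (T y) (hTm y) Z) Z,
      Lp.coeFn_compMeasurePreserving Z (hTm y), hz.coeFn_toLp,
      (hTm y).quasiMeasurePreserving.ae hz.coeFn_toLp] with x h1 h2 h3 h4
    rw [h1, Pi.sub_apply, h2, h3, Function.comp_apply, h4]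
    rfl
  have h0 : Lp.compMeasurePreserving (T 0) (hTm 0) Z - Z = 0 := by
    have := hint 0
    simp only [sub_zero, sub_self, enorm_zero, ENNReal.zero_rpow_of_pos hp0, lintegral_zero] at this
    rw [ENNReal.rpow_eq_zero_iff] at this
    rcases this with h | h
    · exact enorm_eq_zero.1 h.1
    · exact absurd h.2 (by linarith)
  have hlim : Tendsto (fun y => ‖Lp.compMeasurePreserving (T y) (hTm y) Z - Z‖ₑ ^ p) (𝓝 0)
      (𝓝 0) := by
    have hc : Continuous fun y => ‖Lp.compMeasurePreserving (T y) (hTm y) Z - Z‖ₑ ^ p :=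
      ENNReal.continuous_rpow_const.comp (continuous_enorm.comp (hcont.sub continuous_const))
    have := hc.tendsto 0
    rwa [h0, enorm_zero, ENNReal.zero_rpow_of_pos hp0] at this
  obtain ⟨δ, hδ, H⟩ := Metric.eventually_nhds_iff.1 (hlim.eventually (gt_mem_nhds hη))
  refine ⟨δ, hδ, fun y hy => ?_⟩
  rw [← hint y]
  exact (H (by simpa using hy)).le

variable [NormedSpace ℝ F]

theorem integrable_normed_smul_translate {z : Eucl n → F} (hz : LocallyIntegrable z)
    (ρ : ContDiffBump (0 : Eucl n)) (x : Eucl n) :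
    Integrable fun y => ρ.normed volume y • z (x - y) :=
  ρ.hasCompactSupport_normed.convolutionExists_left (ContinuousLinearMap.lsmul ℝ ℝ)
    ρ.continuous_normed hz x

/-- Mollifications converge in `L^p`. -/
theorem MeasureTheory.MemLp.exists_lintegral_convolution_sub_le [CompleteSpace F] {z : Eucl n → F}
    (hz : MemLp z (ENNReal.ofReal p) volume) {η : ℝ≥0∞} (hη : 0 < η) :
    ∃ δ > 0, ∀ ρ : ContDiffBump (0 : Eucl n), ρ.rOut < δ →
      ∫⁻ x, ‖(∫ y, ρ.normed volume y • z (x - y)) - z x‖ₑ ^ p ≤ η := by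
  have hp0 : 0 < p := by linarith [hp.out]
  obtain ⟨δ, hδ, H⟩ := hz.exists_lintegral_translate_sub_le hη
  refine ⟨δ, hδ, fun ρ hρ => ?_⟩
  have hloc : LocallyIntegrable z := hz.locallyIntegrable Fact.out
  set r : Eucl n → ℝ := ρ.normed volume with hr
  have hr0 : ∀ y, 0 ≤ r y := ρ.nonneg_normed
  -- Viewing the mollifier as a probability measure, Jensen and Fubini bound the error by an average
  -- of translation errors, over y in the support of the bump only.
  set ν : Measure (Eucl n) := volume.withDensity fun y => ENNReal.ofReal (r y) with hν
  have hrm : Measurable fun y => ENNReal.ofReal (r y) :=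
    ρ.continuous_normed.measurable.ennreal_ofReal
  have hν1 : ν univ = 1 := by
    rw [hν, withDensity_apply _ MeasurableSet.univ, Measure.restrict_univ,
      ← ofReal_integral_eq_lintegral_ofReal ρ.integrable_normed (Eventually.of_forall hr0),
      ρ.integral_normed, ENNReal.ofReal_one]
  have : IsFiniteMeasure ν := ⟨by rw [hν1]; exact ENNReal.one_lt_top⟩
  have hνac : ν ≪ volume := withDensity_absolutelyContinuous _ _
  have hmeas : AEMeasurable (fun w : Eucl n × Eucl n => ‖z (w.1 - w.2) - z w.1‖ₑ)
      (volume.prod volume) := by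
    have h1 : AEStronglyMeasurable (fun w : Eucl n × Eucl n => z (w.1 - w.2))
        (volume.prod volume) :=
      hz.1.comp_quasiMeasurePreserving
        (quasiMeasurePreserving_sub (volume : Measure (Eucl n)) volume)
    exact (h1.sub hz.1.comp_fst).enorm
  have hslice : ∀ x, AEMeasurable (fun y => ‖z (x - y) - z x‖ₑ) ν := by
    intro x
    have h1 : AEStronglyMeasurable (fun y => z (x - y)) volume :=
      hz.1.comp_quasiMeasurePreserving (quasiMeasurePreserving_sub_left volume x)
    exact ((h1.sub aestronglyMeasurable_const).enorm).mono_ac hνac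
  have hpt : ∀ x, ‖(∫ y, r y • z (x - y)) - z x‖ₑ ^ p ≤ ∫⁻ y, ‖z (x - y) - z x‖ₑ ^ p ∂ν := by
    intro x
    have e1 : (∫ y, r y • z (x - y)) - z x = ∫ y, r y • (z (x - y) - z x) := by
      simp only [smul_sub]
      rw [integral_sub (integrable_normed_smul_translate hloc ρ x)
        (ρ.integrable_normed.smul_const _), integral_smul_const, ρ.integral_normed, one_smul]
    have e2 : ‖∫ y, r y • (z (x - y) - z x)‖ₑ ≤ ∫⁻ y, ‖z (x - y) - z x‖ₑ ∂ν := by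
      refine (enorm_integral_le_lintegral_enorm _).trans_eq ?_
      rw [hν, lintegral_withDensity_eq_lintegral_mul_non_measurable₀ _ hrm.aemeasurable
        (Eventually.of_forall fun _ => ENNReal.ofReal_lt_top)]
      refine lintegral_congr fun y => ?_
      rw [enorm_smul, Pi.mul_apply, Real.enorm_of_nonneg (hr0 y)]
    rw [e1]
    refine (ENNReal.rpow_le_rpow e2 hp0.le).trans ?_
    have := lintegral_rpow_le_measure_univ_mul ν (hslice x) hp.out
    rwa [hν1, ENNReal.one_rpow, one_mul] at this
  calc ∫⁻ x, ‖(∫ y, r y • z (x - y)) - z x‖ₑ ^ p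
      ≤ ∫⁻ x, ∫⁻ y, ‖z (x - y) - z x‖ₑ ^ p ∂ν := lintegral_mono hpt
    _ = ∫⁻ y, (∫⁻ x, ‖z (x - y) - z x‖ₑ ^ p) ∂ν := by
        refine lintegral_lintegral_swap (f := fun x y => ‖z (x - y) - z x‖ₑ ^ p) ?_
        exact (hmeas.pow_const p).mono_ac (Measure.AbsolutelyContinuous.rfl.prod hνac)
    _ ≤ ∫⁻ _, η ∂ν := by
        refine lintegral_mono_ae ?_
        rw [hν, ae_withDensity_iff hrm]
        refine Eventually.of_forall fun y hy => H y ?_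
        have hy' : y ∈ Function.support (ρ.normed volume) := fun h => hy (by
          rw [hr, h, ENNReal.ofReal_zero])
        rw [ρ.support_normed_eq, mem_ball_zero_iff] at hy'
        exact hy'.trans hρ
    _ = η := by rw [lintegral_const, hν1, mul_one]

end Mollification

/-! ### Cutoffs, compactly supported Sobolev functions and admissible competitors -/

section CompactSupport

open scoped Convolution

variable {n : ℕ} {p : ℝ} [hp : Fact (1 < p)] {U : Set (Eucl n)}

/-- Product of a Sobolev function and a test function, extended by zero. -/
theorem HasWeakGradient.mul_isTestFunction (hU : MeasurableSet U) {f χ : Eucl n → ℝ}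
    {g : Eucl n → Eucl n} (h : HasWeakGradient U f g) (hχ : IsTestFunction U χ)
    (hf : IntegrableOn f U) (hg : IntegrableOn g U) :
    HasWeakGradient univ (fun x => χ x * U.indicator f x)
      (fun x => χ x • U.indicator g x + U.indicator f x • gradient χ x) := by
  intro φ hφ e
  have hχφ : IsTestFunction U fun x => χ x * φ x :=
    ⟨hχ.1.mul hφ.1, hχ.2.1.mul_right, (tsupport_mul_subset_left).trans hχ.2.2⟩
  have hd1 := hχ.1.differentiable (by simp)
  have hd2 := hφ.1.differentiable (by simp)
  -- Testing with χφ and applying the product rule moves the term φ∇χ to the gradient side.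
  have key := h _ hχφ e
  have e1 : ∀ x, fderiv ℝ (fun x => χ x * φ x) x e =
      χ x * fderiv ℝ φ x e + φ x * fderiv ℝ χ x e := by
    intro x
    rw [fderiv_fun_mul (hd1 x) (hd2 x)]
    simp
  have c1 : Continuous fun x => fderiv ℝ φ x e :=
    (hφ.1.continuous_fderiv (by simp)).clm_apply continuous_const
  have c2 : Continuous fun x => fderiv ℝ χ x e :=
    (hχ.1.continuous_fderiv (by simp)).clm_apply continuous_const
  have hmul : ∀ {w : Eucl n → ℝ} {ψ : Eucl n → ℝ}, IntegrableOn w U → Continuous ψ →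
      HasCompactSupport ψ → IntegrableOn (fun x => w x * ψ x) U := by
    intro w ψ hw hψ hψc
    obtain ⟨K, hK⟩ := hψc.exists_bound_of_continuous hψ
    exact hw.mul_bdd (c := K) hψ.aestronglyMeasurable (Eventually.of_forall hK)
  have i1 : IntegrableOn (fun x => f x * (χ x * fderiv ℝ φ x e)) U :=
    hmul hf (hχ.1.continuous.mul c1) hχ.2.1.mul_right
  have i2 : IntegrableOn (fun x => f x * (φ x * fderiv ℝ χ x e)) U :=
    hmul hf (hφ.1.continuous.mul c2) hφ.2.1.mul_right
  have i3 : IntegrableOn (fun x => inner ℝ (g x) e * (χ x * φ x)) U :=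
    hmul (hg.inner_const e) (hχ.1.continuous.mul hφ.1.continuous) hχ.2.1.mul_right
  have k1 : ∫ x in U, f x * fderiv ℝ (fun x => χ x * φ x) x e =
      (∫ x in U, f x * (χ x * fderiv ℝ φ x e)) + ∫ x in U, f x * (φ x * fderiv ℝ χ x e) := by
    rw [← integral_add i1 i2]
    congr 1 with x
    rw [e1, mul_add]
  have l1 : ∫ x in univ, χ x * U.indicator f x * fderiv ℝ φ x e =
      ∫ x in U, f x * (χ x * fderiv ℝ φ x e) := by
    rw [← integral_indicator hU, Measure.restrict_univ]
    congr 1 with x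
    by_cases hx : x ∈ U
    · simp only [indicator_of_mem hx]
      ring
    · simp [hx]
  have l2 : ∫ x in univ,
      inner ℝ (χ x • U.indicator g x + U.indicator f x • gradient χ x) e * φ x =
      (∫ x in U, inner ℝ (g x) e * (χ x * φ x)) + ∫ x in U, f x * (φ x * fderiv ℝ χ x e) := by
    rw [← integral_add i3 i2, ← integral_indicator hU, Measure.restrict_univ]
    congr 1 with x
    by_cases hx : x ∈ U
    · simp only [indicator_of_mem hx]
      rw [inner_add_left, real_inner_smul_left, real_inner_smul_left, inner_gradient_left]
      ring
    · simp [hx]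
  rw [l1, l2]
  linarith

/-- The gradient of a mollification is the mollification of the weak gradient. -/
theorem HasWeakGradient.gradient_convolution {z : Eucl n → ℝ} {g : Eucl n → Eucl n}
    (h : HasWeakGradient univ z g) (hz : LocallyIntegrable z) (hg : LocallyIntegrable g)
    (ρ : ContDiffBump (0 : Eucl n)) (x : Eucl n) :
    gradient (fun x => ∫ y, ρ.normed volume y • z (x - y)) x =
      ∫ y, ρ.normed volume y • g (x - y) := by
  set r := ρ.normed (volume : Measure (Eucl n)) with hr
  have hrs : ContDiff ℝ ∞ r := ρ.contDiff_normed
  have hrc : HasCompactSupport r := ρ.hasCompactSupport_normed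
  refine ext_inner_right ℝ fun e => ?_
  rw [inner_gradient_left]
  have hd := hrc.hasFDerivAt_convolution_left (ContinuousLinearMap.lsmul ℝ ℝ) (μ := volume)
    (hrs.of_le (by simp)) hz x
  have hd' : fderiv ℝ (fun x => ∫ y, r y • z (x - y)) x =
      ((fderiv ℝ r) ⋆[(ContinuousLinearMap.lsmul ℝ ℝ).precompL (Eucl n), volume] z) x := hd.fderiv
  have hex : Integrable fun t => ((ContinuousLinearMap.lsmul ℝ ℝ).precompL (Eucl n) (fderiv ℝ r t))
      (z (x - t)) :=
    (hrc.fderiv (𝕜 := ℝ)).convolutionExists_left _ (hrs.continuous_fderiv (by simp)) hz x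
  rw [hd', convolution_def, ContinuousLinearMap.integral_apply hex]
  simp only [ContinuousLinearMap.precompL_apply, ContinuousLinearMap.lsmul_apply, smul_eq_mul]
  -- The derivative of the convolution falls on the mollifier; the reflected mollifier is the test
  -- function that transfers it to the weak gradient.
  have hψ : IsTestFunction univ fun y => r (x - y) :=
    ⟨hrs.comp (contDiff_const.sub contDiff_id), hrc.comp_homeomorph (Homeomorph.subLeft x),
      subset_univ _⟩
  have hw := h _ hψ e
  have hfd : ∀ y, fderiv ℝ (fun y => r (x - y)) y e = - fderiv ℝ r (x - y) e := by
    intro y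
    have h1 := ((hrs.differentiable (by simp)) (x - y)).hasFDerivAt.comp y
      ((hasFDerivAt_id y).const_sub x)
    have h2 : fderiv ℝ (fun y => r (x - y)) y = _ := h1.fderiv
    rw [h2]
    simp
  simp only [Measure.restrict_univ, hfd, mul_neg, integral_neg, neg_inj] at hw
  have l1 : ∫ t, fderiv ℝ r t e * z (x - t) = ∫ y, z y * fderiv ℝ r (x - y) e := by
    rw [← integral_sub_left_eq_self (fun y => z y * fderiv ℝ r (x - y) e) volume x]
    congr 1 with t
    rw [sub_sub_cancel, mul_comm]
  rw [l1, hw, ← integral_sub_left_eq_self _ volume x, real_inner_comm,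
    ← integral_inner (integrable_normed_smul_translate hg ρ x)]
  congr 1 with t
  rw [sub_sub_cancel, real_inner_smul_right, real_inner_comm e, mul_comm]

/-- Compactly supported weakly differentiable functions are approximated by `C¹` functions with
compact support. -/
theorem HasWeakGradient.exists_contDiff_lintegral_sub_le (hU : IsOpen U) {z : Eucl n → ℝ}
    {g : Eucl n → Eucl n} (h : HasWeakGradient univ z g)
    (hz : MemLp z (ENNReal.ofReal p) volume) (hg : MemLp g (ENNReal.ofReal p) volume)
    {K : Set (Eucl n)} (hK : IsCompact K) (hKU : K ⊆ U) (hzK : ∀ x ∉ K, z x = 0)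
    {η : ℝ≥0∞} (hη : 0 < η) :
    ∃ w : Eucl n → ℝ, ContDiff ℝ 1 w ∧ HasCompactSupport w ∧ tsupport w ⊆ U ∧
      ∫⁻ x, ‖w x - z x‖ₑ ^ p ≤ η ∧ ∫⁻ x, ‖gradient w x - g x‖ₑ ^ p ≤ η := by
  obtain ⟨δ₁, hδ₁, H₁⟩ := hz.exists_lintegral_convolution_sub_le hη
  obtain ⟨δ₂, hδ₂, H₂⟩ := hg.exists_lintegral_convolution_sub_le hη
  obtain ⟨δ₃, hδ₃, H₃⟩ := hK.exists_cthickening_subset_open hU hKU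
  -- The first two radii control the errors of the function and its gradient, the third keeps the
  -- thickened support inside `U`.
  obtain ⟨δ, hδ, hδlt⟩ : ∃ δ : ℝ, 0 < δ ∧ δ < min δ₁ (min δ₂ δ₃) :=
    exists_between (by positivity)
  obtain ⟨h1, h2⟩ := lt_min_iff.1 hδlt
  obtain ⟨h2, h3⟩ := lt_min_iff.1 h2
  let ρ : ContDiffBump (0 : Eucl n) := ⟨δ / 2, δ, by positivity, by linarith⟩
  set w : Eucl n → ℝ := fun x => ∫ y, ρ.normed volume y • z (x - y) with hw
  have hzl : LocallyIntegrable z := hz.locallyIntegrable Fact.out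
  have hgl : LocallyIntegrable g := hg.locallyIntegrable Fact.out
  have hws : ContDiff ℝ 1 w := ρ.hasCompactSupport_normed.contDiff_convolution_left
    (ContinuousLinearMap.lsmul ℝ ℝ) (n := 1) ρ.contDiff_normed hzl
  have hwg : gradient w = fun x => ∫ y, ρ.normed volume y • g (x - y) :=
    funext fun x => h.gradient_convolution hzl hgl ρ x
  have hwsupp : tsupport w ⊆ Metric.cthickening δ K := by
    refine closure_minimal (fun x hx => ?_) Metric.isClosed_cthickening
    by_contra hxn
    refine hx (integral_eq_zero_of_ae (Eventually.of_forall fun y => ?_))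
    by_cases hy : y ∈ Metric.ball (0 : Eucl n) δ
    · have : z (x - y) = 0 := by
        refine hzK _ fun hmem => hxn ?_
        refine Metric.mem_cthickening_of_dist_le x (x - y) δ _ hmem ?_
        rw [dist_eq_norm, sub_sub_cancel]
        exact (mem_ball_zero_iff.1 hy).le
      simp [this]
    · have : ρ.normed volume y = 0 := by
        by_contra hne
        have : y ∈ Function.support (ρ.normed volume) := hne
        rw [ρ.support_normed_eq] at this
        exact hy this
      simp [this]
  refine ⟨w, hws, hK.cthickening.of_isClosed_subset (isClosed_tsupport _) hwsupp,
    (hwsupp.trans (Metric.cthickening_mono h3.le _)).trans H₃, H₁ ρ h1, ?_⟩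
  rw [hwg]
  exact H₂ ρ h2

theorem norm_Lp_sub_le_of_lintegral {E : Type*} [NormedAddCommGroup E]
    {a b : Lp E (ENNReal.ofReal p) (volume.restrict U)} {a' b' : Eucl n → E}
    (ha : a =ᵐ[volume.restrict U] a') (hb : b =ᵐ[volume.restrict U] b') {ε : ℝ} (hε : 0 ≤ ε)
    (h : ∫⁻ x in U, ‖b' x - a' x‖ₑ ^ p ≤ ENNReal.ofReal ε ^ p) : ‖a - b‖ ≤ ε := by
  have hp0 : 0 < p := by linarith [hp.out]
  have h1 : ‖a - b‖ₑ ^ p ≤ ENNReal.ofReal ε ^ p := by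
    rw [enorm_Lp_rpow]
    refine le_trans (lintegral_congr_ae ?_).le h
    filter_upwards [Lp.coeFn_sub a b, ha, hb] with x hx hxa hxb
    rw [hx, Pi.sub_apply, hxa, hxb, enorm_sub_rev]
  rwa [ENNReal.rpow_le_rpow_iff hp0, ← ofReal_norm, ENNReal.ofReal_le_ofReal_iff hε] at h1

/-- Weakly differentiable functions supported in a compact subset of `U` belong to
`W^{1,p}_0(U)`. -/
theorem mem_sobolevZero_of_compactSupport (hU : IsOpen U) {z : Eucl n → ℝ}
    {g : Eucl n → Eucl n} (h : HasWeakGradient univ z g)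
    (hz : MemLp z (ENNReal.ofReal p) volume) (hg : MemLp g (ENNReal.ofReal p) volume)
    {K : Set (Eucl n)} (hK : IsCompact K) (hKU : K ⊆ U) (hzK : ∀ x ∉ K, z x = 0)
    {u : SobolevSpace p U} (hu : sobFun u =ᵐ[volume.restrict U] z)
    (hug : sobGrad u =ᵐ[volume.restrict U] g) : u ∈ SobolevZero p U := by
  refine Metric.mem_closure_iff.2 fun ε hε => ?_
  have hηpos : 0 < ENNReal.ofReal (ε / 2) ^ p :=
    ENNReal.rpow_pos (by simpa using hε) ENNReal.ofReal_ne_top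
  obtain ⟨w, hws, hwc, hwU, h1, h2⟩ :=
    h.exists_contDiff_lintegral_sub_le hU hz hg hK hKU hzK hηpos
  have hwgc : HasCompactSupport (gradient w) := (hwc.fderiv (𝕜 := ℝ)).comp_left (map_zero _)
  have m1 : MemLp w (ENNReal.ofReal p) volume := hws.continuous.memLp_of_hasCompactSupport hwc
  have m2 : MemLp (gradient w) (ENNReal.ofReal p) volume :=
    (continuous_gradient hws).memLp_of_hasCompactSupport hwgc
  let ζ : SobolevSpace p U := sobMk (m1.restrict U) (m2.restrict U) (hasWeakGradient_gradient hws U)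
  have hζw : sobFun ζ =ᵐ[volume.restrict U] w := sobFun_sobMk _ _ _
  have hζg : sobGrad ζ =ᵐ[volume.restrict U] gradient w := sobGrad_sobMk _ _ _
  refine ⟨ζ, ⟨w, hws, hwc, hwU, hζw⟩, ?_⟩
  have n1 : ‖u.1.1 - ζ.1.1‖ ≤ ε / 2 := norm_Lp_sub_le_of_lintegral hu hζw (by positivity)
    ((setLIntegral_le_lintegral U _).trans h1)
  have n2 : ‖u.1.2 - ζ.1.2‖ ≤ ε / 2 := norm_Lp_sub_le_of_lintegral hug hζg (by positivity)
    ((setLIntegral_le_lintegral U _).trans h2)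
  rw [dist_eq_norm]
  change max ‖u.1.1 - ζ.1.1‖ ‖u.1.2 - ζ.1.2‖ < ε
  exact (max_le n1 n2).trans_lt (by linarith)

/-- The product of a Sobolev function and a test function belongs to `W^{1,p}_0`. -/
theorem exists_sobolevZero_mul (hU : IsOpen U) (hUv : volume U ≠ ⊤) (f : SobolevSpace p U)
    {χ : Eucl n → ℝ} (hχ : IsTestFunction U χ) :
    ∃ z ∈ SobolevZero p U, sobGrad z =ᵐ[volume.restrict U]
      fun x => χ x • sobGrad f x + sobFun f x • gradient χ x := by
  have hUm := hU.measurableSet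
  obtain ⟨Z, hZ⟩ : ∃ Z : Eucl n → ℝ, Z = fun x => χ x * U.indicator (sobFun f) x := ⟨_, rfl⟩
  obtain ⟨G, hG⟩ : ∃ G : Eucl n → Eucl n, G = fun x => χ x • U.indicator (sobGrad f) x +
    U.indicator (sobFun f) x • gradient χ x := ⟨_, rfl⟩
  have hZG : HasWeakGradient univ Z G := hZ ▸ hG ▸ (hasWeakGradient_sob f).mul_isTestFunction hUm hχ
    (integrableOn_Lp hUv f.1.1) (integrableOn_Lp hUv f.1.2)
  have hf1 : MemLp (U.indicator (sobFun f)) (ENNReal.ofReal p) volume :=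
    (memLp_indicator_iff_restrict hUm).2 (Lp.memLp f.1.1)
  have hg1 : MemLp (U.indicator (sobGrad f)) (ENNReal.ofReal p) volume :=
    (memLp_indicator_iff_restrict hUm).2 (Lp.memLp f.1.2)
  have hχ1 : ContDiff ℝ 1 χ := hχ.1.of_le (by simp)
  have hgc : HasCompactSupport (gradient χ) := (hχ.2.1.fderiv (𝕜 := ℝ)).comp_left (map_zero _)
  have hχt : MemLp χ ⊤ volume := hχ.1.continuous.memLp_of_hasCompactSupport hχ.2.1
  have hχgt : MemLp (gradient χ) ⊤ volume :=
    (continuous_gradient hχ1).memLp_of_hasCompactSupport hgc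
  have hZp : MemLp Z (ENNReal.ofReal p) volume :=
    hZ ▸ hf1.smul (r := ENNReal.ofReal p) hχt
  have hGp : MemLp G (ENNReal.ofReal p) volume :=
    hG ▸ (hg1.smul (r := ENNReal.ofReal p) hχt).add (hχgt.smul (r := ENNReal.ofReal p) hf1)
  obtain ⟨z, hzZ, hzG⟩ : ∃ z : SobolevSpace p U, sobFun z =ᵐ[volume.restrict U] Z ∧
      sobGrad z =ᵐ[volume.restrict U] G :=
    ⟨sobMk (hZp.restrict U) (hGp.restrict U) (hZG.mono (subset_univ U)),
      sobFun_sobMk _ _ _, sobGrad_sobMk _ _ _⟩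
  refine ⟨z, ?_, hzG.trans ?_⟩
  · refine mem_sobolevZero_of_compactSupport hU hZG hZp hGp hχ.2.1.isCompact hχ.2.2 ?_ hzZ hzG
    intro x hx
    simp [hZ, image_eq_zero_of_notMem_tsupport hx]
  · rw [Filter.EventuallyEq, ae_restrict_iff' hUm]
    exact Eventually.of_forall fun x hx => by simp [hG, hx]

/-- Being 1 on a whole neighbourhood makes the gradient of the cutoff vanish on the closure. -/
theorem exists_isTestFunction_eq_one {A : Set (Eucl n)} (hU : IsOpen U)
    (hA : IsCompact (closure A)) (hAU : closure A ⊆ U) :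
    ∃ χ : Eucl n → ℝ, IsTestFunction U χ ∧ ∀ᶠ x in 𝓝ˢ (closure A), χ x = 1 := by
  obtain ⟨K, hK, hAK, hKU⟩ := exists_compact_between hA hU hAU
  obtain ⟨χ, h1, h0, -⟩ := exists_contMDiffMap_one_nhds_of_subset_interior
    (modelWithCornersSelf ℝ (Eucl n)) (n := (⊤ : ℕ∞)) hA.isClosed hAK
  have hsub : tsupport χ ⊆ K := closure_minimal (fun x hx => by
    by_contra h
    exact hx (h0 x h)) hK.isClosed
  exact ⟨χ, ⟨χ.contMDiff.contDiff, hK.of_isClosed_subset (isClosed_tsupport _) hsub,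
    hsub.trans hKU⟩, h1⟩

/-- There are functions with prescribed trace and vanishing gradient in a compactly contained
set. -/
theorem perfectConductorClass_nonempty {A : Set (Eucl n)} (hU : IsOpen U) (hUv : volume U ≠ ⊤)
    (hA : IsOpen A) (hAc : IsCompact (closure A)) (hAU : closure A ⊆ U) (f : SobolevSpace p U) :
    (perfectConductorClass U A f).Nonempty := by
  obtain ⟨χ, hχ, hχ1⟩ := exists_isTestFunction_eq_one hU hAc hAU
  obtain ⟨z, hz, hzg⟩ := exists_sobolevZero_mul hU hUv f hχ
  have hneg : ∀ y ∈ SobolevZero p U, -y ∈ SobolevZero p U := by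
    intro y hy
    refine map_mem_closure (f := fun y : SobolevSpace p U => -y) continuous_neg hy ?_
    rintro y ⟨φ, h1, h2, h3, h4⟩
    refine ⟨-φ, h1.neg, h2.neg, ?_, ?_⟩
    · rwa [tsupport_neg]
    · filter_upwards [Lp.coeFn_neg y.1.1, h4] with x hx hx4
      rw [Pi.neg_apply, ← hx4]
      exact hx
  -- The competitor is f - χf: its trace is that of f, and it vanishes where χ = 1.
  refine ⟨f - z, ?_, ?_⟩
  · change f - z - f ∈ _
    rw [sub_sub_cancel_left]
    exact hneg z hz
  · have hsub : A ⊆ U := subset_closure.trans hAU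
    have h1 := ae_mono (Measure.restrict_mono hsub le_rfl) (sobGrad_sub f z)
    have h2 := ae_mono (Measure.restrict_mono hsub le_rfl) hzg
    filter_upwards [h1, h2, ae_restrict_mem hA.measurableSet] with x hx1 hx2 hxA
    have hev : χ =ᶠ[𝓝 x] fun _ => 1 :=
      hχ1.filter_mono (nhds_le_nhdsSet (subset_closure hxA))
    have hg0 : gradient χ x = 0 := by
      rw [gradient, hev.fderiv_eq]
      simp
    rw [hx1, hx2, hev.eq_of_nhds, hg0, smul_zero, add_zero, one_smul, sub_self]

end CompactSupport

end

noncomputable section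

/-! ### Semicontinuity and uniform convexity of weighted Dirichlet energies -/

section GradEnergy

variable {n : ℕ} {p : ℝ} [hp : Fact (1 < p)] {U : Set (Eucl n)}

/-- The weighted Dirichlet energy `∫_U a |∇u|^p dx`. -/
def gradEnergy (a : Eucl n → ℝ≥0∞) (u : SobolevSpace p U) : ℝ≥0∞ :=
  ∫⁻ x in U, a x * ‖sobGrad u x‖ₑ ^ p

theorem aestronglyMeasurable_sobGrad (u : SobolevSpace p U) :
    AEStronglyMeasurable (sobGrad u) (volume.restrict U) :=
  (Lp.memLp u.1.2).1

theorem aemeasurable_mul_enorm_sobGrad_rpow {a : Eucl n → ℝ≥0∞}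
    (ha : AEMeasurable a (volume.restrict U)) (u : SobolevSpace p U) :
    AEMeasurable (fun x => a x * ‖sobGrad u x‖ₑ ^ p) (volume.restrict U) :=
  ha.mul ((aestronglyMeasurable_sobGrad u).enorm.pow_const p)

/-- Fatou's lemma along a subsequence whose gradients converge almost everywhere; finiteness of the
weight is needed for the product to pass to the limit. -/
theorem lowerSemicontinuous_gradEnergy {a : Eucl n → ℝ≥0∞}
    (ha : AEMeasurable a (volume.restrict U)) (hat : ∀ᵐ x ∂(volume.restrict U), a x ≠ ⊤) :
    LowerSemicontinuous (gradEnergy a : SobolevSpace p U → ℝ≥0∞) := by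
  refine lowerSemicontinuous_iff_isClosed_preimage.2 fun y => ?_
  refine IsSeqClosed.isClosed fun u u₀ hu hlim => ?_
  have h1 : Tendsto (fun k => (u k).1.2) atTop (𝓝 u₀.1.2) :=
    ((continuous_snd.comp continuous_subtype_val).tendsto u₀).comp hlim
  obtain ⟨ns, hns, hae⟩ := (tendstoInMeasure_of_tendsto_Lp h1).exists_seq_tendsto_ae
  have hle : gradEnergy a u₀ ≤ liminf (fun i => gradEnergy a (u (ns i))) atTop := by
    refine le_trans ?_ (lintegral_liminf_le'
      fun i => aemeasurable_mul_enorm_sobGrad_rpow ha (u (ns i)))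
    refine lintegral_mono_ae ?_
    filter_upwards [hae, hat] with x hx hax
    refine le_of_eq (Tendsto.liminf_eq ?_).symm
    exact ENNReal.Tendsto.const_mul
      ((ENNReal.continuous_rpow_const.tendsto _).comp ((continuous_enorm.tendsto _).comp hx))
      (Or.inr hax)
  refine hle.trans (liminf_le_of_le (by isBoundedDefault) fun b hb => ?_)
  obtain ⟨i, hi⟩ := hb.exists
  exact hi.trans (hu (ns i))

/-- The constant is half of the one for the real inequality. Keeping the midpoint term on the left
avoids subtraction in `ℝ≥0∞`. -/
theorem exists_enorm_sub_rpow_add_le {E : Type*} [NormedAddCommGroup E] [InnerProductSpace ℝ E]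
    [FiniteDimensional ℝ E] {p : ℝ} (hp : 1 < p) {ε : ℝ≥0} (hε : 0 < ε) :
    ∃ C : ℝ≥0, ∀ x y : E, ‖x - y‖ₑ ^ p + (2 * C : ℝ≥0) * ‖(1 / 2 : ℝ) • (x + y)‖ₑ ^ p ≤
      (ε + C : ℝ≥0) * (‖x‖ₑ ^ p + ‖y‖ₑ ^ p) := by
  obtain ⟨C, hC, h⟩ := exists_norm_sub_rpow_add_le (E := E) hp (ε := ε) (by exact_mod_cast hε)
  have hp0 : 0 ≤ p := by linarith
  refine ⟨(C / 2).toNNReal, fun x y => ?_⟩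
  have e : ∀ z : E, ‖z‖ₑ ^ p = ((‖z‖₊ ^ p : ℝ≥0) : ℝ≥0∞) := fun z =>
    (ENNReal.coe_rpow_of_nonneg _ hp0).symm
  simp only [e]
  have key : ‖x - y‖₊ ^ p + 2 * (C / 2).toNNReal * ‖(1 / 2 : ℝ) • (x + y)‖₊ ^ p ≤
      (ε + (C / 2).toNNReal) * (‖x‖₊ ^ p + ‖y‖₊ ^ p) := by
    rw [← NNReal.coe_le_coe]
    push_cast
    rw [Real.coe_toNNReal _ (by positivity)]
    have := h x y
    rwa [mul_div_cancel₀ _ two_ne_zero]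
  exact_mod_cast key

/-- Multiply the pointwise inequality by the weight and integrate. The constants do not see the
weight, which makes the convexity uniform along a sequence of weights. -/
theorem gradEnergy_sub_add_le {a : Eucl n → ℝ≥0∞} (ha : AEMeasurable a (volume.restrict U))
    {ε C : ℝ≥0}
    (h : ∀ x y : Eucl n, ‖x - y‖ₑ ^ p + (2 * C : ℝ≥0) * ‖(1 / 2 : ℝ) • (x + y)‖ₑ ^ p ≤
      (ε + C : ℝ≥0) * (‖x‖ₑ ^ p + ‖y‖ₑ ^ p)) (u v : SobolevSpace p U) :
    gradEnergy a (u - v) + (2 * C : ℝ≥0) * gradEnergy a ((1 / 2 : ℝ) • (u + v)) ≤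
      (ε + C : ℝ≥0) * (gradEnergy a u + gradEnergy a v) := by
  unfold gradEnergy
  rw [← lintegral_const_mul' _ _ ENNReal.coe_ne_top,
    ← lintegral_add_left' (aemeasurable_mul_enorm_sobGrad_rpow ha _),
    ← lintegral_add_left' (aemeasurable_mul_enorm_sobGrad_rpow ha _),
    ← lintegral_const_mul' _ _ ENNReal.coe_ne_top]
  refine lintegral_mono_ae ?_
  filter_upwards [sobGrad_sub u v, sobGrad_smul (1 / 2 : ℝ) (u + v), sobGrad_add u v]
    with x h1 h2 h3
  rw [h1, h2, h3]
  calc a x * ‖sobGrad u x - sobGrad v x‖ₑ ^ p +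
        (2 * C : ℝ≥0) * (a x * ‖(1 / 2 : ℝ) • (sobGrad u x + sobGrad v x)‖ₑ ^ p)
      = a x * (‖sobGrad u x - sobGrad v x‖ₑ ^ p +
          (2 * C : ℝ≥0) * ‖(1 / 2 : ℝ) • (sobGrad u x + sobGrad v x)‖ₑ ^ p) := by ring
    _ ≤ a x * ((ε + C : ℝ≥0) * (‖sobGrad u x‖ₑ ^ p + ‖sobGrad v x‖ₑ ^ p)) :=
        mul_le_mul_right (h _ _) _
    _ = _ := by ring

theorem sameTrace_sub_mem {u v f : SobolevSpace p U} (hu : SameTrace u f) (hv : SameTrace v f) :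
    u - v ∈ SobolevZero p U := by
  have hcont : Continuous fun z : SobolevSpace p U × SobolevSpace p U => z.1 - z.2 := by fun_prop
  have : u - f - (v - f) ∈ SobolevZero p U := map_mem_closure₂ hcont hu hv
    (u := {u | ∃ φ : Eucl n → ℝ, ContDiff ℝ 1 φ ∧ HasCompactSupport φ ∧ tsupport φ ⊆ U ∧
      sobFun u =ᵐ[volume.restrict U] φ}) ?_
  · rwa [sub_sub_sub_cancel_right] at this
  · rintro a ⟨φ, h1, h2, h3, h4⟩ b ⟨ψ, k1, k2, k3, k4⟩
    refine ⟨φ - ψ, h1.sub k1, h2.sub k2, (tsupport_sub _ _).trans (union_subset h3 k3), ?_⟩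
    filter_upwards [sobFun_sub a b, h4, k4] with x hx hx1 hx2
    rw [hx, hx1, hx2, Pi.sub_apply]

theorem sobolevZero_smul {c : ℝ} {u : SobolevSpace p U} (hu : u ∈ SobolevZero p U) :
    c • u ∈ SobolevZero p U := by
  refine map_mem_closure (f := fun u : SobolevSpace p U => c • u) (continuous_const_smul c) hu ?_
  rintro a ⟨φ, h1, h2, h3, h4⟩
  refine ⟨c • φ, h1.const_smul c, h2.smul_left,
    (tsupport_smul_subset_right (fun _ => c) φ).trans h3, ?_⟩
  filter_upwards [Lp.coeFn_smul c a.1.1, h4] with x hx hx1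
  rw [Pi.smul_apply, ← hx1]
  exact hx

/-- The reflection 2f - v has the trace of f as well, and the midpoint minus f is half of u - (2f -
v). -/
theorem sameTrace_midpoint {u v f : SobolevSpace p U} (hu : SameTrace u f) (hv : SameTrace v f) :
    SameTrace ((1 / 2 : ℝ) • (u + v)) f := by
  have h1 : u - (f - (v - f)) ∈ SobolevZero p U := by
    refine sameTrace_sub_mem (f := f) hu ?_
    have : f - (v - f) - f = (-1 : ℝ) • (v - f) := by
      module
    change _ ∈ _
    rw [this]
    exact sobolevZero_smul hv
  have h2 : (1 / 2 : ℝ) • (u + v) - f = (1 / 2 : ℝ) • (u - (f - (v - f))) := by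
    module
  change _ ∈ _
  rw [h2]
  exact sobolevZero_smul h1

theorem isClosed_sameTrace (f : SobolevSpace p U) : IsClosed {u | SameTrace u f} :=
  isClosed_closure.preimage (continuous_id.sub continuous_const)

theorem exists_nnreal_mul_eq (R : ℝ≥0) {ε : ℝ} (hε : 0 < ε) :
    ∃ τ : ℝ≥0, 0 < τ ∧ (2 * (R + 1) * τ : ℝ) = ε := by
  refine ⟨(ε / (2 * (R + 1))).toNNReal, Real.toNNReal_pos.2 (by positivity), ?_⟩
  rw [Real.coe_toNNReal _ (by positivity)]
  field_simp

theorem mul_lt_of_two_mul_add_one_mul_eq {R τ : ℝ≥0} {ε : ℝ} (hτ : 0 < τ)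
    (h : (2 * (R + 1) * τ : ℝ) = ε) : (R * τ : ℝ) < ε := by
  have h9 : (0 : ℝ) < τ := hτ
  have h10 : (0 : ℝ) ≤ R * τ := by positivity
  linarith

theorem exists_le_one_mul_le (C : ℝ≥0) {κ : ℝ≥0} (hκ : 0 < κ) :
    ∃ δ : ℝ≥0, 0 < δ ∧ 4 * (C + 1) * δ ≤ κ ∧ δ ≤ 1 := by
  refine ⟨min 1 (κ / (4 * (C + 1))), by positivity, ?_, min_le_left _ _⟩
  calc 4 * (C + 1) * min 1 (κ / (4 * (C + 1))) ≤ 4 * (C + 1) * (κ / (4 * (C + 1))) := by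
        gcongr
        exact min_le_right _ _
    _ = κ := by field_simp

set_option maxHeartbeats 4000000 in
/-- Weighted Dirichlet energies with a common positive lower bound on the weights are uniformly
convex on classes of functions with the same trace. -/
theorem uniformlyConvexSeq_gradEnergy (hn : 0 < n) (hU : IsOpen U) (hUb : Bornology.IsBounded U)
    {a : ℕ → Eucl n → ℝ≥0∞} (ha : ∀ k, AEMeasurable (a k) (volume.restrict U)) {c : ℝ≥0}
    (hc : 0 < c) (hca : ∀ k, ∀ᵐ x ∂(volume.restrict U), (c : ℝ≥0∞) ≤ a k x)
    (f : SobolevSpace p U) :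
    UniformlyConvexSeq {u | SameTrace u f} fun k => gradEnergy (a k) := by
  intro M ε hε
  have hp0 : 0 < p := by linarith [hp.out]
  obtain ⟨R, hR⟩ := exists_norm_le_norm_gradient p hn hU hUb
  -- Order of choices: τ is the gradient bound that Poincaré's inequality turns into ε, κ = cτ^p the
  -- matching energy; then η depends on κ and M, C on η, and δ on κ and C.
  obtain ⟨τ, hτpos, hτ⟩ := exists_nnreal_mul_eq R hε
  obtain ⟨κ, hκ⟩ : ∃ κ : ℝ≥0, κ = c * τ ^ p := ⟨_, rfl⟩
  have hκpos : 0 < κ := hκ ▸ mul_pos hc (NNReal.rpow_pos hτpos)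
  obtain ⟨η, hηpos, hη, -⟩ := exists_le_one_mul_le M hκpos
  obtain ⟨C, hC⟩ := exists_enorm_sub_rpow_add_le (E := Eucl n) hp.out hηpos
  obtain ⟨δ, hδpos, hδ, hδ1⟩ := exists_le_one_mul_le C hκpos
  refine ⟨δ, hδpos, fun k u hu v hv m hm hum hvm hmid => ?_⟩
  have hmt : m ≠ ⊤ := ne_top_of_le_ne_top ENNReal.coe_ne_top hm
  lift m to ℝ≥0 using hmt
  have hmM : m ≤ M := by exact_mod_cast hm
  have hkey := gradEnergy_sub_add_le (ha k) hC u v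
  -- The lower bound m at the midpoint produces the term 2Cm, which cancels; only the small quantity
  -- 2η(m+δ) + 2Cδ is left.
  have h1 : gradEnergy (a k) (u - v) + ((2 * C * m : ℝ≥0) : ℝ≥0∞) ≤
      ((2 * η * (m + δ) + 2 * C * δ : ℝ≥0) : ℝ≥0∞) + ((2 * C * m : ℝ≥0) : ℝ≥0∞) := by
    calc gradEnergy (a k) (u - v) + ((2 * C * m : ℝ≥0) : ℝ≥0∞)
        ≤ gradEnergy (a k) (u - v) +
            (2 * C : ℝ≥0) * gradEnergy (a k) ((1 / 2 : ℝ) • (u + v)) := by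
          rw [ENNReal.coe_mul (2 * C)]
          gcongr
      _ ≤ (η + C : ℝ≥0) * (gradEnergy (a k) u + gradEnergy (a k) v) := hkey
      _ ≤ (η + C : ℝ≥0) * ((m + δ) + (m + δ)) := by gcongr
      _ = _ := by
          norm_cast
          ring
  have h2 : gradEnergy (a k) (u - v) ≤ ((2 * η * (m + δ) + 2 * C * δ : ℝ≥0) : ℝ≥0∞) :=
    (ENNReal.add_le_add_iff_right ENNReal.coe_ne_top).1 h1
  have h3 : 2 * η * (m + δ) + 2 * C * δ ≤ κ := by
    have a1 : 2 * (2 * η * (m + δ)) ≤ κ := by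
      refine le_trans ?_ hη
      calc 2 * (2 * η * (m + δ)) ≤ 2 * (2 * η * (M + 1)) := by gcongr
        _ = _ := by ring
    have a2 : 2 * (2 * C * δ) ≤ κ := by
      refine le_trans ?_ hδ
      calc 2 * (2 * C * δ) ≤ 2 * (2 * (C + 1) * δ) := by
            gcongr
            exact le_self_add
        _ = _ := by ring
    rw [← NNReal.coe_le_coe] at a1 a2 ⊢
    push_cast at a1 a2 ⊢
    linarith
  have h4 : (c : ℝ≥0∞) * ‖(u - v).1.2‖ₑ ^ p ≤ gradEnergy (a k) (u - v) := by
    rw [enorm_Lp_rpow, ← lintegral_const_mul' _ _ ENNReal.coe_ne_top]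
    refine lintegral_mono_ae ?_
    filter_upwards [hca k] with x hx
    exact mul_le_mul_left hx _
  have h5 : (c : ℝ≥0∞) * ‖(u - v).1.2‖ₑ ^ p ≤ c * (τ : ℝ≥0∞) ^ p := by
    refine h4.trans (h2.trans ((ENNReal.coe_le_coe.2 h3).trans_eq ?_))
    rw [hκ, ENNReal.coe_mul, ENNReal.coe_rpow_of_nonneg _ hp0.le]
  rw [ENNReal.mul_le_mul_iff_right (by exact_mod_cast hc.ne') ENNReal.coe_ne_top,
    ENNReal.rpow_le_rpow_iff hp0] at h5
  have h6 : ‖(u - v).1.2‖ ≤ τ := by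
    have : ‖(u - v).1.2‖₊ ≤ τ := ENNReal.coe_le_coe.1 h5
    exact_mod_cast this
  have h7 := hR _ (sameTrace_sub_mem hu hv)
  have h8 : (R : ℝ) * ‖(u - v).1.2‖ ≤ R * τ := mul_le_mul_of_nonneg_left h6 R.2
  exact (h7.trans h8).trans_lt (mul_lt_of_two_mul_add_one_mul_eq hτpos hτ)

end GradEnergy

end

noncomputable section

/-! ### Comparing a density with powers of the field -/

section Coefficients

variable {α : Type*} {m : MeasurableSpace α} {ν : Measure α}

theorem ofReal_mul_norm_rpow {F : Type*} [SeminormedAddCommGroup F] {p lam : ℝ} (hp : 0 ≤ p)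
    (hlam : 0 < lam) (y : F) :
    ENNReal.ofReal (lam * ‖y‖) ^ p = ENNReal.ofReal (lam ^ p) * ‖y‖ₑ ^ p := by
  rw [ENNReal.ofReal_mul hlam.le, ofReal_norm, ENNReal.mul_rpow_of_nonneg _ _ hp,
    ENNReal.ofReal_rpow_of_pos hlam]

theorem ofReal_one_div_rpow_mul_cancel {p lam : ℝ} (hlam : 0 < lam) (t : ℝ≥0∞) :
    ENNReal.ofReal (1 / lam ^ p) * (ENNReal.ofReal (lam ^ p) * t) = t := by
  have h : 0 < lam ^ p := Real.rpow_pos_of_pos hlam p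
  rw [← mul_assoc, ← ENNReal.ofReal_mul (by positivity), one_div_mul_cancel h.ne',
    ENNReal.ofReal_one, one_mul]

/-- At E = λ|g| the power term scales by λ^p, which the normalization cancels, whereas the additive
constant is divided by λ^p and disappears as λ → ∞. -/
theorem lintegral_mul_enorm_rpow_le {F : Type*} [SeminormedAddCommGroup F] {p : ℝ} (hp : 0 ≤ p)
    {Q : α → ℝ → ℝ} {b : α → ℝ≥0∞} {C : ℝ≥0∞}
    (h : ∀ᵐ x ∂ν, ∀ E : ℝ, 0 ≤ E → b x * ENNReal.ofReal E ^ p ≤ ENNReal.ofReal (Q x E) + C)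
    {lam : ℝ} (hlam : 0 < lam) (g : α → F) :
    ∫⁻ x, b x * ‖g x‖ₑ ^ p ∂ν ≤ ENNReal.ofReal (1 / lam ^ p) *
      ((∫⁻ x, ENNReal.ofReal (Q x (lam * ‖g x‖)) ∂ν) + C * ν univ) := by
  rw [← lintegral_const, ← lintegral_add_right _ measurable_const,
    ← lintegral_const_mul' _ _ ENNReal.ofReal_ne_top]
  refine lintegral_mono_ae ?_
  filter_upwards [h] with x hx
  calc b x * ‖g x‖ₑ ^ p
      = ENNReal.ofReal (1 / lam ^ p) * (b x * ENNReal.ofReal (lam * ‖g x‖) ^ p) := by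
        rw [ofReal_mul_norm_rpow hp hlam, mul_left_comm (b x), ofReal_one_div_rpow_mul_cancel hlam]
    _ ≤ _ := by
        gcongr
        exact hx _ (by positivity)

theorem mul_lintegral_le_lintegral_mul_enorm_rpow {F : Type*} [SeminormedAddCommGroup F] {p : ℝ}
    (hp : 0 ≤ p) {Q : α → ℝ → ℝ} {b : α → ℝ≥0∞} {C : ℝ≥0∞}
    (h : ∀ᵐ x ∂ν, ∀ E : ℝ, 0 ≤ E → ENNReal.ofReal (Q x E) ≤ b x * ENNReal.ofReal E ^ p + C)
    {lam : ℝ} (hlam : 0 < lam) (g : α → F) :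
    ENNReal.ofReal (1 / lam ^ p) * ∫⁻ x, ENNReal.ofReal (Q x (lam * ‖g x‖)) ∂ν ≤
      (∫⁻ x, b x * ‖g x‖ₑ ^ p ∂ν) + ENNReal.ofReal (1 / lam ^ p) * (C * ν univ) := by
  rw [← lintegral_const, ← lintegral_const_mul' _ _ ENNReal.ofReal_ne_top,
    ← lintegral_const_mul' _ _ ENNReal.ofReal_ne_top,
    ← lintegral_add_right _ (measurable_const.const_mul _)]
  refine lintegral_mono_ae ?_
  filter_upwards [h] with x hx
  calc ENNReal.ofReal (1 / lam ^ p) * ENNReal.ofReal (Q x (lam * ‖g x‖))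
      ≤ ENNReal.ofReal (1 / lam ^ p) * (b x * ENNReal.ofReal (lam * ‖g x‖) ^ p + C) := by
        gcongr
        exact hx _ (by positivity)
    _ = _ := by
        rw [ofReal_mul_norm_rpow hp hlam, mul_add, mul_left_comm (b x),
          ofReal_one_div_rpow_mul_cancel hlam]

/-- The infimum of `Q(x, r) / r^p` over the rational numbers `r ≥ K`. -/
def lowerRatio (Q : α → ℝ → ℝ) (p K : ℝ) (x : α) : ℝ≥0∞ :=
  ⨅ (r : ℚ) (_ : K ≤ r), ENNReal.ofReal (Q x r / (r : ℝ) ^ p)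

/-- The supremum of `Q(x, r) / r^p` over the rational numbers `r ≥ K`. -/
def upperRatio (Q : α → ℝ → ℝ) (p K : ℝ) (x : α) : ℝ≥0∞ :=
  ⨆ (r : ℚ) (_ : K ≤ r), ENNReal.ofReal (Q x r / (r : ℝ) ^ p)

variable {Q : α → ℝ → ℝ} {p K : ℝ}

theorem aemeasurable_lowerRatio (hQ : ∀ E : ℝ, 0 ≤ E → AEMeasurable (fun x => Q x E) ν)
    (hK : 0 ≤ K) : AEMeasurable (lowerRatio Q p K) ν :=
  AEMeasurable.iInf fun r => AEMeasurable.iInf fun hr =>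
    ((hQ r (hK.trans hr)).div_const _).ennreal_ofReal

theorem aemeasurable_upperRatio (hQ : ∀ E : ℝ, 0 ≤ E → AEMeasurable (fun x => Q x E) ν)
    (hK : 0 ≤ K) : AEMeasurable (upperRatio Q p K) ν :=
  AEMeasurable.iSup fun r => AEMeasurable.iSup fun hr =>
    ((hQ r (hK.trans hr)).div_const _).ennreal_ofReal

theorem lowerRatio_mono {K' : ℝ} (h : K ≤ K') (x : α) : lowerRatio Q p K x ≤ lowerRatio Q p K' x :=
  le_iInf₂ fun r hr => iInf₂_le r (h.trans hr)

/-- Rational r keep the ratios measurable in x; continuity in the field recovers all real E.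
Approximation from above keeps r ≥ K. -/
theorem exists_rat_tendsto_ratio (hK : 0 < K) {x : α} (hx : ContinuousOn (Q x) (Ici 0)) {E : ℝ}
    (hE : K ≤ E) : ∃ r : ℕ → ℚ, (∀ k, K ≤ r k) ∧
      Tendsto (fun k => ENNReal.ofReal (Q x (r k) / (r k : ℝ) ^ p)) atTop
        (𝓝 (ENNReal.ofReal (Q x E / E ^ p))) := by
  obtain ⟨r, -, hr, hlim⟩ := Real.exists_seq_rat_strictAnti_tendsto E
  have hE0 : 0 < E := hK.trans_le hE
  refine ⟨r, fun k => hE.trans (hr k).le, ENNReal.tendsto_ofReal (Tendsto.div ?_ ?_ ?_)⟩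
  · exact (hx E hE0.le).tendsto.comp (tendsto_nhdsWithin_iff.2
      ⟨hlim, Eventually.of_forall fun k => (hE0.trans (hr k)).le⟩)
  · exact hlim.rpow_const (Or.inl hE0.ne')
  · exact (Real.rpow_pos_of_pos hE0 p).ne'

theorem lowerRatio_le (hK : 0 < K) {x : α} (hx : ContinuousOn (Q x) (Ici 0)) {E : ℝ}
    (hE : K ≤ E) : lowerRatio Q p K x ≤ ENNReal.ofReal (Q x E / E ^ p) := by
  obtain ⟨r, hr, hlim⟩ := exists_rat_tendsto_ratio (p := p) hK hx hE
  exact ge_of_tendsto' hlim fun k => iInf₂_le (r k) (hr k)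

theorem le_upperRatio (hK : 0 < K) {x : α} (hx : ContinuousOn (Q x) (Ici 0)) {E : ℝ}
    (hE : K ≤ E) : ENNReal.ofReal (Q x E / E ^ p) ≤ upperRatio Q p K x := by
  obtain ⟨r, hr, hlim⟩ := exists_rat_tendsto_ratio (p := p) hK hx hE
  exact le_of_tendsto' hlim fun k => le_iSup₂_of_le (r k) (hr k) le_rfl

theorem ofReal_div_rpow_mul {E : ℝ} (hE : 0 < E) (y : ℝ) :
    ENNReal.ofReal (y / E ^ p) * ENNReal.ofReal E ^ p = ENNReal.ofReal y := by
  have h : 0 < E ^ p := Real.rpow_pos_of_pos hE p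
  rw [ENNReal.ofReal_rpow_of_pos hE, ← ENNReal.ofReal_mul' h.le, div_mul_cancel₀ _ h.ne']

/-- Above the threshold K the ratio bound applies; below it the left side is at most D K^p. -/
theorem lowerRatio_mul_le (hp : 0 ≤ p) (hK : 0 < K) {x : α} (hx : ContinuousOn (Q x) (Ici 0))
    {D : ℝ≥0∞} (hD : lowerRatio Q p K x ≤ D) (E : ℝ) :
    lowerRatio Q p K x * ENNReal.ofReal E ^ p ≤
      ENNReal.ofReal (Q x E) + D * ENNReal.ofReal K ^ p := by
  rcases le_total K E with h | h
  · refine le_trans ?_ le_self_add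
    rw [← ofReal_div_rpow_mul (p := p) (hK.trans_le h) (Q x E)]
    gcongr
    exact lowerRatio_le hK hx h
  · refine le_trans ?_ le_add_self
    gcongr

theorem le_upperRatio_mul (hK : 0 < K) {x : α} (hx : ContinuousOn (Q x) (Ici 0))
    {D : ℝ≥0∞} {E : ℝ} (hD : E ≤ K → ENNReal.ofReal (Q x E) ≤ D) :
    ENNReal.ofReal (Q x E) ≤ upperRatio Q p K x * ENNReal.ofReal E ^ p + D := by
  rcases le_total K E with h | h
  · refine le_trans ?_ le_self_add
    rw [← ofReal_div_rpow_mul (p := p) (hK.trans_le h) (Q x E)]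
    gcongr
    exact le_upperRatio hK hx h
  · exact (hD h).trans le_add_self

variable {b : ℝ}

theorem iSup_lowerRatio (hK : 0 < K) {x : α} (hx : ContinuousOn (Q x) (Ici 0))
    (hb : Tendsto (fun E : ℝ => Q x E / E ^ p) atTop (𝓝 b)) :
    ⨆ k : ℕ, lowerRatio Q p (K + k) x = ENNReal.ofReal b := by
  have hb' := ENNReal.tendsto_ofReal hb
  refine le_antisymm (iSup_le fun k => ?_) (le_of_forall_lt fun t ht => ?_)
  · refine ge_of_tendsto hb' ?_
    filter_upwards [eventually_ge_atTop (K + k)] with E hE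
    exact lowerRatio_le (by positivity) hx hE
  · obtain ⟨t', ht', htb⟩ := exists_between ht
    obtain ⟨E₁, hE₁⟩ := eventually_atTop.1 (hb'.eventually (lt_mem_nhds htb))
    obtain ⟨k, hk⟩ := exists_nat_ge E₁
    refine ht'.trans_le (le_iSup_of_le k (le_iInf₂ fun r hr => (hE₁ r ?_).le))
    linarith

theorem tendsto_upperRatio (hK : 0 < K) {x : α} (hx : ContinuousOn (Q x) (Ici 0))
    (hb : Tendsto (fun E : ℝ => Q x E / E ^ p) atTop (𝓝 b)) :
    Tendsto (fun k : ℕ => upperRatio Q p (K + k) x) atTop (𝓝 (ENNReal.ofReal b)) := by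
  have hb' := ENNReal.tendsto_ofReal hb
  refine tendsto_order.2 ⟨fun t ht => Eventually.of_forall fun k => ht.trans_le ?_, fun t ht => ?_⟩
  · refine le_of_tendsto hb' ?_
    filter_upwards [eventually_ge_atTop (K + k)] with E hE
    exact le_upperRatio (by positivity) hx hE
  · obtain ⟨t', htb, ht'⟩ := exists_between ht
    obtain ⟨E₁, hE₁⟩ := eventually_atTop.1 (hb'.eventually (gt_mem_nhds htb))
    filter_upwards [tendsto_natCast_atTop_atTop.eventually (eventually_ge_atTop E₁)] with k hk
    refine lt_of_le_of_lt (iSup₂_le fun r hr => (hE₁ r ?_).le) ht'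
    linarith

variable {c C E₀ : ℝ}

/-- From 2E₀ on, t = (r/E₀)^p is at least 2, so t - 1 ≥ t/2; this keeps the weights uniformly
positive. -/
theorem le_lowerRatio (hp : 1 ≤ p) (hc : 0 ≤ c) (hE₀ : 0 < E₀) (hK : 2 * E₀ ≤ K) {x : α}
    (hx : ∀ E, 0 ≤ E → c * ((E / E₀) ^ p - 1) ≤ Q x E) :
    ENNReal.ofReal (c / (2 * E₀ ^ p)) ≤ lowerRatio Q p K x := by
  refine le_iInf₂ fun r hr => ENNReal.ofReal_le_ofReal ?_
  have hr0 : (0 : ℝ) < r := by linarith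
  have hr2 : 2 ≤ (r / E₀ : ℝ) := by rw [le_div_iff₀ hE₀]; linarith
  have h2 : 2 ≤ (r / E₀ : ℝ) ^ p :=
    hr2.trans (Real.self_le_rpow_of_one_le (by linarith) hp)
  have h3 : 0 < E₀ ^ p := Real.rpow_pos_of_pos hE₀ p
  have h4 : 0 < (r : ℝ) ^ p := Real.rpow_pos_of_pos hr0 p
  calc c / (2 * E₀ ^ p) = c * ((r / E₀ : ℝ) ^ p / 2) / (r : ℝ) ^ p := by
        rw [Real.div_rpow hr0.le hE₀.le]
        field_simp
    _ ≤ c * ((r / E₀ : ℝ) ^ p - 1) / (r : ℝ) ^ p := by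
        gcongr
        linarith
    _ ≤ _ := by
        gcongr
        exact hx r hr0.le

theorem upperRatio_le (hp : 0 ≤ p) (hC : 0 ≤ C) (hE₀ : 0 < E₀) (hK : E₀ ≤ K) {x : α}
    (hx : ∀ E, 0 ≤ E → Q x E ≤ C * ((E / E₀) ^ p + 1)) :
    upperRatio Q p K x ≤ ENNReal.ofReal (2 * C / E₀ ^ p) := by
  refine iSup₂_le fun r hr => ENNReal.ofReal_le_ofReal ?_
  have hr0 : (0 : ℝ) < r := by linarith
  have h2 : 1 ≤ (r / E₀ : ℝ) ^ p :=
    Real.one_le_rpow (by rw [le_div_iff₀ hE₀]; linarith) hp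
  have h3 : 0 < E₀ ^ p := Real.rpow_pos_of_pos hE₀ p
  have h4 : 0 < (r : ℝ) ^ p := Real.rpow_pos_of_pos hr0 p
  calc Q x r / (r : ℝ) ^ p ≤ C * ((r / E₀ : ℝ) ^ p + 1) / (r : ℝ) ^ p := by
        gcongr
        exact hx r hr0.le
    _ ≤ C * (2 * (r / E₀ : ℝ) ^ p) / (r : ℝ) ^ p := by
        gcongr
        linarith
    _ = _ := by
        rw [Real.div_rpow hr0.le hE₀.le]
        field_simp

theorem lowerRatio_le_upperRatio (x : α) : lowerRatio Q p K x ≤ upperRatio Q p K x := by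
  obtain ⟨r, hr⟩ := exists_rat_gt K
  exact (iInf₂_le r hr.le).trans
    (le_iSup₂ (f := fun (r : ℚ) (_ : K ≤ r) => ENNReal.ofReal (Q x r / (r : ℝ) ^ p)) r hr.le)

/-- A power of higher order dominates any multiple of one of lower order, up to a constant. -/
theorem exists_mul_rpow_le_growth {q : ℝ} (hp : 0 ≤ p) (hpq : p < q) (hc : 0 < c) (hE₀ : 0 < E₀)
    (M : ℝ≥0) : ∃ C : ℝ≥0, ∀ E y : ℝ, 0 ≤ E → c * ((E / E₀) ^ q - 1) ≤ y →
      M * ENNReal.ofReal E ^ p ≤ ENNReal.ofReal y + C := by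
  have hq : 0 < E₀ ^ q := Real.rpow_pos_of_pos hE₀ q
  -- The field strength at which c(E/E₀)^q overtakes M E^p.
  set T : ℝ := (M * E₀ ^ q / c) ^ (1 / (q - p)) with hT
  have hT0 : 0 ≤ T := by positivity
  refine ⟨(c + M * T ^ p).toNNReal, fun E y hE hy => ?_⟩
  have key : M * E ^ p ≤ c * (E / E₀) ^ q + M * T ^ p := by
    rcases le_total E T with h | h
    · have h1 : E ^ p ≤ T ^ p := Real.rpow_le_rpow hE h hp
      have h2 : (M : ℝ) * E ^ p ≤ M * T ^ p := mul_le_mul_of_nonneg_left h1 M.2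
      have h3 : 0 ≤ c * (E / E₀) ^ q := by positivity
      linarith
    · have h1 : M * E₀ ^ q / c ≤ E ^ (q - p) := by
        calc M * E₀ ^ q / c = T ^ (q - p) := by
              rw [hT, ← Real.rpow_mul (by positivity), one_div_mul_cancel (by linarith),
                Real.rpow_one]
          _ ≤ _ := Real.rpow_le_rpow hT0 h (by linarith)
      have h2 : M * E ^ p ≤ c * (E / E₀) ^ q := by
        have h3 : (M : ℝ) ≤ c * E ^ (q - p) / E₀ ^ q := by
          rw [le_div_iff₀ hq]
          rwa [div_le_iff₀ hc, mul_comm _ c] at h1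
        calc M * E ^ p ≤ c * E ^ (q - p) / E₀ ^ q * E ^ p := by gcongr
          _ = c * (E ^ (q - p) * E ^ p) / E₀ ^ q := by ring
          _ = c * (E / E₀) ^ q := by
              rw [← Real.rpow_add_of_nonneg hE (by linarith) hp, sub_add_cancel,
                Real.div_rpow hE hE₀.le, mul_div_assoc]
      have h3 : 0 ≤ M * T ^ p := by positivity
      linarith
  calc (M : ℝ≥0∞) * ENNReal.ofReal E ^ p = ENNReal.ofReal (M * E ^ p) := by
        rw [ENNReal.ofReal_mul (NNReal.coe_nonneg M), ENNReal.ofReal_coe_nnreal,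
          ENNReal.ofReal_rpow_of_nonneg hE hp]
    _ ≤ ENNReal.ofReal (y + (c + M * T ^ p)) := ENNReal.ofReal_le_ofReal (by linarith)
    _ ≤ _ := ENNReal.ofReal_add_le

theorem mul_rpow_le_of_growth {q : ℝ} (hq : 0 ≤ q) (hc : 0 ≤ c) (hE₀ : 0 < E₀) {E y : ℝ}
    (hE : 0 ≤ E) (hy : c * ((E / E₀) ^ q - 1) ≤ y) :
    ENNReal.ofReal (c / E₀ ^ q) * ENNReal.ofReal E ^ q ≤ ENNReal.ofReal y + ENNReal.ofReal c := by
  have h3 : 0 < E₀ ^ q := Real.rpow_pos_of_pos hE₀ q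
  rw [ENNReal.ofReal_rpow_of_nonneg hE hq, ← ENNReal.ofReal_mul (by positivity)]
  refine (ENNReal.ofReal_le_ofReal ?_).trans ENNReal.ofReal_add_le
  rw [Real.div_rpow hE hE₀.le] at hy
  have : c / E₀ ^ q * E ^ q = c * (E ^ q / E₀ ^ q) := by ring
  linarith

end Coefficients

/-! ### Lower and upper weights converging to the asymptotic coefficient -/

section Coefficients

variable {n : ℕ} {p c C E₀ : ℝ} {U : Set (Eucl n)} {Q : Eucl n → ℝ → ℝ} {β : Eucl n → ℝ}

/-- Increasing weights that bound the density from below, up to constants, and converge to the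
asymptotic coefficient. -/
theorem exists_lower_weights (hp : 1 < p) (hQ : IsCaratheodory U Q) (hc : 0 < c) (hcC : c ≤ C)
    (hE₀ : 0 < E₀) (hg : HasGrowth U Q p c C E₀) (hβ : HasAsymptoticGrowth U Q p β) :
    ∃ (a : ℕ → Eucl n → ℝ≥0∞) (c₀ D : ℝ≥0) (R : ℕ → ℝ≥0), 0 < c₀ ∧
      (∀ k, AEMeasurable (a k) (volume.restrict U)) ∧ (∀ x, Monotone fun k => a k x) ∧
      (∀ k, ∀ᵐ x ∂(volume.restrict U), (c₀ : ℝ≥0∞) ≤ a k x ∧ a k x ≤ D) ∧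
      (∀ᵐ x ∂(volume.restrict U), ⨆ k, a k x = ENNReal.ofReal (β x)) ∧
      ∀ k, ∀ᵐ x ∂(volume.restrict U), ∀ E : ℝ, 0 ≤ E →
        a k x * ENNReal.ofReal E ^ p ≤ ENNReal.ofReal (Q x E) + R k := by
  have hp0 : 0 ≤ p := by linarith
  have hK : ∀ k : ℕ, 2 * E₀ ≤ 2 * E₀ + k := fun k => by linarith [Nat.cast_nonneg (α := ℝ) k]
  have hK0 : ∀ k : ℕ, 0 < 2 * E₀ + k := fun k => by positivity
  have h3 : 0 < E₀ ^ p := Real.rpow_pos_of_pos hE₀ p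
  have hbd : ∀ k : ℕ, ∀ᵐ x ∂(volume.restrict U),
      ENNReal.ofReal (c / (2 * E₀ ^ p)) ≤ lowerRatio Q p (2 * E₀ + k) x ∧
      lowerRatio Q p (2 * E₀ + k) x ≤ ENNReal.ofReal (2 * C / E₀ ^ p) := by
    intro k
    filter_upwards [hg] with x hx
    exact ⟨le_lowerRatio hp.le hc.le hE₀ (hK k) fun E hE => (hx E hE).1,
      (lowerRatio_le_upperRatio x).trans (upperRatio_le hp0 (hc.le.trans hcC) hE₀
        (by linarith [hK k]) fun E hE => (hx E hE).2)⟩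
  refine ⟨fun k => lowerRatio Q p (2 * E₀ + k), (c / (2 * E₀ ^ p)).toNNReal,
    (2 * C / E₀ ^ p).toNNReal,
    fun k => (2 * C / E₀ ^ p).toNNReal * (2 * E₀ + k).toNNReal ^ p, ?_, fun k => ?_,
    fun x i j hij => ?_, hbd, ?_, fun k => ?_⟩
  · exact Real.toNNReal_pos.2 (by positivity)
  · exact aemeasurable_lowerRatio hQ.1 (hK0 k).le
  · exact lowerRatio_mono (by gcongr) x
  · filter_upwards [hQ.2, hβ] with x hx hb
    exact iSup_lowerRatio (by positivity) hx hb
  · filter_upwards [hQ.2, hbd k] with x hx hb E hE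
    rw [ENNReal.coe_mul, ENNReal.coe_rpow_of_nonneg _ hp0]
    exact lowerRatio_mul_le hp0 (hK0 k) hx hb.2 E

/-- Weights that bound the density from above, up to constants, and converge to the asymptotic
coefficient. -/
theorem exists_upper_weights (hp : 1 < p) (hQ : IsCaratheodory U Q) (hC : 0 ≤ C)
    (hE₀ : 0 < E₀) (hg : HasGrowth U Q p c C E₀) (hβ : HasAsymptoticGrowth U Q p β) :
    ∃ (a : ℕ → Eucl n → ℝ≥0∞) (D : ℝ≥0) (R : ℕ → ℝ≥0),
      (∀ k, AEMeasurable (a k) (volume.restrict U)) ∧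
      (∀ k, ∀ᵐ x ∂(volume.restrict U), a k x ≤ D) ∧
      (∀ᵐ x ∂(volume.restrict U), Tendsto (fun k => a k x) atTop (𝓝 (ENNReal.ofReal (β x)))) ∧
      ∀ k, ∀ᵐ x ∂(volume.restrict U), ∀ E : ℝ, 0 ≤ E →
        ENNReal.ofReal (Q x E) ≤ a k x * ENNReal.ofReal E ^ p + R k := by
  have hp0 : 0 ≤ p := by linarith
  have hK0 : ∀ k : ℕ, 0 < E₀ + k := fun k => by positivity
  refine ⟨fun k => upperRatio Q p (E₀ + k), (2 * C / E₀ ^ p).toNNReal,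
    fun k => (C * (((E₀ + k) / E₀) ^ p + 1)).toNNReal, fun k => ?_, fun k => ?_, ?_, fun k => ?_⟩
  · exact aemeasurable_upperRatio hQ.1 (hK0 k).le
  · filter_upwards [hg] with x hx
    exact upperRatio_le hp0 hC hE₀ (by linarith [Nat.cast_nonneg (α := ℝ) k])
      fun E hE => (hx E hE).2
  · filter_upwards [hQ.2, hβ] with x hx hb
    exact tendsto_upperRatio hE₀ hx hb
  · filter_upwards [hQ.2, hg] with x hx hb E hE
    refine le_upperRatio_mul (hK0 k) hx fun h => ENNReal.ofReal_le_ofReal ((hb E hE).2.trans ?_)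
    gcongr

end Coefficients

end

noncomputable section

/-! ### The limiting problem for the perfect conductor -/

section Conductor

variable {n : ℕ} {Ω A : Set (Eucl n)}

theorem IsConductorGeometry.measurableSet_outerRegion (h : IsConductorGeometry Ω A) :
    MeasurableSet (outerRegion Ω A) :=
  h.isOpen_domain.measurableSet.diff isClosed_closure.measurableSet

theorem IsConductorGeometry.inner_subset (h : IsConductorGeometry Ω A) : A ⊆ Ω :=
  subset_closure.trans h.closure_inner_subset

theorem disjoint_outerRegion (Ω A : Set (Eucl n)) : Disjoint (outerRegion Ω A) A :=
  disjoint_sdiff_left.mono_right subset_closure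

/-- The interface ∂A is a null set by the Lipschitz condition, so it carries no energy. -/
theorem IsConductorGeometry.restrict_domain (h : IsConductorGeometry Ω A) :
    (volume.restrict Ω : Measure (Eucl n)) =
      volume.restrict (outerRegion Ω A) + volume.restrict A := by
  rw [← Measure.restrict_union (disjoint_outerRegion Ω A) h.isOpen_inner.measurableSet]
  refine Measure.restrict_congr_set ?_
  have h0 : ∀ᵐ x : Eucl n, x ∉ frontier A :=
    measure_eq_zero_iff_ae_notMem.1 (h.lipschitz_inner.volume_frontier_eq_zero h.isOpen_inner)
  refine eventuallyEq_set.2 ?_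
  filter_upwards [h0] with x hx
  rw [h.isOpen_inner.frontier_eq] at hx
  constructor
  · intro hxΩ
    by_cases hxA : x ∈ closure A
    · exact Or.inr (by_contra fun hA => hx ⟨hxA, hA⟩)
    · exact Or.inl ⟨hxΩ, hxA⟩
  · rintro (hxB | hxA)
    · exact hxB.1
    · exact h.inner_subset hxA

theorem IsConductorGeometry.volume_domain_ne_top (h : IsConductorGeometry Ω A) : volume Ω ≠ ⊤ :=
  h.isBounded_domain.measure_lt_top.ne

theorem IsConductorGeometry.volume_outer_ne_top (h : IsConductorGeometry Ω A) :
    volume (outerRegion Ω A) ≠ ⊤ :=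
  measure_ne_top_of_subset sdiff_subset h.volume_domain_ne_top

theorem IsConductorGeometry.volume_inner_ne_top (h : IsConductorGeometry Ω A) : volume A ≠ ⊤ :=
  measure_ne_top_of_subset h.inner_subset h.volume_domain_ne_top

/-- The weight `a` on the outer region, and the constant `k + 1` on the inner region. -/
def conductorWeight (Ω A : Set (Eucl n)) (a : ℕ → Eucl n → ℝ≥0∞) (k : ℕ) : Eucl n → ℝ≥0∞ :=
  fun x => (outerRegion Ω A).indicator (a k) x + A.indicator (fun _ => ((k + 1 : ℝ≥0) : ℝ≥0∞)) x

variable {a : ℕ → Eucl n → ℝ≥0∞}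

theorem conductorWeight_outer {x : Eucl n} (hx : x ∈ outerRegion Ω A) (k : ℕ) :
    conductorWeight Ω A a k x = a k x := by
  rw [conductorWeight, indicator_of_mem hx,
    indicator_of_notMem ((disjoint_outerRegion Ω A).notMem_of_mem_left hx), add_zero]

theorem conductorWeight_inner {x : Eucl n} (hx : x ∈ A) (k : ℕ) :
    conductorWeight Ω A a k x = (k + 1 : ℝ≥0) := by
  rw [conductorWeight, indicator_of_mem hx,
    indicator_of_notMem ((disjoint_outerRegion Ω A).notMem_of_mem_right hx), zero_add]

theorem monotone_conductorWeight (ha : ∀ x, Monotone fun k => a k x) (x : Eucl n) :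
    Monotone fun k => conductorWeight Ω A a k x := by
  intro i j hij
  refine add_le_add (indicator_le_indicator (ha x hij)) (indicator_le_indicator ?_)
  exact_mod_cast Nat.add_le_add_right hij 1

theorem IsConductorGeometry.aemeasurable_conductorWeight (h : IsConductorGeometry Ω A)
    (ha : ∀ k, AEMeasurable (a k) (volume.restrict (outerRegion Ω A))) (k : ℕ) :
    AEMeasurable (conductorWeight Ω A a k) (volume.restrict Ω) :=
  (((aemeasurable_indicator_iff h.measurableSet_outerRegion).2 (ha k)).add
    ((measurable_const.indicator h.isOpen_inner.measurableSet).aemeasurable)).restrict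

theorem IsConductorGeometry.ae_domain (h : IsConductorGeometry Ω A) {P : Eucl n → Prop}
    (hB : ∀ᵐ x ∂(volume.restrict (outerRegion Ω A)), P x) (hA : ∀ᵐ x ∂(volume.restrict A), P x) :
    ∀ᵐ x ∂(volume.restrict Ω), P x := by
  rw [h.restrict_domain]
  exact ae_add_measure_iff.2 ⟨hB, hA⟩

variable {p : ℝ} [hp : Fact (1 < p)]

theorem IsConductorGeometry.gradEnergy_conductorWeight (h : IsConductorGeometry Ω A) (k : ℕ)
    (u : SobolevSpace p Ω) : gradEnergy (conductorWeight Ω A a k) u =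
      (∫⁻ x in outerRegion Ω A, a k x * ‖sobGrad u x‖ₑ ^ p) +
        ∫⁻ x in A, ((k + 1 : ℝ≥0) : ℝ≥0∞) * ‖sobGrad u x‖ₑ ^ p := by
  rw [gradEnergy, h.restrict_domain, lintegral_add_measure]
  congr 1
  · exact setLIntegral_congr_fun h.measurableSet_outerRegion
      fun x hx => by simp only [conductorWeight_outer hx]
  · exact setLIntegral_congr_fun h.isOpen_inner.measurableSet
      fun x hx => by simp only [conductorWeight_inner hx]

theorem limitEnergy_eq (β : Eucl n → ℝ) (u : SobolevSpace p Ω) : limitEnergy Ω A β u =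
    ∫⁻ x in outerRegion Ω A, ENNReal.ofReal (β x) * ‖sobGrad u x‖ₑ ^ p := by
  have hp0 : 0 ≤ p := by linarith [hp.out]
  refine lintegral_congr fun x => ?_
  rw [ENNReal.ofReal_mul' (by positivity), ← ofReal_norm,
    ENNReal.ofReal_rpow_of_nonneg (norm_nonneg _) hp0]

theorem IsConductorGeometry.aemeasurable_enorm_sobGrad (h : IsConductorGeometry Ω A)
    (u : SobolevSpace p Ω) :
    AEMeasurable (fun x => ‖sobGrad u x‖ₑ ^ p) (volume.restrict (outerRegion Ω A)) ∧
      AEMeasurable (fun x => ‖sobGrad u x‖ₑ ^ p) (volume.restrict A) := by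
  have h1 := (aestronglyMeasurable_sobGrad u).enorm.pow_const p
  exact ⟨h1.mono_set sdiff_subset, h1.mono_set h.inner_subset⟩

/-- A finite supremum of the weighted energies forces the gradient to vanish in the inner
region. -/
theorem IsConductorGeometry.sobGrad_eq_zero_of_iSup_ne_top (h : IsConductorGeometry Ω A)
    {u : SobolevSpace p Ω} (hu : ⨆ k, gradEnergy (conductorWeight Ω A a k) u ≠ ⊤) :
    ∀ᵐ x ∂(volume.restrict A), sobGrad u x = 0 := by
  have hp0 : 0 < p := by linarith [hp.out]
  have h1 : ∀ k : ℕ, (k : ℝ≥0∞) * ∫⁻ x in A, ‖sobGrad u x‖ₑ ^ p ≤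
      ⨆ k, gradEnergy (conductorWeight Ω A a k) u := by
    intro k
    refine le_trans ?_ (le_iSup _ k)
    rw [h.gradEnergy_conductorWeight, lintegral_const_mul' _ _ ENNReal.coe_ne_top]
    refine le_trans ?_ le_add_self
    gcongr
    push_cast
    exact le_self_add
  have h2 : ∫⁻ x in A, ‖sobGrad u x‖ₑ ^ p = 0 := by
    by_contra h0
    obtain ⟨k, hk⟩ := ENNReal.exists_nat_mul_gt h0 hu
    exact absurd (h1 k) (not_le.2 hk)
  filter_upwards [(lintegral_eq_zero_iff' (h.aemeasurable_enorm_sobGrad u).2).1 h2] with x hx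
  simpa [hp0, hp0.not_gt, hp0.ne'] using hx

/-- If the gradient vanishes in the inner region, then the weighted energies increase to the
limiting energy. -/
theorem IsConductorGeometry.iSup_gradEnergy (h : IsConductorGeometry Ω A)
    (ha : ∀ k, AEMeasurable (a k) (volume.restrict (outerRegion Ω A)))
    (hmono : ∀ x, Monotone fun k => a k x) {β : Eucl n → ℝ}
    (hβ : ∀ᵐ x ∂(volume.restrict (outerRegion Ω A)), ⨆ k, a k x = ENNReal.ofReal (β x))
    {u : SobolevSpace p Ω} (hu : ∀ᵐ x ∂(volume.restrict A), sobGrad u x = 0) :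
    ⨆ k, gradEnergy (conductorWeight Ω A a k) u = limitEnergy Ω A β u := by
  have hp0 : 0 < p := by linarith [hp.out]
  have h0 : ∀ k : ℕ, ∫⁻ x in A, ((k + 1 : ℝ≥0) : ℝ≥0∞) * ‖sobGrad u x‖ₑ ^ p = 0 := fun k =>
    lintegral_eq_zero_of_ae_eq_zero (by filter_upwards [hu] with x hx; simp [hx, hp0])
  simp only [h.gradEnergy_conductorWeight, h0, add_zero]
  have hm : ∀ k, AEMeasurable (fun x => a k x * ‖sobGrad u x‖ₑ ^ p)
      (volume.restrict (outerRegion Ω A)) := fun k => (ha k).mul (h.aemeasurable_enorm_sobGrad u).1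
  rw [limitEnergy_eq, ← lintegral_iSup' hm]
  · refine lintegral_congr_ae ?_
    filter_upwards [hβ] with x hx
    rw [← hx, ENNReal.iSup_mul]
  · exact Eventually.of_forall fun x i j hij => mul_le_mul_left (hmono x hij) _

/-- Existence for the limiting problem, and strong convergence of the families whose weighted
energies do not exceed the limiting energy asymptotically. -/
theorem IsConductorGeometry.exists_isLimitSolution (h : IsConductorGeometry Ω A) (hn : 0 < n)
    {c₀ D : ℝ≥0} (hc₀ : 0 < c₀)
    (ha : ∀ k, AEMeasurable (a k) (volume.restrict (outerRegion Ω A)))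
    (hmono : ∀ x, Monotone fun k => a k x)
    (hbd : ∀ k, ∀ᵐ x ∂(volume.restrict (outerRegion Ω A)), (c₀ : ℝ≥0∞) ≤ a k x ∧ a k x ≤ D)
    {β : Eucl n → ℝ}
    (hβ : ∀ᵐ x ∂(volume.restrict (outerRegion Ω A)), ⨆ k, a k x = ENNReal.ofReal (β x))
    (f : SobolevSpace p Ω) :
    ∃ w, IsLimitSolution Ω A β f w ∧ limitEnergy Ω A β w ≠ ⊤ ∧
      ∀ {ι : Type} (l : Filter ι) (v : ι → SobolevSpace p Ω), (∀ᶠ i in l, SameTrace (v i) f) →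
        (∀ k, ∀ t, limitEnergy Ω A β w < t →
          ∀ᶠ i in l, gradEnergy (conductorWeight Ω A a k) (v i) < t) → Tendsto v l (𝓝 w) := by
  have hlower : ∀ k, ∀ᵐ x ∂(volume.restrict Ω),
      ((min c₀ 1 : ℝ≥0) : ℝ≥0∞) ≤ conductorWeight Ω A a k x := by
    refine fun k => h.ae_domain ?_ ?_
    · filter_upwards [hbd k, ae_restrict_mem h.measurableSet_outerRegion] with x hx hxB
      rw [conductorWeight_outer hxB]
      exact (ENNReal.coe_le_coe.2 (min_le_left _ _)).trans hx.1
    · filter_upwards [ae_restrict_mem h.isOpen_inner.measurableSet] with x hx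
      rw [conductorWeight_inner hx]
      exact ENNReal.coe_le_coe.2 ((min_le_right _ _).trans le_add_self)
  have htop : ∀ k, ∀ᵐ x ∂(volume.restrict Ω), conductorWeight Ω A a k x ≠ ⊤ := by
    refine fun k => h.ae_domain ?_ ?_
    · filter_upwards [hbd k, ae_restrict_mem h.measurableSet_outerRegion] with x hx hxB
      rw [conductorWeight_outer hxB]
      exact ne_top_of_le_ne_top ENNReal.coe_ne_top hx.2
    · filter_upwards [ae_restrict_mem h.isOpen_inner.measurableSet] with x hx
      rw [conductorWeight_inner hx]
      exact ENNReal.coe_ne_top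
  have hmeas := h.aemeasurable_conductorWeight ha
  have hsup := fun u hu => h.iSup_gradEnergy (p := p) ha hmono hβ (u := u) hu
  have hfin : ∀ u : SobolevSpace p Ω, limitEnergy Ω A β u ≠ ⊤ := by
    intro u
    rw [limitEnergy_eq]
    have h1 : ∫⁻ x in outerRegion Ω A, (D : ℝ≥0∞) * ‖sobGrad u x‖ₑ ^ p ≠ ⊤ := by
      rw [lintegral_const_mul' _ _ ENNReal.coe_ne_top]
      exact ENNReal.mul_ne_top ENNReal.coe_ne_top (ne_top_of_le_ne_top
        (lintegral_rpow_ne_top u.1.2) (lintegral_mono_set sdiff_subset))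
    refine ne_top_of_le_ne_top h1 (lintegral_mono_ae ?_)
    filter_upwards [hβ, ae_all_iff.2 hbd] with x hx hb
    rw [← hx]
    gcongr
    exact iSup_le fun k => (hb k).2
  obtain ⟨u₀, hu₀⟩ := perfectConductorClass_nonempty h.isOpen_domain h.volume_domain_ne_top
    h.isOpen_inner (Metric.isCompact_of_isClosed_isBounded isClosed_closure
      (h.isBounded_domain.subset h.closure_inner_subset)) h.closure_inner_subset f
  -- Minimization runs over all functions with the trace of f. The constraint in `A` is not imposed:
  -- finiteness of the supremum enforces it.
  obtain ⟨w, hwX, hwmin, hw⟩ := (uniformlyConvexSeq_gradEnergy hn h.isOpen_domain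
    h.isBounded_domain hmeas (lt_min hc₀ one_pos) hlower f).exists_minimizer (isClosed_sameTrace f)
    (fun u hu v hv => sameTrace_midpoint hu hv)
    (fun u i j hij => lintegral_mono fun x =>
      mul_le_mul_left (monotone_conductorWeight hmono x hij) _)
    (fun k => lowerSemicontinuous_gradEnergy (hmeas k) (htop k)) (u₀ := u₀) hu₀.1
    (by rw [hsup u₀ hu₀.2]; exact hfin u₀)
  have hw0 : ∀ᵐ x ∂(volume.restrict A), sobGrad w x = 0 := by
    refine h.sobGrad_eq_zero_of_iSup_ne_top (a := a) (ne_top_of_le_ne_top ?_ (hwmin u₀ hu₀.1))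
    rw [hsup u₀ hu₀.2]
    exact hfin u₀
  rw [hsup w hw0] at hw
  refine ⟨w, ⟨⟨hwX, hw0⟩, fun u hu => ?_⟩, hfin w, hw⟩
  change limitEnergy Ω A β w ≤ limitEnergy Ω A β u
  rw [← hsup w hw0, ← hsup u hu.2]
  exact hwmin u hu.1

variable {QB QA : Eucl n → ℝ → ℝ} {R : ℝ≥0}

/-- The weighted energies are bounded by the normalized energies, up to a remainder. -/
theorem IsConductorGeometry.gradEnergy_le_normalizedEnergy (h : IsConductorGeometry Ω A) {k : ℕ}
    {RA : ℝ≥0} (hB : ∀ᵐ x ∂(volume.restrict (outerRegion Ω A)), ∀ E : ℝ, 0 ≤ E →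
      a k x * ENNReal.ofReal E ^ p ≤ ENNReal.ofReal (QB x E) + R)
    (hA : ∀ᵐ x ∂(volume.restrict A), ∀ E : ℝ, 0 ≤ E →
      ((k + 1 : ℝ≥0) : ℝ≥0∞) * ENNReal.ofReal E ^ p ≤ ENNReal.ofReal (QA x E) + RA)
    {lam : ℝ} (hlam : 0 < lam) (u : SobolevSpace p Ω) :
    gradEnergy (conductorWeight Ω A a k) u ≤ normalizedEnergy Ω A QB QA lam u +
      ENNReal.ofReal (1 / lam ^ p) * (R * volume (outerRegion Ω A) + RA * volume A) := by
  have hp0 : 0 ≤ p := by linarith [hp.out]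
  have h1 := lintegral_mul_enorm_rpow_le hp0 hB hlam (sobGrad u)
  have h2 := lintegral_mul_enorm_rpow_le hp0 hA hlam (sobGrad u)
  rw [Measure.restrict_apply_univ] at h1 h2
  rw [h.gradEnergy_conductorWeight]
  refine (add_le_add h1 h2).trans_eq ?_
  rw [normalizedEnergy]
  ring

/-- The normalized energy of a function with vanishing gradient in the inner region is bounded by
a weighted energy, up to a remainder. -/
theorem normalizedEnergy_le_of_sobGrad_eq_zero {b : Eucl n → ℝ≥0∞}
    (hB : ∀ᵐ x ∂(volume.restrict (outerRegion Ω A)), ∀ E : ℝ, 0 ≤ E →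
      ENNReal.ofReal (QB x E) ≤ b x * ENNReal.ofReal E ^ p + R)
    (hA : ∀ᵐ x ∂(volume.restrict A), QA x 0 = 0) {lam : ℝ} (hlam : 0 < lam)
    {u : SobolevSpace p Ω} (hu : ∀ᵐ x ∂(volume.restrict A), sobGrad u x = 0) :
    normalizedEnergy Ω A QB QA lam u ≤ (∫⁻ x in outerRegion Ω A, b x * ‖sobGrad u x‖ₑ ^ p) +
      ENNReal.ofReal (1 / lam ^ p) * (R * volume (outerRegion Ω A)) := by
  have h0 : ∫⁻ x in A, ENNReal.ofReal (QA x (lam * ‖sobGrad u x‖)) = 0 :=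
    lintegral_eq_zero_of_ae_eq_zero (by filter_upwards [hA, hu] with x h1 h2; simp [h1, h2])
  rw [normalizedEnergy, h0, add_zero]
  have h1 := mul_lintegral_le_lintegral_mul_enorm_rpow (p := p) (by linarith [hp.out]) hB hlam
    (sobGrad u)
  rwa [Measure.restrict_apply_univ] at h1

theorem tendsto_ofReal_one_div_rpow_mul {s : ℝ} (hs : 0 < s) {M : ℝ≥0∞} (hM : M ≠ ⊤) :
    Tendsto (fun lam : ℝ => ENNReal.ofReal (1 / lam ^ s) * M) atTop (𝓝 0) := by
  have h1 : Tendsto (fun lam : ℝ => 1 / lam ^ s) atTop (𝓝 0) := by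
    simp only [one_div]
    exact (tendsto_rpow_atTop hs).inv_tendsto_atTop
  have h2 := ENNReal.Tendsto.mul_const (ENNReal.tendsto_ofReal h1) (Or.inr hM)
  simpa using h2

/-- Dominated convergence; the uniform bound D on the weights gives the dominating function. -/
theorem IsConductorGeometry.tendsto_lintegral_upper_weights (h : IsConductorGeometry Ω A)
    {b : ℕ → Eucl n → ℝ≥0∞} {D : ℝ≥0}
    (hb : ∀ k, AEMeasurable (b k) (volume.restrict (outerRegion Ω A)))
    (hbD : ∀ k, ∀ᵐ x ∂(volume.restrict (outerRegion Ω A)), b k x ≤ D) {β : Eucl n → ℝ}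
    (hβ : ∀ᵐ x ∂(volume.restrict (outerRegion Ω A)),
      Tendsto (fun k => b k x) atTop (𝓝 (ENNReal.ofReal (β x)))) (u : SobolevSpace p Ω) :
    Tendsto (fun k => ∫⁻ x in outerRegion Ω A, b k x * ‖sobGrad u x‖ₑ ^ p) atTop
      (𝓝 (limitEnergy Ω A β u)) := by
  have hp0 : 0 ≤ p := by linarith [hp.out]
  rw [limitEnergy_eq]
  refine tendsto_lintegral_of_dominated_convergence' (fun x => D * ‖sobGrad u x‖ₑ ^ p)
    (fun k => (hb k).mul (h.aemeasurable_enorm_sobGrad u).1) (fun k => ?_) ?_ ?_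
  · filter_upwards [hbD k] with x hx
    gcongr
  · rw [lintegral_const_mul' _ _ ENNReal.coe_ne_top]
    exact ENNReal.mul_ne_top ENNReal.coe_ne_top (ne_top_of_le_ne_top
      (lintegral_rpow_ne_top u.1.2) (lintegral_mono_set sdiff_subset))
  · filter_upwards [hβ] with x hx
    exact ENNReal.Tendsto.mul_const hx (Or.inr (ENNReal.rpow_ne_top_of_nonneg hp0 enorm_ne_top))

end Conductor

end

noncomputable section

/-! ### Higher integrability and convergence in the inner region -/

section InnerRegularity

variable {n : ℕ} {Ω A : Set (Eucl n)} {p q : ℝ} [hp : Fact (1 < p)] [hq : Fact (1 < q)]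

/-- In the inner region, the `L^q` norm of the gradient is controlled by the normalized energy. -/
theorem lintegral_inner_rpow_le_normalizedEnergy {QB QA : Eucl n → ℝ → ℝ} {c C E₀ : ℝ}
    (hc : 0 ≤ c) (hE₀ : 0 < E₀) (hA : HasGrowth A QA q c C E₀) {lam : ℝ} (hlam : 0 < lam)
    (u : SobolevSpace p Ω) :
    ENNReal.ofReal (c / E₀ ^ q) * ∫⁻ x in A, ‖sobGrad u x‖ₑ ^ q ≤
      ENNReal.ofReal (1 / lam ^ (q - p)) * normalizedEnergy Ω A QB QA lam u +
        ENNReal.ofReal (1 / lam ^ q) * (ENNReal.ofReal c * volume A) := by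
  have hq0 : 0 ≤ q := by linarith [hq.out]
  have h1 := lintegral_mul_enorm_rpow_le (ν := volume.restrict A) hq0 (Q := QA)
    (b := fun _ => ENNReal.ofReal (c / E₀ ^ q)) (C := ENNReal.ofReal c) (by
      filter_upwards [hA] with x hx E hE
      exact mul_rpow_le_of_growth hq0 hc hE₀ hE (hx E hE).1) hlam (sobGrad u)
  rw [lintegral_const_mul' _ _ ENNReal.ofReal_ne_top, Measure.restrict_apply_univ, mul_add] at h1
  refine h1.trans (add_le_add_left ?_ _)
  -- The energy is normalized by λ^p while the inner density grows with order q; the surplus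
  -- λ^{-(q-p)} drives the gradient to zero.
  have h2 : ENNReal.ofReal (1 / lam ^ q) =
      ENNReal.ofReal (1 / lam ^ (q - p)) * ENNReal.ofReal (1 / lam ^ p) := by
    rw [← ENNReal.ofReal_mul (by positivity), one_div_mul_one_div, ← Real.rpow_add hlam,
      sub_add_cancel]
  rw [h2, mul_assoc, normalizedEnergy, mul_add (ENNReal.ofReal (1 / lam ^ p))]
  gcongr
  exact le_add_self

theorem memLp_of_lintegral_rpow_ne_top {α F : Type*} [MeasurableSpace α] [NormedAddCommGroup F]
    {μ : Measure α} {g : α → F} (hg : AEStronglyMeasurable g μ) (h : ∫⁻ x, ‖g x‖ₑ ^ q ∂μ ≠ ⊤) :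
    MemLp g (ENNReal.ofReal q) μ := by
  have hq0 : 0 < q := by linarith [hq.out]
  refine ⟨hg, lt_top_iff_ne_top.2 fun htop => h ?_⟩
  rw [← eLpNorm_ofReal_rpow μ g hq0, htop, ENNReal.top_rpow_of_pos hq0]

/-- If the gradient of `u ∈ W^{1,p}(Ω)` is in `L^q(A)`, then the restriction of `u` to `A` belongs
to `W^{1,q}(A)`. -/
theorem HasLipschitzBoundary.exists_sobolevSpace_restrict (h : HasLipschitzBoundary A)
    (hA : IsOpen A) (hAΩ : A ⊆ Ω) (hΩ : Bornology.IsBounded Ω) {u : SobolevSpace p Ω}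
    (hu : ∫⁻ x in A, ‖sobGrad u x‖ₑ ^ q ≠ ⊤) :
    ∃ uA : SobolevSpace q A, sobFun uA =ᵐ[volume.restrict A] sobFun u ∧
      sobGrad uA =ᵐ[volume.restrict A] sobGrad u := by
  have hq0 : 0 ≤ q := by linarith [hq.out]
  have hΩt : volume Ω ≠ ⊤ := hΩ.measure_lt_top.ne
  have h1 : IntegrableOn (sobFun u) A := (integrableOn_Lp hΩt u.1.1).mono_set hAΩ
  have h2 : IntegrableOn (sobGrad u) A := (integrableOn_Lp hΩt u.1.2).mono_set hAΩ
  have h3 : HasWeakGradient A (sobFun u) (sobGrad u) := (hasWeakGradient_sob u).mono hAΩ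
  obtain ⟨C, hC⟩ := h.exists_lintegral_rpow_le hA (hΩ.subset hAΩ) hq.out
  have h4 : ∫⁻ x in A, ‖sobFun u x‖ₑ ^ q ≠ ⊤ :=
    ne_top_of_le_ne_top (ENNReal.mul_ne_top ENNReal.coe_ne_top (ENNReal.add_ne_top.2
      ⟨hu, ENNReal.rpow_ne_top_of_nonneg hq0 h1.2.ne⟩)) (hC _ _ h1 h2 h3)
  have m1 := memLp_of_lintegral_rpow_ne_top h1.1 h4
  have m2 := memLp_of_lintegral_rpow_ne_top h2.1 hu
  exact ⟨sobMk m1 m2 h3, sobFun_sobMk m1 m2 h3, sobGrad_sobMk m1 m2 h3⟩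

/-- Supplies the L^1 term of the L^q estimate in `A` from W^{1,p}(Ω) alone. -/
theorem lintegral_enorm_sobFun_rpow_le (hAΩ : A ⊆ Ω) (u : SobolevSpace p Ω) :
    (∫⁻ x in A, ‖sobFun u x‖ₑ) ^ p ≤ volume A ^ (p - 1) * ‖u‖ₑ ^ p := by
  have hp0 : 0 ≤ p := by linarith [hp.out]
  have hm : AEStronglyMeasurable (sobFun u) (volume.restrict A) := (Lp.memLp u.1.1).1.mono_set hAΩ
  refine (lintegral_rpow_le_measure_univ_mul _ hm.enorm hp.out).trans ?_
  rw [Measure.restrict_apply_univ]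
  gcongr
  calc ∫⁻ x in A, ‖sobFun u x‖ₑ ^ p ≤ ∫⁻ x in Ω, ‖sobFun u x‖ₑ ^ p := lintegral_mono_set hAΩ
    _ = ‖u.1.1‖ₑ ^ p := (enorm_Lp_rpow u.1.1).symm
    _ ≤ ‖u‖ₑ ^ p := by
        refine ENNReal.rpow_le_rpow ?_ hp0
        exact enorm_le_iff_norm_le.2 (norm_fst_le u.1)

theorem tendsto_of_tendsto_enorm_sub_rpow {E ι : Type*} [NormedAddCommGroup E] {s : ℝ} (hs : 0 < s)
    {l : Filter ι} {v : ι → E} {w : E} (h : Tendsto (fun i => ‖v i - w‖ₑ ^ s) l (𝓝 0)) :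
    Tendsto v l (𝓝 w) := by
  rw [tendsto_iff_edist_tendsto_0]
  have h1 := (ENNReal.continuous_rpow_const (y := s⁻¹)).tendsto 0 |>.comp h
  rw [ENNReal.zero_rpow_of_pos (inv_pos.2 hs)] at h1
  refine h1.congr fun i => ?_
  rw [Function.comp_apply, ENNReal.rpow_rpow_inv hs.ne', edist_eq_enorm_sub]

theorem tendsto_lintegral_enorm_sobFun_sub (hAΩ : A ⊆ Ω) (hA : volume A ≠ ⊤) {ι : Type*}
    {l : Filter ι} {v : ι → SobolevSpace p Ω} {w : SobolevSpace p Ω} (hv : Tendsto v l (𝓝 w)) :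
    Tendsto (fun i => ∫⁻ x in A, ‖sobFun (v i - w) x‖ₑ) l (𝓝 0) := by
  have hp0 : 0 < p := by linarith [hp.out]
  have h1 : Tendsto (fun i => ‖v i - w‖ₑ) l (𝓝 0) := by
    simpa only [edist_eq_enorm_sub] using tendsto_iff_edist_tendsto_0.1 hv
  have h2 := (ENNReal.continuous_rpow_const (y := p)).tendsto 0 |>.comp h1
  rw [ENNReal.zero_rpow_of_pos hp0] at h2
  have h3 := ENNReal.Tendsto.const_mul (a := volume A ^ (p - 1)) h2
    (Or.inr (ENNReal.rpow_ne_top_of_nonneg (by linarith [hp.out]) hA))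
  rw [mul_zero] at h3
  have h4 := tendsto_of_tendsto_of_tendsto_of_le_of_le tendsto_const_nhds h3
    (fun i => zero_le) fun i => lintegral_enorm_sobFun_rpow_le hAΩ (v i - w)
  have h5 := (ENNReal.continuous_rpow_const (y := p⁻¹)).tendsto 0 |>.comp h4
  rw [ENNReal.zero_rpow_of_pos (inv_pos.2 hp0)] at h5
  refine h5.congr fun i => ?_
  rw [Function.comp_apply, ENNReal.rpow_rpow_inv hp0.ne']

theorem enorm_sub_rpow_eq_lintegral {v w : SobolevSpace p Ω} {vA wA : SobolevSpace q A}
    (hv : sobGrad vA =ᵐ[volume.restrict A] sobGrad v)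
    (hw : sobGrad wA =ᵐ[volume.restrict A] sobGrad w) :
    ‖vA.1.2 - wA.1.2‖ₑ ^ q = ∫⁻ x in A, ‖sobGrad v x - sobGrad w x‖ₑ ^ q := by
  rw [enorm_Lp_rpow]
  refine lintegral_congr_ae ?_
  filter_upwards [hv, hw, sobGrad_sub vA wA] with x h1 h2 h3
  rw [← h1, ← h2, ← h3]
  rfl

theorem lintegral_enorm_sobFun_sub (hAΩ : A ⊆ Ω) {v w : SobolevSpace p Ω}
    {vA wA : SobolevSpace q A} (hv : sobFun vA =ᵐ[volume.restrict A] sobFun v)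
    (hw : sobFun wA =ᵐ[volume.restrict A] sobFun w) :
    ∫⁻ x in A, ‖sobFun (vA - wA) x‖ₑ = ∫⁻ x in A, ‖sobFun (v - w) x‖ₑ := by
  have hmono := ae_mono (Measure.restrict_mono_set (volume : Measure (Eucl n)) hAΩ)
  refine lintegral_congr_ae ?_
  filter_upwards [hv, hw, sobFun_sub vA wA, hmono (sobFun_sub v w)] with x h1 h2 h3 h4
  rw [h3, h4, h1, h2]

theorem HasLipschitzBoundary.exists_enorm_fst_rpow_le (h : HasLipschitzBoundary A)
    (hA : IsOpen A) (hAb : Bornology.IsBounded A) :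
    ∃ C : ℝ≥0, ∀ z : SobolevSpace q A,
      ‖z.1.1‖ₑ ^ q ≤ C * (‖z.1.2‖ₑ ^ q + (∫⁻ x in A, ‖sobFun z x‖ₑ) ^ q) := by
  obtain ⟨C, hC⟩ := h.exists_lintegral_rpow_le hA hAb hq.out
  refine ⟨C, fun z => ?_⟩
  rw [enorm_Lp_rpow, enorm_Lp_rpow]
  exact hC _ _ (integrableOn_Lp hAb.measure_lt_top.ne z.1.1)
    (integrableOn_Lp hAb.measure_lt_top.ne z.1.2) (hasWeakGradient_sob z)

theorem SobolevSpace.tendsto_of_tendsto_fst_snd {ι : Type*} {l : Filter ι}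
    {v : ι → SobolevSpace p Ω} {w : SobolevSpace p Ω}
    (h1 : Tendsto (fun i => (v i).1.1) l (𝓝 w.1.1))
    (h2 : Tendsto (fun i => (v i).1.2) l (𝓝 w.1.2)) : Tendsto v l (𝓝 w) :=
  tendsto_subtype_rng.2 (h1.prodMk_nhds h2)

/-- Convergence in `W^{1,p}(Ω)` and of the gradients in `L^q(A)` implies convergence of the
restrictions in `W^{1,q}(A)`. -/
theorem HasLipschitzBoundary.tendsto_restrict (h : HasLipschitzBoundary A)
    (hA : IsOpen A) (hAΩ : A ⊆ Ω) (hΩ : Bornology.IsBounded Ω) {ι : Type*} {l : Filter ι}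
    {v : ι → SobolevSpace p Ω} {w : SobolevSpace p Ω} {vA : ι → SobolevSpace q A}
    {wA : SobolevSpace q A}
    (hvA : ∀ᶠ i in l, sobFun (vA i) =ᵐ[volume.restrict A] sobFun (v i) ∧
      sobGrad (vA i) =ᵐ[volume.restrict A] sobGrad (v i))
    (hwA : sobFun wA =ᵐ[volume.restrict A] sobFun w ∧
      sobGrad wA =ᵐ[volume.restrict A] sobGrad w) (hv : Tendsto v l (𝓝 w))
    (hg : Tendsto (fun i => ∫⁻ x in A, ‖sobGrad (v i) x - sobGrad w x‖ₑ ^ q) l (𝓝 0)) :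
    Tendsto vA l (𝓝 wA) := by
  have hq0 : 0 < q := by linarith [hq.out]
  obtain ⟨C, hC⟩ := h.exists_enorm_fst_rpow_le (q := q) hA (hΩ.subset hAΩ)
  have t2 : Tendsto (fun i => ‖(vA i).1.2 - wA.1.2‖ₑ ^ q) l (𝓝 0) := by
    refine hg.congr' ?_
    filter_upwards [hvA] with i hi
    exact (enorm_sub_rpow_eq_lintegral hi.2 hwA.2).symm
  have t3 := tendsto_lintegral_enorm_sobFun_sub hAΩ (hΩ.subset hAΩ).measure_lt_top.ne hv
  have t4 := (ENNReal.continuous_rpow_const (y := q)).tendsto 0 |>.comp t3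
  rw [ENNReal.zero_rpow_of_pos hq0] at t4
  have t5 := ENNReal.Tendsto.const_mul (a := (C : ℝ≥0∞)) (t2.add t4) (Or.inr ENNReal.coe_ne_top)
  rw [add_zero, mul_zero] at t5
  have t1 : Tendsto (fun i => ‖(vA i).1.1 - wA.1.1‖ₑ ^ q) l (𝓝 0) := by
    refine tendsto_of_tendsto_of_tendsto_of_le_of_le' tendsto_const_nhds t5
      (Eventually.of_forall fun i => zero_le) ?_
    filter_upwards [hvA] with i hi
    have h1 := hC (vA i - wA)
    rwa [lintegral_enorm_sobFun_sub hAΩ hi.1 hwA.1] at h1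
  exact SobolevSpace.tendsto_of_tendsto_fst_snd (tendsto_of_tendsto_enorm_sub_rpow hq0 t1)
    (tendsto_of_tendsto_enorm_sub_rpow hq0 t2)

end InnerRegularity

end

/-! ### The main theorem -/

set_option maxHeartbeats 4000000 in
theorem mainTheorem4 {n : ℕ} (hn : 2 ≤ n) (p q : ℝ) [Fact (1 < p)] [Fact (1 < q)] (hpq : p < q)
    (Ω A : Set (Eucl n)) (hgeom : IsConductorGeometry Ω A)
    (QB QA : Eucl n → ℝ → ℝ)
    (hA1B : IsCaratheodory (outerRegion Ω A) QB) (hA1A : IsCaratheodory A QA)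
    (hA2B : IsConvexDensity (outerRegion Ω A) QB) (hA2A : IsConvexDensity A QA)
    (hA3 : ∃ c C E₀ : ℝ, 0 < c ∧ c ≤ C ∧ 0 < E₀ ∧
      HasGrowth (outerRegion Ω A) QB p c C E₀ ∧ HasGrowth A QA q c C E₀)
    (β : Eucl n → ℝ) (hA4 : HasAsymptoticGrowth (outerRegion Ω A) QB p β)
    (f : SobolevSpace p Ω)
    (v : ℝ → SobolevSpace p Ω)
    (hv : ∀ lam : ℝ, 0 < lam → IsNormalizedSolution Ω A QB QA f lam (v lam)) :
    ∃ w : SobolevSpace p Ω,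
      IsLimitSolution Ω A β f w ∧
      (∀ w' : SobolevSpace p Ω, IsLimitSolution Ω A β f w' → w' = w) ∧
      (∀ x ∈ A, ∃ c : ℝ, ∀ᵐ y ∂(volume.restrict (connectedComponentIn A x)), sobFun w y = c) ∧
      Tendsto (fun lam : ℝ => toWeakSpace ℝ (SobolevSpace p Ω) (v lam)) atTop
        (𝓝 (toWeakSpace ℝ (SobolevSpace p Ω) w)) ∧
      ∃ (vA : ℝ → SobolevSpace q A) (wA : SobolevSpace q A),
        (∀ lam : ℝ, 0 < lam → sobFun (vA lam) =ᵐ[volume.restrict A] sobFun (v lam)) ∧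
        sobFun wA =ᵐ[volume.restrict A] sobFun w ∧
        Tendsto vA atTop (𝓝 wA) := by
  obtain ⟨c, C, E₀, hc, hcC, hE₀, hgB, hgA⟩ := hA3
  have hp : 1 < p := Fact.out
  have hq : 1 < q := Fact.out
  obtain ⟨a, c₀, D, R, hc₀, ham, hmono, hbd, hsup, hlow⟩ :=
    exists_lower_weights hp hA1B hc hcC hE₀ hgB hA4
  obtain ⟨b, D', R', hbm, hbD, hblim, hup⟩ :=
    exists_upper_weights hp hA1B (hc.le.trans hcC) hE₀ hgB hA4
  obtain ⟨w, hw, hwt, hconv⟩ :=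
    hgeom.exists_isLimitSolution (by omega) hc₀ ham hmono hbd hsup f
  have hQA0 : ∀ᵐ x ∂(volume.restrict A), QA x 0 = 0 := hA2A.mono fun x hx => hx.2.2.2
  -- Minimality of `v lam` against `w`, whose inner contribution vanishes because Q_A(x,0) = 0.
  have hGw : ∀ k, ∀ lam : ℝ, 0 < lam → normalizedEnergy Ω A QB QA lam (v lam) ≤
      (∫⁻ x in outerRegion Ω A, b k x * ‖sobGrad w x‖ₑ ^ p) +
        ENNReal.ofReal (1 / lam ^ p) * (R' k * volume (outerRegion Ω A)) := fun k lam hlam =>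
    ((hv lam hlam).2 hw.1.1).trans
      (normalizedEnergy_le_of_sobGrad_eq_zero (hup k) hQA0 hlam hw.1.2)
  have hblim' := hgeom.tendsto_lintegral_upper_weights hbm hbD hblim w
  have hvw : Tendsto v atTop (𝓝 w) := by
    refine hconv atTop v ?_ fun k t ht => ?_
    · filter_upwards [eventually_gt_atTop 0] with lam hlam
      exact (hv lam hlam).1
    -- The index j of the upper weight is fixed before λ → ∞, so that the remainders depending on j
    -- and k both vanish.
    · obtain ⟨j, hj⟩ := (hblim'.eventually (gt_mem_nhds ht)).exists
      choose RA hRA using fun M : ℝ≥0 => exists_mul_rpow_le_growth (p := p) (by linarith) hpq hc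
        hE₀ M
      have hlowA : ∀ᵐ x ∂(volume.restrict A), ∀ E : ℝ, 0 ≤ E →
          ((k + 1 : ℝ≥0) : ℝ≥0∞) * ENNReal.ofReal E ^ p ≤
            ENNReal.ofReal (QA x E) + RA (k + 1) := by
        filter_upwards [hgA] with x hx E hE
        exact hRA _ E _ hE (hx E hE).1
      have hVB := hgeom.volume_outer_ne_top
      have hVA := hgeom.volume_inner_ne_top
      have t1 := tendsto_ofReal_one_div_rpow_mul (s := p) (by linarith)
        (ENNReal.mul_ne_top (ENNReal.coe_ne_top (r := R' j)) hVB)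
      have t2 := tendsto_ofReal_one_div_rpow_mul (s := p) (by linarith) (ENNReal.add_ne_top.2
        ⟨ENNReal.mul_ne_top (ENNReal.coe_ne_top (r := R k)) hVB,
          ENNReal.mul_ne_top (ENNReal.coe_ne_top (r := RA (k + 1))) hVA⟩)
      have t3 := (t1.const_add (∫⁻ x in outerRegion Ω A, b j x * ‖sobGrad w x‖ₑ ^ p)).add t2
      rw [add_zero, add_zero] at t3
      filter_upwards [eventually_gt_atTop 0, t3.eventually (gt_mem_nhds hj)] with lam hlam hlt
      refine lt_of_le_of_lt ?_ hlt
      exact (hgeom.gradEnergy_le_normalizedEnergy (hlow k) hlowA hlam (v lam)).trans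
        (add_le_add_left (hGw j lam hlam) _)
  -- Any j with finite upper energy of `w` bounds the normalized energies for large λ.
  obtain ⟨j, hj⟩ := (hblim'.eventually (gt_mem_nhds (lt_top_iff_ne_top.2 hwt))).exists
  have hAΩ := hgeom.inner_subset
  have hVA := hgeom.volume_inner_ne_top
  have hκ0 : ENNReal.ofReal (c / E₀ ^ q) ≠ 0 :=
    (ENNReal.ofReal_pos.2 (div_pos hc (Real.rpow_pos_of_pos hE₀ q))).ne'
  have hgrad : ∀ lam : ℝ, 0 < lam → ∫⁻ x in A, ‖sobGrad (v lam) x‖ₑ ^ q ≤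
      (ENNReal.ofReal (c / E₀ ^ q))⁻¹ * (ENNReal.ofReal (1 / lam ^ (q - p)) *
        ((∫⁻ x in outerRegion Ω A, b j x * ‖sobGrad w x‖ₑ ^ p) +
          ENNReal.ofReal (1 / lam ^ p) * (R' j * volume (outerRegion Ω A))) +
        ENNReal.ofReal (1 / lam ^ q) * (ENNReal.ofReal c * volume A)) := by
    intro lam hlam
    have h1 := lintegral_inner_rpow_le_normalizedEnergy (QB := QB) hc.le hE₀ hgA hlam (v lam)
    rw [ENNReal.mul_le_iff_le_inv hκ0 ENNReal.ofReal_ne_top] at h1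
    refine h1.trans ?_
    gcongr
    exact hGw j lam hlam
  have hR' : R' j * volume (outerRegion Ω A) ≠ ⊤ :=
    ENNReal.mul_ne_top ENNReal.coe_ne_top hgeom.volume_outer_ne_top
  have hcA : ENNReal.ofReal c * volume A ≠ ⊤ := ENNReal.mul_ne_top ENNReal.ofReal_ne_top hVA
  have hgfin : ∀ lam : ℝ, 0 < lam → ∫⁻ x in A, ‖sobGrad (v lam) x‖ₑ ^ q ≠ ⊤ := by
    intro lam hlam
    refine ne_top_of_le_ne_top (ENNReal.mul_ne_top (ENNReal.inv_ne_top.2 hκ0)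
      (ENNReal.add_ne_top.2 ⟨ENNReal.mul_ne_top ENNReal.ofReal_ne_top
        (ENNReal.add_ne_top.2 ⟨hj.ne, ENNReal.mul_ne_top ENNReal.ofReal_ne_top hR'⟩),
        ENNReal.mul_ne_top ENNReal.ofReal_ne_top hcA⟩)) (hgrad lam hlam)
  have hglim : Tendsto (fun lam => ∫⁻ x in A, ‖sobGrad (v lam) x‖ₑ ^ q) atTop (𝓝 0) := by
    have t1 := tendsto_ofReal_one_div_rpow_mul (s := q - p) (by linarith)
      (ENNReal.add_ne_top.2 ⟨hj.ne, hR'⟩)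
    have t2 := tendsto_ofReal_one_div_rpow_mul (s := q) (by linarith) hcA
    have t3 := ENNReal.Tendsto.const_mul (a := (ENNReal.ofReal (c / E₀ ^ q))⁻¹) (t1.add t2)
      (Or.inr (ENNReal.inv_ne_top.2 hκ0))
    rw [add_zero, mul_zero] at t3
    refine tendsto_of_tendsto_of_tendsto_of_le_of_le' tendsto_const_nhds t3
      (Eventually.of_forall fun _ => zero_le) ?_
    filter_upwards [eventually_ge_atTop 1] with lam hlam
    have h1 : ENNReal.ofReal (1 / lam ^ p) * (R' j * volume (outerRegion Ω A)) ≤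
        R' j * volume (outerRegion Ω A) := mul_le_of_le_one_left' (ENNReal.ofReal_le_one.2
      (div_le_one_of_le₀ (Real.one_le_rpow hlam (by linarith)) (by positivity)))
    refine (hgrad lam (by linarith)).trans ?_
    gcongr
  have hw0 : ∫⁻ x in A, ‖sobGrad w x‖ₑ ^ q = 0 := by
    refine lintegral_eq_zero_of_ae_eq_zero ?_
    filter_upwards [hw.1.2] with x hx
    simp only [hx, enorm_zero, Pi.zero_apply]
    exact ENNReal.zero_rpow_of_pos (by linarith)
  have hex : ∀ lam : ℝ, ∃ uA : SobolevSpace q A, 0 < lam →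
      sobFun uA =ᵐ[volume.restrict A] sobFun (v lam) ∧
        sobGrad uA =ᵐ[volume.restrict A] sobGrad (v lam) := by
    intro lam
    by_cases hlam : 0 < lam
    · obtain ⟨uA, huA⟩ := hgeom.lipschitz_inner.exists_sobolevSpace_restrict hgeom.isOpen_inner hAΩ
        hgeom.isBounded_domain (hgfin lam hlam)
      exact ⟨uA, fun _ => huA⟩
    · exact ⟨0, fun h => absurd h hlam⟩
  choose vA hvA using hex
  obtain ⟨wA, hwA⟩ := hgeom.lipschitz_inner.exists_sobolevSpace_restrict (q := q)
    hgeom.isOpen_inner hAΩ hgeom.isBounded_domain (u := w) (by rw [hw0]; exact ENNReal.zero_ne_top)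
  refine ⟨w, hw, fun w' hw' => ?_, fun x hx => ?_, ?_, vA, wA, fun lam hlam => (hvA lam hlam).1,
    hwA.1, ?_⟩
  -- A second minimizer, as a constant family, satisfies the convergence criterion, hence tends to
  -- `w`.
  · have hlim : Tendsto (fun _ : ℕ => w') atTop (𝓝 w) := by
      refine hconv atTop _ (Eventually.of_forall fun _ => hw'.1.1) fun k t ht =>
        Eventually.of_forall fun _ => lt_of_le_of_lt ?_ ht
      refine le_trans ?_ (hw'.2 hw.1)
      rw [← hgeom.iSup_gradEnergy ham hmono hsup hw'.1.2]
      exact le_iSup (fun k => gradEnergy (conductorWeight Ω A a k) w') k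
    exact tendsto_nhds_unique tendsto_const_nhds hlim
  · have hVΩ := hgeom.volume_domain_ne_top
    exact ((hasWeakGradient_sob w).mono hAΩ).exists_ae_eq_const hgeom.isOpen_inner
      ((integrableOn_Lp hVΩ w.1.1).mono_set hAΩ) ((integrableOn_Lp hVΩ w.1.2).mono_set hAΩ)
      hw.1.2 hx
  · exact ((toWeakSpaceCLM ℝ (SobolevSpace p Ω)).continuous.tendsto w).comp hvw
  · refine hgeom.lipschitz_inner.tendsto_restrict hgeom.isOpen_inner hAΩ hgeom.isBounded_domain
      ?_ hwA hvw ?_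
    · filter_upwards [eventually_gt_atTop 0] with lam hlam
      exact hvA lam hlam
    · refine hglim.congr fun lam => lintegral_congr_ae ?_
      filter_upwards [hw.1.2] with x hx
      rw [hx, sub_zero]
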